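/- **Setup.** *The desingularized multiple zeta function.* For $s=(s_1,\dots,s_r)\in(\mathbb C\setminus\mathbb Z)^r$ put $$\zeta^{\rm des}_r(s):=\lim_{c\to1,\,c\neq1}\frac1{(1-c)^r}\prod_{k=1}^r\frac1{(e^{2\pi i s_k}-1)\Gamma(s_k)}\int_{\mathcal C^r}\prod_{j=1}^r\Big(\frac1{e^{t_j+\cdots+t_r}-1}-\frac{c}{e^{c(t_j+\cdots+t_r)}-1}\Big)\prod_{k=1}^r t_k^{s_k-1}\,dt_k ,$$ with $c$ real and $\mathcal C$ the Hankel contour: the positive real axis from $+\infty$ to $\varepsilon$ (argument $0$), the circle of radius $\varepsilon$ around $0$ counterclockwise, and the positive real axis from $\varepsilon$ to $+\infty$ (argument $2\pi$), for all sufficiently small $\varepsilon>0$. This function extends (uniquely) to an entire function $\zeta^{\rm des}_r$ on $\mathbb C^r$. *The functions $L^{\rm des}$.* For functions on $(0,1)$ put $J[f](t)=\int_0^t f(z)\frac{dz}z$, $D[f](t)=t f'(t)$ and $J^{-n}:=D^n$ for $n\ge 0$. Put $L^{\rm des}(0)(t)=\frac t{1-t}+\frac{t\log t}{(1-t)^2}$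 and, for $k_1,\dots,k_r\in\mathbb Z$, $$L^{\rm des}(k_1,\dots,k_r)(t)=J^{k_r}\big[L^{\rm des}(0)\,J^{k_{r-1}}[L^{\rm des}(0)\cdots J^{k_1}[L^{\rm des}(0)]\cdots]\big](t),\qquad 0<t<1 .$$ For $r=0$ (empty index) both $L^{\rm des}$ and $\zeta^{\rm des}_0$ are $1$. *The algebra $\mathcal H$.* Let $\mathbb Q\langle d,j,y\rangle$ be the non-commutative polynomial ring in $d,j,y$ with $dj=jd=1$ (so $j^{-k}=d^k$); it has as basis the reduced words $j^{k_1}yj^{k_2}y\cdots yj^{k_n}$, $n\ge1$, $k_i\in\mathbb Z$. The bilinear product $\mathbin{\sqcup\!\sqcup}_0 $ is defined recursively on reduced words by $1\mathbin{\sqcup\!\sqcup}_0 w=w\mathbin{\sqcup\!\sqcup}_0 1=w$, $yu\mathbin{\sqcup\!\sqcup}_0 v=u\mathbin{\sqcup\!\sqcup}_0 yv=y(u\mathbin{\sqcup\!\sqcup}_0 v)$, $ju\mathbin{\sqcup\!\sqcup}_0 jv=j(u\mathbin{\sqcup\!\sqcup}_0 jv)+j(ju\mathbin{\sqcup\!\sqcup}_0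 v)$, $du\mathbin{\sqcup\!\sqcup}_0 dv=d(u\mathbin{\sqcup\!\sqcup}_0 dv)-u\mathbin{\sqcup\!\sqcup}_0 d^2v$, $du\mathbin{\sqcup\!\sqcup}_0 jv=d(u\mathbin{\sqcup\!\sqcup}_0 jv)-u\mathbin{\sqcup\!\sqcup}_0 v$, $ju\mathbin{\sqcup\!\sqcup}_0 dv=d(ju\mathbin{\sqcup\!\sqcup}_0 v)-u\mathbin{\sqcup\!\sqcup}_0 v$. Let $\mathcal T$ be the span of the words $j^{k_1}y\cdots yj^{k_n}$ with $k_n\ne0$, and let $\mathcal B$ be its complement, the span of $1$ and of the words ending in $y$. $\mathcal B$ is closed under $\mathbin{\sqcup\!\sqcup}_0 $. Let $\mathcal L\subset\mathcal B$ be the two-sided ideal of $(\mathcal B,\mathbin{\sqcup\!\sqcup}_0 )$ generated by all $$j^k\{d(u\mathbin{\sqcup\!\sqcup}_0 v)-du\mathbin{\sqcup\!\sqcup}_0 v-u\mathbin{\sqcup\!\sqcup}_0 dv\}\qquad(k\in\mathbb Z,\ u,v\text{ words ending in }y),$$ and put $\mathcal H:=\mathcal B/\mathcal L$ with the product induced by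 $\mathbin{\sqcup\!\sqcup}_0 $. (As a vector space, $\mathcal H=\mathbb Q\langle d,j,y\rangle/(\mathcal T+\mathcal L)$.) **Theorem.** For all $r\ge0$ and $k_1,\dots,k_r\in\mathbb Z$ the limit $\lim_{t\to1-0}L^{\rm des}(k_1,\dots,k_r)(t)$ exists and equals $\zeta^{\rm des}_r(k_1,\dots,k_r)$. There is a unique well-defined $\mathbb Q$-linear map $\zeta^{\rm des}_{\sqcup\!\sqcup}:\mathcal H\to\mathbb R$ with $\zeta^{\rm des}_{\sqcup\!\sqcup}(1)=1$ and $$\zeta^{\rm des}_{\sqcup\!\sqcup}(j^{k_r}y\cdots j^{k_1}y)=\lim_{t\to1-0}L^{\rm des}(k_1,\dots,k_r)(t)=\zeta^{\rm des}_r(k_1,\dots,k_r)$$ for all integers $k_1,\dots,k_r$, and it is a $\mathbb Q$-algebra homomorphism: $\zeta^{\rm des}_{\sqcup\!\sqcup}(xz)=\zeta^{\rm des}_{\sqcup\!\sqcup}(x)\,\zeta^{\rm des}_{\sqcup\!\sqcup}(z)$ for all $x,z\in\mathcal H$. Consequently the shuffle-type formula holds at all integer points: if $j^{k_r}y\cdots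 j^{k_1}y\mathbin{\sqcup\!\sqcup}_0 j^{l_q}y\cdots j^{l_1}y=\sum_m c_m\, j^{m_p}y\cdots j^{m_1}y$ (a finite sum over indices $m=(m_1,\dots,m_p)$), then $$\zeta^{\rm des}_r(k_1,\dots,k_r)\,\zeta^{\rm des}_q(l_1,\dots,l_q)=\sum_m c_m\,\zeta^{\rm des}_p(m_1,\dots,m_p).$$ -/

import Mathlib

open Filter Topology MeasureTheory

noncomputable section

namespace DesMZV

/-! ### The words in `d, j, y` and the ring `ℚ⟨d, j, y⟩` with `dj = jd = 1` -/

/-- The words in the letters `d, j, y` subject to `dj = jd = 1`, in reduced form: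
`j^{k₁} y j^{k₂} y ⋯ y j^{kₙ}` with integers `k₁, …, kₙ` and `n ≥ 1`, where `j^{-k} = d^k`. -/
inductive Word : Type
  /-- The word `j^k`. -/
  | pow (k : ℤ) : Word
  /-- The word `j^k y w`. -/
  | powY (k : ℤ) (w : Word) : Word

namespace Word

/-- `j^a w` in reduced form. -/
def shift (a : ℤ) : Word → Word
  | pow b => pow (a + b)
  | powY b w => powY (a + b) w

/-- Concatenation of words (followed by reduction). -/
def concat : Word → Word → Word
  | pow a, v => shift a v
  | powY a u, v => powY a (concat u v)

instance : One Word := ⟨pow 0⟩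

instance : Mul Word := ⟨concat⟩

theorem one_def : (1 : Word) = pow 0 := rfl

theorem pow_mul (a : ℤ) (v : Word) : pow a * v = shift a v := rfl

theorem powY_mul (a : ℤ) (u v : Word) : powY a u * v = powY a (u * v) := rfl

theorem shift_mul (a : ℤ) (u v : Word) : shift a u * v = shift a (u * v) := by
  cases u with
  | pow b => cases v <;> simp [shift, pow_mul, add_assoc]
  | powY b u => simp [shift, powY_mul]

instance : Monoid Word where
  mul_assoc u v w := by
    induction u with
    | pow a => simp only [pow_mul, shift_mul]
    | powY a u ih => simp only [powY_mul, ih]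
  one_mul u := by cases u <;> simp [one_def, pow_mul, shift]
  mul_one u := by
    induction u with
    | pow a => simp [one_def, pow_mul, shift]
    | powY a u ih => rw [powY_mul, ih]

/-- The letter `j`. -/
def j : Word := pow 1

/-- The letter `d`. -/
def d : Word := pow (-1)

/-- The letter `y`. -/
def y : Word := powY 0 1

theorem d_mul_j : d * j = 1 := rfl

theorem j_mul_d : j * d = 1 := rfl

/-- The exponent `k₁` of `j^{k₁} y ⋯`: the word begins with `j` if it is positive, with `d` if it is
negative, and is `1` or begins with `y` if it is zero. -/
def lead : Word → ℤ
  | pow k => k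
  | powY k _ => k

/-- The number of letters `y`. -/
def depth : Word → ℕ
  | pow _ => 0
  | powY _ w => depth w + 1

/-- The word `j^{k₁} y j^{k₂} y ⋯ j^{kᵣ} y` (the empty word if `r = 0`). -/
def ofList : List ℤ → Word
  | [] => 1
  | k :: l => powY k (ofList l)

/-- The exponents `k₁, …, kᵣ` of `j^{k₁} y ⋯ j^{kᵣ} y j^{k}`. -/
def exponents : Word → List ℤ
  | pow _ => []
  | powY k w => k :: exponents w

/-- The exponent `k` of the last power in `j^{k₁} y ⋯ j^{kᵣ} y j^{k}`. -/
def last : Word → ℤ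
  | pow k => k
  | powY _ w => last w

theorem depth_shift (a : ℤ) (u : Word) : depth (shift a u) = depth u := by
  cases u <;> rfl

theorem depth_mul_j (u : Word) : depth (j * u) = depth u := depth_shift _ _

theorem depth_mul_d (u : Word) : depth (d * u) = depth u := depth_shift _ _

theorem lead_mul_j (u : Word) : lead (j * u) = lead u + 1 := by
  cases u <;> simp [j, pow_mul, shift, lead, add_comm]

theorem lead_mul_d (u : Word) : lead (d * u) = lead u - 1 := by
  cases u <;> simp [d, pow_mul, shift, lead] <;> ring

end Word

/-- The ring `ℚ⟨d, j, y⟩` with `dj = jd = 1`; its multiplication `*` is concatenation. -/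
abbrev QDJY : Type := MonoidAlgebra ℚ Word

/-- A word as an element of `ℚ⟨d, j, y⟩`. -/
def wd (w : Word) : QDJY := MonoidAlgebra.single w 1

/-! ### The product `⧢₀` -/

/-- Auxiliary quantity for the termination of the recursion that defines `⧢₀`. -/
def shMeasure (a b : ℤ) : ℕ :=
  if a = 0 ∨ b = 0 then 0 else if a < 0 ∧ b < 0 then a.natAbs else a.natAbs + b.natAbs

/-- The product `u ⧢₀ v` of two words, by recursion on reduced words:
* `1 ⧢₀ w = w ⧢₀ 1 = w`,
* `yu ⧢₀ v = u ⧢₀ yv = y(u ⧢₀ v)`,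
* `ju ⧢₀ jv = j(u ⧢₀ jv) + j(ju ⧢₀ v)`,
* `ju ⧢₀ dv = d(ju ⧢₀ v) - u ⧢₀ v`,
* `du ⧢₀ jv = d(u ⧢₀ jv) - u ⧢₀ v`,
* `du ⧢₀ dv = d(u ⧢₀ dv) - u ⧢₀ d²v`.

In the last four rules the two factors are called `U` and `V` below. So `u = dU` if `U = ju`, and
`u = jU` if `U = du`; likewise for `v`. In the last two rules the subtracted term is
`jU ⧢₀ dV`, whether `V = jv` or `V = dv`. -/
def shWord (U V : Word) : QDJY :=
  if _lead_U : U.lead = 0 then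
    match U with
    | .pow _ => wd V
    | .powY _ u => wd .y * shWord u V
  else if _lead_V : V.lead = 0 then
    match V with
    | .pow _ => wd U
    | .powY _ v => wd .y * shWord U v
  else if _pos_U : 0 < U.lead then
    if _pos_V : 0 < V.lead then
      wd .j * shWord (.d * U) V + wd .j * shWord U (.d * V)
    else
      wd .d * shWord U (.j * V) - shWord (.d * U) (.j * V)
  else
    wd .d * shWord (.j * U) V - shWord (.j * U) (.d * V)
  termination_by (U.depth + V.depth, shMeasure U.lead V.lead)
  decreasing_by
    all_goals simp only [Word.depth, Word.depth_mul_d, Word.depth_mul_j, Word.lead_mul_d,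
      Word.lead_mul_j]
    all_goals first
      | (apply Prod.Lex.left; omega)
      | (apply Prod.Lex.right; unfold shMeasure; split_ifs <;> omega)

/-- The coefficients of an element of `ℚ⟨d, j, y⟩` with respect to the words. -/
def coeffs : QDJY →ₗ[ℚ] (Word →₀ ℚ) where
  toFun x := x.coeff
  map_add' _ _ := rfl
  map_smul' _ _ := rfl

/-- The `ℚ`-bilinear product `⧢₀` on `ℚ⟨d, j, y⟩`. -/
def sh : QDJY →ₗ[ℚ] QDJY →ₗ[ℚ] QDJY :=
  (Finsupp.linearCombination ℚ fun u : Word =>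
    (Finsupp.linearCombination ℚ (shWord u)).comp coeffs).comp coeffs

theorem sh_wd (u v : Word) : sh (wd u) (wd v) = shWord u v := by
  have h (w : Word) : coeffs (wd w) = Finsupp.single w 1 := rfl
  rw [sh, LinearMap.comp_apply, h, Finsupp.linearCombination_single, one_smul,
    LinearMap.comp_apply, h, Finsupp.linearCombination_single, one_smul]

theorem wd_mul (u v : Word) : wd u * wd v = wd (u * v) := by
  simp [wd, MonoidAlgebra.single_mul_single]

/-! ### The algebra `𝓗` -/

/-- The word ends in `y`. -/
def Word.EndsInY (w : Word) : Prop := w.depth ≠ 0 ∧ w.last = 0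

/-- The span of the words `j^{k₁} y ⋯ y j^{kᵣ}` with `kᵣ ≠ 0`. -/
def T : Submodule ℚ QDJY := Submodule.span ℚ (wd '' {w | w.last ≠ 0})

/-- The span of the words that end in `y`. -/
def endsInYSpan : Submodule ℚ QDJY := Submodule.span ℚ (wd '' {w | w.EndsInY})

/-- The span of the empty word `1` and the words that end in `y`, that is, of the words
`j^{k₁} y ⋯ j^{kᵣ} y` with `r ≥ 0`. -/
def admissible : Submodule ℚ QDJY := Submodule.span ℚ (wd '' {w | w = 1 ∨ w.EndsInY})

theorem Word.eq_one_or_endsInY_iff (w : Word) : (w = 1 ∨ w.EndsInY) ↔ w.last = 0 := by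
  cases w with
  | pow k => simp [Word.EndsInY, Word.one_def, Word.depth, Word.last]
  | powY k w => simp [Word.EndsInY, Word.one_def, Word.depth]

theorem endsInYSpan_le : endsInYSpan ≤ admissible :=
  Submodule.span_mono (Set.image_mono fun _ hw => Or.inr hw)

theorem wd_mem_admissible {w : Word} (hw : w.last = 0) : wd w ∈ admissible :=
  Submodule.subset_span ⟨w, (Word.eq_one_or_endsInY_iff w).2 hw, rfl⟩

theorem mul_mem_of_forall {S S' : Set Word} {a : Word} (h : ∀ w ∈ S, a * w ∈ S') {x : QDJY}
    (hx : x ∈ Submodule.span ℚ (wd '' S)) : wd a * x ∈ Submodule.span ℚ (wd '' S') := by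
  induction hx using Submodule.span_induction with
  | mem x hx =>
    obtain ⟨w, hw, rfl⟩ := hx
    rw [wd_mul]
    exact Submodule.subset_span ⟨_, h w hw, rfl⟩
  | zero => simp
  | add x z _ _ hx hz => rw [mul_add]; exact add_mem hx hz
  | smul c x _ hx => rw [mul_smul_comm]; exact Submodule.smul_mem _ _ hx

theorem Word.last_shift (a : ℤ) {w : Word} (hw : w.depth ≠ 0) :
    (Word.shift a w).last = w.last := by
  cases w with
  | pow k => simp [Word.depth] at hw
  | powY k w => rfl

theorem pow_mul_mem (a : ℤ) {x : QDJY} (hx : x ∈ endsInYSpan) :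
    wd (.pow a) * x ∈ endsInYSpan := by
  refine mul_mem_of_forall (fun w hw => ?_) hx
  exact ⟨by rw [Word.pow_mul, Word.depth_shift]; exact hw.1,
    by rw [Word.pow_mul, Word.last_shift a hw.1]; exact hw.2⟩

theorem y_mul_mem {x : QDJY} (hx : x ∈ admissible) : wd .y * x ∈ endsInYSpan := by
  refine mul_mem_of_forall (fun w hw => ?_) hx
  have : Word.y * w = Word.powY 0 w := by rw [Word.y, Word.powY_mul, one_mul]
  rw [this]
  exact ⟨by simp [Word.depth], (Word.eq_one_or_endsInY_iff w).1 hw⟩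

theorem Word.depth_ne_zero {w : Word} (h : w.last = 0) (h' : w.lead ≠ 0) : w.depth ≠ 0 := by
  cases w with
  | pow k => exact absurd h h'
  | powY k w => simp [Word.depth]

theorem shWord_mem (U V : Word) : U.last = 0 → V.last = 0 →
    shWord U V ∈ admissible ∧ (U.depth ≠ 0 ∨ V.depth ≠ 0 → shWord U V ∈ endsInYSpan) := by
  induction U, V using shWord.induct with
  | case1 V k hk =>
    intro hU hV
    rw [shWord, dif_pos hk]
    refine ⟨wd_mem_admissible hV, fun h => Submodule.subset_span ⟨V, ⟨?_, hV⟩, rfl⟩⟩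
    simpa [Word.depth] using h
  | case2 V k u hk ih =>
    intro hU hV
    rw [shWord, dif_pos hk]
    have := y_mul_mem (ih hU hV).1
    exact ⟨endsInYSpan_le this, fun _ => this⟩
  | case3 U hU0 k hk =>
    intro hU hV
    rw [shWord, dif_neg hU0, dif_pos hk]
    refine ⟨wd_mem_admissible hU, fun h => Submodule.subset_span ⟨U, ⟨?_, hU⟩, rfl⟩⟩
    simpa [Word.depth] using h
  | case4 U hU0 k v hk ih =>
    intro hU hV
    rw [shWord, dif_neg hU0, dif_pos hk]
    have := y_mul_mem (ih hU hV).1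
    exact ⟨endsInYSpan_le this, fun _ => this⟩
  | case5 U V hU0 hV0 hU1 hV1 ih1 ih2 =>
    intro hU hV
    have dU := Word.depth_ne_zero hU hU0
    have dV := Word.depth_ne_zero hV hV0
    have := add_mem
      (pow_mul_mem 1 ((ih1 ((Word.last_shift _ dU).trans hU) hV).2 (Or.inr dV)))
      (pow_mul_mem 1 ((ih2 hU ((Word.last_shift _ dV).trans hV)).2 (Or.inl dU)))
    rw [shWord, dif_neg hU0, dif_neg hV0, dif_pos hU1, dif_pos hV1]
    exact ⟨endsInYSpan_le this, fun _ => this⟩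
  | case6 U V hU0 hV0 hU1 hV1 ih1 ih2 =>
    intro hU hV
    have dU := Word.depth_ne_zero hU hU0
    have dV := Word.depth_ne_zero hV hV0
    have dU' : (Word.d * U).depth ≠ 0 := by rwa [Word.depth_mul_d]
    have := sub_mem
      (pow_mul_mem (-1) ((ih1 hU ((Word.last_shift _ dV).trans hV)).2 (Or.inl dU)))
      ((ih2 ((Word.last_shift _ dU).trans hU) ((Word.last_shift _ dV).trans hV)).2 (Or.inl dU'))
    rw [shWord, dif_neg hU0, dif_neg hV0, dif_pos hU1, dif_neg hV1]
    exact ⟨endsInYSpan_le this, fun _ => this⟩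
  | case7 U V hU0 hV0 hU1 ih1 ih2 =>
    intro hU hV
    have dU := Word.depth_ne_zero hU hU0
    have dV := Word.depth_ne_zero hV hV0
    have dU' : (Word.j * U).depth ≠ 0 := by rwa [Word.depth_mul_j]
    have := sub_mem
      (pow_mul_mem (-1) ((ih1 ((Word.last_shift _ dU).trans hU) hV).2 (Or.inr dV)))
      ((ih2 ((Word.last_shift _ dU).trans hU) ((Word.last_shift _ dV).trans hV)).2 (Or.inl dU'))
    rw [shWord, dif_neg hU0, dif_neg hV0, dif_neg hU1]
    exact ⟨endsInYSpan_le this, fun _ => this⟩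

theorem sh_mem {x z : QDJY} (hx : x ∈ admissible) (hz : z ∈ admissible) :
    sh x z ∈ admissible := by
  induction hx using Submodule.span_induction with
  | mem x hx =>
    obtain ⟨u, hu, rfl⟩ := hx
    induction hz using Submodule.span_induction with
    | mem z hz =>
      obtain ⟨v, hv, rfl⟩ := hz
      rw [sh_wd]
      exact (shWord_mem u v ((Word.eq_one_or_endsInY_iff u).1 hu)
        ((Word.eq_one_or_endsInY_iff v).1 hv)).1
    | zero => simp
    | add z z' _ _ hz hz' => rw [map_add]; exact add_mem hz hz'
    | smul c z _ hz => rw [map_smul]; exact Submodule.smul_mem _ _ hz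
  | zero => simp
  | add x x' _ _ hx hx' => rw [map_add, LinearMap.add_apply]; exact add_mem hx hx'
  | smul c x _ hx => rw [map_smul, LinearMap.smul_apply]; exact Submodule.smul_mem _ _ hx

theorem shWord_one_left (v : Word) : shWord 1 v = wd v := by
  rw [Word.one_def, shWord, dif_pos (show (Word.pow 0).lead = 0 from rfl)]

theorem shWord_one_right (u : Word) : shWord u 1 = wd u := by
  induction u with
  | pow k =>
    rw [Word.one_def, shWord]
    by_cases hk : (Word.pow k).lead = 0
    · rw [dif_pos hk]
      exact congrArg (fun k => wd (Word.pow k)) (Eq.symm hk)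
    · rw [dif_neg hk, dif_pos (show (Word.pow 0).lead = 0 from rfl)]
  | powY k u ih =>
    rw [Word.one_def, shWord]
    by_cases hk : (Word.powY k u).lead = 0
    · rw [dif_pos hk]
      have hk' : k = 0 := hk
      change wd Word.y * shWord u 1 = _
      rw [ih, wd_mul, Word.y, Word.powY_mul, one_mul, hk']
    · rw [dif_neg hk, dif_pos (show (Word.pow 0).lead = 0 from rfl)]

theorem one_sh (x : QDJY) : sh (wd 1) x = x := by
  induction x using MonoidAlgebra.induction_linear with
  | zero => simp
  | add x z hx hz => rw [map_add, hx, hz]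
  | single u c =>
    have : MonoidAlgebra.single u c = c • wd u := by simp [wd]
    rw [this, map_smul, sh_wd, shWord_one_left]

theorem sh_one (x : QDJY) : sh x (wd 1) = x := by
  induction x using MonoidAlgebra.induction_linear with
  | zero => simp
  | add x z hx hz => rw [map_add, LinearMap.add_apply, hx, hz]
  | single u c =>
    have : MonoidAlgebra.single u c = c • wd u := by simp [wd]
    rw [this, map_smul, LinearMap.smul_apply, sh_wd, shWord_one_right]

/-- As a vector space, `ℚ⟨d, j, y⟩` is the direct sum of `T` and the admissible part. -/
theorem isCompl_T_admissible : IsCompl T admissible := by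
  have hT : ∀ x ∈ T, ∀ w : Word, w.last = 0 → coeffs x w = 0 := by
    intro x hx w hw
    induction hx using Submodule.span_induction with
    | mem x hx =>
      obtain ⟨v, hv, rfl⟩ := hx
      exact Finsupp.single_eq_of_ne (fun h => hv (h ▸ hw))
    | zero => simp
    | add x z _ _ hx hz => rw [map_add, Finsupp.add_apply, hx, hz, add_zero]
    | smul c x _ hx => rw [map_smul, Finsupp.smul_apply, hx, smul_zero]
  have hA : ∀ x ∈ admissible, ∀ w : Word, w.last ≠ 0 → coeffs x w = 0 := by
    intro x hx w hw
    induction hx using Submodule.span_induction with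
    | mem x hx =>
      obtain ⟨v, hv, rfl⟩ := hx
      exact Finsupp.single_eq_of_ne
        (fun h => hw (h ▸ (Word.eq_one_or_endsInY_iff v).1 hv))
    | zero => simp
    | add x z _ _ hx hz => rw [map_add, Finsupp.add_apply, hx, hz, add_zero]
    | smul c x _ hx => rw [map_smul, Finsupp.smul_apply, hx, smul_zero]
  refine IsCompl.of_eq ?_ ?_
  · refine (Submodule.eq_bot_iff _).2 fun x hx => MonoidAlgebra.coeff_injective ?_
    ext w
    by_cases hw : w.last = 0
    · exact hT x hx.1 w hw
    · exact hA x hx.2 w hw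
  · refine Submodule.eq_top_iff'.2 fun x => ?_
    induction x using MonoidAlgebra.induction_linear with
    | zero => exact zero_mem _
    | add x z hx hz => exact add_mem hx hz
    | single u c =>
      have : MonoidAlgebra.single u c = c • wd u := by simp [wd]
      rw [this]
      refine Submodule.smul_mem _ _ ?_
      by_cases hw : u.last = 0
      · exact Submodule.mem_sup_right (wd_mem_admissible hw)
      · exact Submodule.mem_sup_left (Submodule.subset_span ⟨u, hw, rfl⟩)

/-- The algebra `(admissible, ⧢₀)`; here `*` is the product `⧢₀`. -/
def Adm : Type := admissible

instance : AddCommGroup Adm := inferInstanceAs (AddCommGroup admissible)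

instance : Module ℚ Adm := inferInstanceAs (Module ℚ admissible)

/-- The underlying element of `ℚ⟨d, j, y⟩`. -/
def Adm.val (x : Adm) : QDJY := Subtype.val x

instance : Mul Adm := ⟨fun x z => ⟨sh x.val z.val, sh_mem x.2 z.2⟩⟩

instance : One Adm := ⟨⟨wd 1, wd_mem_admissible rfl⟩⟩

instance : NonAssocRing Adm where
  left_distrib x z w := Subtype.ext (map_add (sh x.val) z.val w.val)
  right_distrib x z w := Subtype.ext (by
    change sh (x.val + z.val) w.val = sh x.val w.val + sh z.val w.val
    rw [map_add, LinearMap.add_apply])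
  zero_mul x := Subtype.ext (by
    change sh (0 : QDJY) x.val = 0
    rw [map_zero, LinearMap.zero_apply])
  mul_zero x := Subtype.ext (map_zero (sh x.val))
  one_mul x := Subtype.ext (one_sh x.val)
  mul_one x := Subtype.ext (sh_one x.val)

instance : IsScalarTower ℚ Adm Adm where
  smul_assoc c x z := Subtype.ext (by
    change sh (c • x.val) z.val = c • sh x.val z.val
    rw [map_smul, LinearMap.smul_apply])

/-- The two-sided ideal (for `⧢₀`) generated by the elements
`j^k (d(u ⧢₀ v) - du ⧢₀ v - u ⧢₀ dv)` with `k` an integer and `u, v` words that end in `y`. -/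
def L : TwoSidedIdeal Adm :=
  TwoSidedIdeal.span {x | ∃ (k : ℤ) (u v : Word), u.EndsInY ∧ v.EndsInY ∧
    x.val = wd (.pow k) *
      (wd .d * sh (wd u) (wd v) - sh (wd .d * wd u) (wd v) - sh (wd u) (wd .d * wd v))}

/-- All the generators of `L` are admissible. -/
theorem generator_mem (k : ℤ) (u v : Word) (hu : u.EndsInY) (hv : v.EndsInY) :
    wd (.pow k) *
      (wd .d * sh (wd u) (wd v) - sh (wd .d * wd u) (wd v) - sh (wd u) (wd .d * wd v))
      ∈ admissible := by
  have hd {w : Word} (hw : w.EndsInY) : (Word.d * w).EndsInY :=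
    ⟨by rw [Word.depth_mul_d]; exact hw.1, (Word.last_shift _ hw.1).trans hw.2⟩
  have h {u v : Word} (hu : u.EndsInY) (hv : v.EndsInY) :
      sh (wd u) (wd v) ∈ endsInYSpan := by
    rw [sh_wd]
    exact (shWord_mem u v hu.2 hv.2).2 (Or.inl hu.1)
  rw [wd_mul, wd_mul]
  exact endsInYSpan_le (pow_mul_mem k (sub_mem (sub_mem (pow_mul_mem (-1) (h hu hv))
    (h (hd hu) hv)) (h hu (hd hv))))

/-- The algebra `𝓗`, with the product induced by `⧢₀`. -/
abbrev H : Type := L.ringCon.Quotient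

instance : Module ℚ H where
  add_smul a b x := by
    induction x using Quotient.inductionOn' with
    | h x => exact congrArg (fun z : Adm => (z : H)) (add_smul a b x)
  zero_smul x := by
    induction x using Quotient.inductionOn' with
    | h x => exact congrArg (fun z : Adm => (z : H)) (zero_smul ℚ x)

theorem Word.last_ofList (l : List ℤ) : (Word.ofList l).last = 0 := by
  induction l with
  | nil => rfl
  | cons k l ih => exact ih

/-- The word `j^{kᵣ} y ⋯ j^{k₁} y`, for the index `(k₁, …, kᵣ)`. -/
def Adm.word (k : List ℤ) : Adm :=
  ⟨wd (Word.ofList k.reverse), wd_mem_admissible (Word.last_ofList _)⟩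

/-- The class in `𝓗` of the word `j^{kᵣ} y ⋯ j^{k₁} y`, for the index `(k₁, …, kᵣ)`. -/
def H.word (k : List ℤ) : H := (Adm.word k : H)

/-! ### The functions `L^des(k₁, …, kᵣ)(t)` -/

/-- `J[f](t) = ∫₀ᵗ f(z) dz/z`. -/
def opJ (f : ℝ → ℝ) (t : ℝ) : ℝ := ∫ z in (0 : ℝ)..t, f z / z

/-- `D[f](t) = t f'(t)`. -/
def opD (f : ℝ → ℝ) (t : ℝ) : ℝ := t * deriv f t

/-- `J^k` for an integer `k`, where `J^{-1} = D`. -/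
def opJPow : ℤ → (ℝ → ℝ) → ℝ → ℝ
  | .ofNat n => opJ^[n]
  | .negSucc n => opD^[n + 1]

/-- `L^des(0)(t) = t/(1-t) + t log t/(1-t)²`. -/
def desLiZero (t : ℝ) : ℝ := t / (1 - t) + t * Real.log t / (1 - t) ^ 2

/-- `J^{m₁}[L^des(0) J^{m₂}[L^des(0) ⋯ J^{mᵣ}[L^des(0)] ⋯ ]]` for the list `m₁, …, mᵣ`. -/
def desLiAux : List ℤ → ℝ → ℝ
  | [] => fun _ => 1
  | m :: l => opJPow m fun t => desLiZero t * desLiAux l t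

/-- `L^des(k₁, …, kᵣ)(t) = J^{kᵣ}[L^des(0) J^{kᵣ₋₁}[L^des(0) ⋯ J^{k₁}[L^des(0)] ⋯ ]](t)`,
a function of `0 < t < 1`. -/
def desLi (k : List ℤ) : ℝ → ℝ := desLiAux k.reverse

/-! ### The desingularized multiple zeta functions -/

/-- The logarithm along the Hankel contour with a circle of radius `ε`, which is parametrized by
`u ∈ ℝ`: the positive real axis from `+∞` to `ε` (`u ≤ 0`, argument `0`), the circle of radius `ε`
around `0`, counterclockwise (`0 ≤ u ≤ 2π`), and the positive real axis from `ε` to `+∞` (`u ≥ 2π`,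
argument `2π`). -/
def hankelLog (ε u : ℝ) : ℂ :=
  if u ≤ 0 then Real.log (ε - u)
  else if u ≤ 2 * Real.pi then Real.log ε + u * Complex.I
  else Real.log (ε + (u - 2 * Real.pi)) + 2 * Real.pi * Complex.I

/-- The Hankel contour. -/
def hankelPath (ε u : ℝ) : ℂ := Complex.exp (hankelLog ε u)

/-- The function `∏ⱼ (1/(exp(tⱼ+⋯+tᵣ) - 1) - c/(exp(c(tⱼ+⋯+tᵣ)) - 1))`. -/
def genH (r : ℕ) (c : ℝ) (t : Fin r → ℂ) : ℂ :=
  ∏ j : Fin r,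
    (1 / (Complex.exp (∑ k ∈ Finset.Ici j, t k) - 1)
      - c / (Complex.exp (c * ∑ k ∈ Finset.Ici j, t k) - 1))

/-- The integrand of `∫_{𝒞^r} genH(t₁, …, tᵣ; c) ∏ₖ tₖ^{sₖ-1} dtₖ` in the parameters of the
contours. -/
def desIntegrand (r : ℕ) (s : Fin r → ℂ) (c ε : ℝ) (u : Fin r → ℝ) : ℂ :=
  genH r c (fun k => hankelPath ε (u k)) *
    ∏ k : Fin r, (Complex.exp ((s k - 1) * hankelLog ε (u k)) * deriv (hankelPath ε) (u k))

/-- `C(s) = ∏ₖ 1/((e^{2πi sₖ} - 1) Γ(sₖ))`. -/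
def desCoeff (r : ℕ) (s : Fin r → ℂ) : ℂ :=
  ∏ k : Fin r,
    1 / ((Complex.exp (2 * Real.pi * Complex.I * s k) - 1) * Complex.Gamma (s k))

/-- `Z` is the desingularized multiple zeta function of depth `r`: it is entire on `ℂ^r`, and for
`s ∈ (ℂ ∖ ℤ)^r` and all sufficiently small `ε > 0` it is the limit, for real `c → 1`, `c ≠ 1`, of
`(1-c)^{-r} C(s) ∫_{𝒞^r} genH(t; c) ∏ₖ tₖ^{sₖ-1} dtₖ`, where the integral converges absolutely for
`c` close to `1`. -/
structure IsDesMZF (r : ℕ) (Z : (Fin r → ℂ) → ℂ) : Prop where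
  entire : Differentiable ℂ Z
  eventually : ∀ᶠ ε in 𝓝[>] (0 : ℝ), ∀ s : Fin r → ℂ, (∀ k, ∀ n : ℤ, s k ≠ n) →
    (∀ᶠ c in 𝓝[≠] (1 : ℝ), Integrable (desIntegrand r s c ε)) ∧
    Tendsto (fun c : ℝ => 1 / (1 - (c : ℂ)) ^ r * desCoeff r s * ∫ u, desIntegrand r s c ε u)
      (𝓝[≠] 1) (𝓝 (Z s))

theorem IsDesMZF.unique {r : ℕ} {Z Z' : (Fin r → ℂ) → ℂ} (h : IsDesMZF r Z)
    (h' : IsDesMZF r Z') : Z = Z' := by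
  obtain ⟨ε, hε, hε'⟩ := (h.eventually.and h'.eventually).exists
  have hd : Dense ((Set.range ((↑) : ℤ → ℂ))ᶜ) :=
    (Set.countable_range _).dense_compl ℝ
  have hD : Dense (Set.univ.pi fun _ : Fin r => (Set.range ((↑) : ℤ → ℂ))ᶜ) :=
    dense_pi _ fun _ _ => hd
  refine Continuous.ext_on hD h.entire.continuous h'.entire.continuous fun s hs => ?_
  have hs' : ∀ k, ∀ n : ℤ, s k ≠ n := fun k n e => hs k (Set.mem_univ k) ⟨n, e.symm⟩
  exact tendsto_nhds_unique (hε s hs').2 (hε' s hs').2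

open Classical in
/-- The desingularized multiple zeta function `ζ^des_r` on `ℂ^r` (the value `0` is used only if it
did not exist). -/
def desMZF (r : ℕ) : (Fin r → ℂ) → ℂ :=
  if h : ∃ Z, IsDesMZF r Z then h.choose else 0

/-- The special value `ζ^des_r(k₁, …, kᵣ)` at an integer point. -/
def desZeta (k : List ℤ) : ℂ := desMZF k.length fun i => (k.get i : ℂ)

end DesMZV

end

/-!
The substitution `t = exp (-z)` turns functions on `(0, 1)` into functions `F` that are holomorphic
and exponentially decaying on the half strip `Re z > -1`, `|Im z| < 1`. There `D` becomes `-d/dz`,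
its inverse is `J F(z) = ∫_z^∞ F`, and `J` has the complex powers
`J^s F(z) = 1/Γ(s) ∫₀^∞ F(z + t) t^{s-1} dt` (Weyl's fractional integrals), continued to all `s` by
`J^s = J^{s+n} D^n`. In contrast to `t = 1`, the point `z = 0` is interior to the domain.

Deforming the Hankel contour gives `∫_𝒞 F(z + t) t^{s-1} dt = (e^{2πis} - 1) Γ(s) J^s F(z)`.
Divided by `1 - c`, the factors of the generating function tend to
`G(z) = d/dz (z / (e^z - 1))`, dominatedly, so that
`ζ^des_r(s) = J^{sᵣ}[G J^{sᵣ₋₁}[G ⋯ J^{s₁}[G] ⋯ ]](0)`, which is entire in `s`. Since `G` is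
`L^des(0)` in the variable `z`, at integer points this is the limit of `L^des(k₁, …, kᵣ)(t)` as
`t → 1`.

For the algebra, read the letters of a word as operators: `j` as `J`, `d` as `D`, and `y` as
multiplication by `G`. As `D` is a derivation with inverse `J`, the rules that define `⧢₀` hold for
the pointwise product of functions, the rule for `ju ⧢₀ jv` being integration by parts. So words
act as an algebra homomorphism, which kills the generators of `𝓛` by the Leibniz rule; evaluation
at `z = 0` gives the homomorphism on `𝓗`.
-/

noncomputable section

namespace DesMZV

/-! ### Holomorphic dependence of integrals on parameters -/

section Parametric

variable {α : Type*} [MeasurableSpace α] {μ : Measure α}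

theorem aestronglyMeasurable_of_hasFDerivAt {𝕜 E F : Type*} [NontriviallyNormedField 𝕜]
    [CompleteSpace 𝕜] [NormedAddCommGroup E] [NormedSpace 𝕜 E] [FiniteDimensional 𝕜 E]
    [NormedAddCommGroup F] [NormedSpace 𝕜 F] {f : E → α → F} {f' : α → E →L[𝕜] F} {p : E}
    (hmeas : ∀ᶠ q in 𝓝 p, AEStronglyMeasurable (f q) μ)
    (hderiv : ∀ᵐ a ∂μ, HasFDerivAt (fun q => f q a) (f' a) p) : AEStronglyMeasurable f' μ := by
  have apply_meas (v : E) : AEStronglyMeasurable (fun a => f' a v) μ := by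
    have line : Tendsto (fun c : 𝕜 => p + c • v) (𝓝[≠] 0) (𝓝 p) :=
      Continuous.tendsto' (by fun_prop) _ _ (by simp) |>.mono_left nhdsWithin_le_nhds
    obtain ⟨c, hc, hc'⟩ := exists_seq_forall_of_frequently (line.eventually hmeas).frequently
    exact aestronglyMeasurable_of_tendsto_ae atTop
      (fun n => ((hc' n).sub hmeas.self_of_nhds).const_smul (c n)⁻¹)
      (hderiv.mono fun a ha => (ha.hasLineDerivAt v).tendsto_slope_zero.comp hc)
  let b := Module.finBasis 𝕜 E
  have expand : f' = fun a => ∑ i, (b.coord i).toContinuousLinearMap.smulRight (f' a (b i)) := by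
    ext a v
    conv_lhs => rw [← b.sum_repr v]
    simp only [map_sum, map_smul, Module.Basis.coord_apply, sum_apply,
      ContinuousLinearMap.smulRight_apply, LinearMap.coe_toContinuousLinearMap']
  rw [expand]
  exact Finset.aestronglyMeasurable_fun_sum _ fun i _ =>
    (ContinuousLinearMap.smulRightL 𝕜 E F _).continuous.comp_aestronglyMeasurable (apply_meas (b i))

variable {P E : Type*} [NormedAddCommGroup P] [NormedSpace ℂ P] [FiniteDimensional ℂ P]
  [NormedAddCommGroup E] [NormedSpace ℂ E]

theorem differentiableAt_integral_of_dominated {f : P → α → E} {p : P} {b : α → ℝ} {U : Set P}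
    (hU : U ∈ 𝓝 p) (hmeas : ∀ q ∈ U, AEStronglyMeasurable (f q) μ)
    (hdiff : ∀ᵐ a ∂μ, DifferentiableOn ℂ (fun q => f q a) U) (hb : Integrable b μ)
    (hle : ∀ᵐ a ∂μ, ∀ q ∈ U, ‖f q a‖ ≤ b a) :
    DifferentiableAt ℂ (fun q => ∫ a, f q a ∂μ) p := by
  obtain ⟨ρ, ρ_pos, hρ⟩ := Metric.mem_nhds_iff.1 hU
  have hp : p ∈ U := mem_of_mem_nhds hU
  have hderiv : ∀ᵐ a ∂μ, HasFDerivAt (fun q => f q a) (fderiv ℂ (fun q => f q a) p) p :=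
    hdiff.mono fun a ha => (ha.differentiableAt hU).hasFDerivAt
  -- The Schwarz lemma turns the bound `‖f q a‖ ≤ b a` into a Lipschitz bound.
  have hlip : ∀ᵐ a ∂μ, ∀ q ∈ Metric.ball p ρ, ‖f q a - f p a‖ ≤ 2 * b a / ρ * ‖q - p‖ := by
    filter_upwards [hdiff, hle] with a ha hle q hq
    have maps : Set.MapsTo (fun q => f q a) (Metric.ball p ρ)
        (Metric.closedBall (f p a) (2 * b a)) := fun q hq => by
      rw [mem_closedBall_iff_norm]
      linarith [norm_sub_le (f q a) (f p a), hle q (hρ hq), hle p hp]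
    simpa [dist_eq_norm] using
      Complex.dist_le_div_mul_dist_of_mapsTo_ball (ha.mono hρ) maps hq
  exact (hasFDerivAt_integral_of_dominated_loc_of_lip' (Metric.ball_mem_nhds p ρ_pos)
    (fun q hq => hmeas q (hρ hq)) (hb.mono' (hmeas p hp) (hle.mono fun a ha => ha p hp))
    (aestronglyMeasurable_of_hasFDerivAt (eventually_of_mem hU hmeas) hderiv) hlip
    ((hb.const_mul 2).div_const ρ) hderiv).2.differentiableAt

variable {f : P × ℂ → E}

theorem differentiableAt_cderiv {R C : ℝ} (hR : 0 < R) {q₀ : P × ℂ} {U : Set (P × ℂ)}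
    (hU : U ∈ 𝓝 q₀)
    (hdiff : ∀ q ∈ U, ∀ w ∈ Metric.sphere q.2 R, DifferentiableAt ℂ f (q.1, w))
    (hle : ∀ q ∈ U, ∀ w ∈ Metric.sphere q.2 R, ‖f (q.1, w)‖ ≤ C) :
    DifferentiableAt ℂ (fun q => Complex.cderiv R (fun w => f (q.1, w)) q.2) q₀ := by
  have on_circle (w : ℂ) (θ : ℝ) : circleMap w R θ ∈ Metric.sphere w R :=
    circleMap_mem_sphere w hR.le θ
  simp only [Complex.cderiv, circleIntegral, circleMap_sub_center, deriv_circleMap,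
    intervalIntegral.integral_of_le Real.two_pi_pos.le]
  refine DifferentiableAt.const_smul (differentiableAt_integral_of_dominated hU
    (b := fun _ => R * (R ^ 2)⁻¹ * C) (fun q hq => ?_) (ae_of_all _ fun θ q hq => ?_)
    (integrable_const _) (ae_of_all _ fun θ q hq => ?_)) _
  · have hf : Continuous fun θ => f (q.1, circleMap q.2 R θ) :=
      continuous_iff_continuousAt.2 fun θ =>
        ContinuousAt.comp (f := fun θ => (q.1, circleMap q.2 R θ))
          (hdiff q hq _ (on_circle _ _)).continuousAt (by fun_prop)
    have hpow : Continuous fun θ => (circleMap 0 R θ ^ 2)⁻¹ :=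
      (by fun_prop : Continuous fun θ => circleMap 0 R θ ^ 2).inv₀ fun θ =>
        pow_ne_zero 2 (circleMap_ne_center hR.ne')
    have hcircle : Continuous fun θ => circleMap 0 R θ * Complex.I := by fun_prop
    exact (hcircle.smul (hpow.smul hf)).aestronglyMeasurable
  · have hf : DifferentiableAt ℂ (fun q : P × ℂ => f (q.1, circleMap q.2 R θ)) q :=
      (hdiff q hq _ (on_circle _ θ)).comp (f := fun q : P × ℂ => (q.1, circleMap q.2 R θ)) q
        (by unfold circleMap; fun_prop)
    exact ((hf.const_smul _).const_smul _).differentiableWithinAt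
  · rw [norm_smul, norm_smul, norm_mul, Complex.norm_I, norm_inv, norm_pow,
      norm_circleMap_zero, abs_of_pos hR, mul_one, ← mul_assoc]
    gcongr
    exact hle q hq _ (on_circle _ θ)

theorem differentiableAt_deriv_of_eventually [CompleteSpace E] {q₀ : P × ℂ}
    (hf : ∀ᶠ q in 𝓝 q₀, DifferentiableAt ℂ f q) :
    DifferentiableAt ℂ (fun q : P × ℂ => deriv (fun w => f (q.1, w)) q.2) q₀ := by
  have bounded : ∀ᶠ q in 𝓝 q₀, ‖f q‖ < ‖f q₀‖ + 1 :=
    hf.self_of_nhds.continuousAt.norm.eventually_lt_const (lt_add_one _)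
  obtain ⟨ρ, ρ_pos, hρ⟩ := Metric.mem_nhds_iff.1 (hf.and bounded)
  obtain ⟨R, hR, hRρ⟩ : ∃ R, 0 < R ∧ R + R < ρ := ⟨ρ / 3, by positivity, by linarith⟩
  have near {q : P × ℂ} (hq : q ∈ Metric.ball q₀ R) {w : ℂ} (hw : w ∈ Metric.closedBall q.2 R) :
      (q.1, w) ∈ Metric.ball q₀ ρ := by
    rw [Metric.mem_ball, Prod.dist_eq, max_lt_iff] at hq ⊢
    exact ⟨by linarith, by linarith [dist_triangle w q.2 q₀.2, Metric.mem_closedBall.1 hw]⟩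
  have cauchy : ∀ q ∈ Metric.ball q₀ R,
      Complex.cderiv R (fun w => f (q.1, w)) q.2 = deriv (fun w => f (q.1, w)) q.2 := fun q hq =>
    Complex.cderiv_eq_deriv (U := (fun w => (q.1, w)) ⁻¹' Metric.ball q₀ ρ)
      (Metric.isOpen_ball.preimage (by fun_prop))
      (fun w hw => ((hρ hw).1.comp w (f := fun w => (q.1, w)) (by fun_prop)).differentiableWithinAt)
      hR fun w => near hq
  have hball := Metric.ball_mem_nhds q₀ hR
  refine (differentiableAt_cderiv hR hball
    (fun q hq w hw => (hρ (near hq (Metric.sphere_subset_closedBall hw))).1)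
    fun q hq w hw => (hρ (near hq (Metric.sphere_subset_closedBall hw))).2.le).congr_of_eventuallyEq
    (eventually_of_mem hball fun q hq => (cauchy q hq).symm)

end Parametric

/-! ### Holomorphic functions with exponential decay on a half strip -/

/-- The half strip `{z : Re z > -η, |Im z| < η}`. -/
def strip (η : ℝ) : Set ℂ := {z | -η < z.re ∧ |z.im| < η}

theorem isOpen_strip (η : ℝ) : IsOpen (strip η) :=
  (isOpen_lt continuous_const Complex.continuous_re).inter
    (isOpen_lt (continuous_abs.comp Complex.continuous_im) continuous_const)

theorem strip_mono {η η' : ℝ} (h : η ≤ η') : strip η ⊆ strip η' :=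
  fun _ hz => ⟨(neg_le_neg h).trans_lt hz.1, hz.2.trans_le h⟩

theorem exists_mem_strip {z : ℂ} (hz : z ∈ strip 1) : ∃ η < 1, z ∈ strip η := by
  obtain ⟨η, hη, hη'⟩ := exists_between (max_lt (neg_lt.1 hz.1) hz.2)
  rw [max_lt_iff] at hη
  exact ⟨η, hη', neg_lt.1 hη.1, hη.2⟩

theorem add_mem_strip {z w : ℂ} {η ε : ℝ} (hz : z ∈ strip η) (h : -ε ≤ w.re) (h' : |w.im| ≤ ε) :
    z + w ∈ strip (η + ε) := by
  constructor
  · rw [Complex.add_re]; linarith [hz.1]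
  · rw [Complex.add_im]; linarith [abs_add_le z.im w.im, hz.2]

theorem add_ofReal_mem_strip {z : ℂ} {η t : ℝ} (hz : z ∈ strip η) (ht : 0 ≤ t) :
    z + t ∈ strip η := by
  simpa using add_mem_strip (w := t) (ε := 0) hz (by simpa using ht) (by simp)

theorem closedBall_subset_strip {z : ℂ} {η R : ℝ} (hz : z ∈ strip η) :
    Metric.closedBall z R ⊆ strip (η + R) := fun w hw => by
  rw [mem_closedBall_iff_norm] at hw
  simpa using add_mem_strip (w := w - z) hz
    (by linarith [neg_abs_le (w - z).re, Complex.abs_re_le_norm (w - z)])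
    ((Complex.abs_im_le_norm (w - z)).trans hw)

theorem ofReal_mem_strip {x η : ℝ} (hη : 0 < η) (hx : -η < x) : (x : ℂ) ∈ strip η :=
  ⟨by simpa using hx, by simpa using hη⟩

theorem zero_mem_strip {η : ℝ} (hη : 0 < η) : (0 : ℂ) ∈ strip η := ⟨by simpa, by simpa⟩

/-- Holomorphic functions on `strip 1` that are `O(exp(-Re z / 2))` on the smaller half strips:
the space on which all complex powers of integration act. Any rate of decay below `1` would do,
since the kernel of the iterated integrals decays like `(Re z) exp(-Re z)`. -/
structure Decaying (F : ℂ → ℂ) : Prop where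
  differentiableOn : DifferentiableOn ℂ F (strip 1)
  isBigO : ∀ η < 1, F =O[𝓟 (strip η)] fun z => Real.exp (-z.re / 2)

section Family

variable {P : Type*} [NormedAddCommGroup P] [NormedSpace ℂ P]

/-- Families of functions as in `Decaying` that depend holomorphically on a parameter near `p₀`,
with decay locally uniform in the parameter. -/
structure DecayingFamilyAt (𝓕 : P → ℂ → ℂ) (p₀ : P) : Prop where
  differentiableAt : ∀ᶠ p in 𝓝 p₀, ∀ z ∈ strip 1, DifferentiableAt ℂ (Function.uncurry 𝓕) (p, z)
  isBigO : ∀ᶠ p in 𝓝 p₀, ∀ η < 1,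
    Function.uncurry 𝓕 =O[𝓝 p ×ˢ 𝓟 (strip η)] fun q => Real.exp (-q.2.re / 2)

variable {F G : ℂ → ℂ} {𝓕 𝓖 : P → ℂ → ℂ} {p₀ : P}

theorem differentiableAt_of_uncurry {p : P} {z : ℂ}
    (h : DifferentiableAt ℂ (Function.uncurry 𝓕) (p, z)) : DifferentiableAt ℂ (𝓕 p) z :=
  h.comp (f := fun w : ℂ => (p, w)) z (by fun_prop)

theorem Decaying.differentiableAt (hF : Decaying F) {z : ℂ} (hz : z ∈ strip 1) :
    DifferentiableAt ℂ F z :=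
  hF.differentiableOn.differentiableAt ((isOpen_strip 1).mem_nhds hz)

theorem Decaying.exists_norm_le (hF : Decaying F) {η : ℝ} (hη : η < 1) :
    ∃ C, ∀ z ∈ strip η, ‖F z‖ ≤ C * Real.exp (-z.re / 2) := by
  obtain ⟨C, hC⟩ := (hF.isBigO η hη).bound
  exact ⟨C, by simpa using hC⟩

theorem DecayingFamilyAt.exists_norm_le (h𝓕 : DecayingFamilyAt 𝓕 p₀) {η : ℝ} (hη : η < 1) :
    ∃ C, ∀ᶠ p in 𝓝 p₀, ∀ z ∈ strip η, ‖𝓕 p z‖ ≤ C * Real.exp (-z.re / 2) := by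
  obtain ⟨C, hC⟩ := (h𝓕.isBigO.self_of_nhds η hη).bound
  exact ⟨C, by simpa [eventually_prod_principal_iff] using hC⟩

theorem DecayingFamilyAt.of_eventually
    (hdiff : ∀ᶠ p in 𝓝 p₀, ∀ z ∈ strip 1, DifferentiableAt ℂ (Function.uncurry 𝓕) (p, z))
    (hle : ∀ᶠ p in 𝓝 p₀, ∀ η < 1, ∃ C, ∀ᶠ q in 𝓝 p, ∀ z ∈ strip η,
      ‖𝓕 q z‖ ≤ C * Real.exp (-z.re / 2)) :
    DecayingFamilyAt 𝓕 p₀ where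
  differentiableAt := hdiff
  isBigO := hle.mono fun _ hp η hη =>
    let ⟨C, hC⟩ := hp η hη
    .of_bound C (eventually_prod_principal_iff.2 (by simpa using hC))

theorem DecayingFamilyAt.eventually (h𝓕 : DecayingFamilyAt 𝓕 p₀) :
    ∀ᶠ p in 𝓝 p₀, DecayingFamilyAt 𝓕 p :=
  (h𝓕.differentiableAt.eventually_nhds.and h𝓕.isBigO.eventually_nhds).mono
    fun _ hp => ⟨hp.1, hp.2⟩

theorem Decaying.family (hF : Decaying F) (p₀ : P) : DecayingFamilyAt (fun _ => F) p₀ where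
  differentiableAt := .of_forall fun p z hz =>
    (hF.differentiableAt hz).comp (f := Prod.snd) (p, z) differentiableAt_snd
  isBigO := .of_forall fun _ η hη => (hF.isBigO η hη).comp_tendsto tendsto_snd

theorem DecayingFamilyAt.decaying (h𝓕 : DecayingFamilyAt 𝓕 p₀) : Decaying (𝓕 p₀) where
  differentiableOn z hz :=
    (differentiableAt_of_uncurry (h𝓕.differentiableAt.self_of_nhds z hz)).differentiableWithinAt
  isBigO η hη := (h𝓕.isBigO.self_of_nhds η hη).comp_tendsto (k := fun z => (p₀, z))
    (tendsto_const_nhds.prodMk tendsto_id)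

theorem DecayingFamilyAt.congr (h𝓕 : DecayingFamilyAt 𝓕 p₀)
    (h : ∀ᶠ p in 𝓝 p₀, Set.EqOn (𝓕 p) (𝓖 p) (strip 1)) : DecayingFamilyAt 𝓖 p₀ where
  differentiableAt := by
    filter_upwards [h𝓕.differentiableAt, h.eventually_nhds] with p hp h z hz
    have mem : ∀ᶠ w in 𝓝 z, w ∈ strip 1 := (isOpen_strip 1).mem_nhds hz
    refine (hp z hz).congr_of_eventuallyEq ?_
    filter_upwards [h.prod_nhds mem] with q hq using (hq.1 hq.2).symm
  isBigO := by
    filter_upwards [h𝓕.isBigO, h.eventually_nhds] with p hp h η hη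
    refine (hp η hη).congr' (eventually_prod_principal_iff.2 ?_) .rfl
    filter_upwards [h] with q hq z hz using hq (strip_mono hη.le hz)

theorem isBigO_exp_one_strip (η : ℝ) :
    (fun z : ℂ => Real.exp (-z.re / 2)) =O[𝓟 (strip η)] fun _ => (1 : ℝ) :=
  .of_bound (Real.exp (η / 2)) (by
    simpa using fun z (hz : z ∈ strip η) => by linarith [hz.1])

theorem DecayingFamilyAt.mul (h𝓕 : DecayingFamilyAt 𝓕 p₀) (h𝓖 : DecayingFamilyAt 𝓖 p₀) :
    DecayingFamilyAt (fun p => 𝓕 p * 𝓖 p) p₀ where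
  differentiableAt := by
    filter_upwards [h𝓕.differentiableAt, h𝓖.differentiableAt] with p h h' z hz
      using (h z hz).mul (h' z hz)
  isBigO := by
    filter_upwards [h𝓕.isBigO, h𝓖.isBigO] with p h h' η hη
    simpa only [Function.comp_def, mul_one] using!
      (h η hη).mul ((h' η hη).trans ((isBigO_exp_one_strip η).comp_tendsto tendsto_snd))

theorem Decaying.mul (hF : Decaying F) (hG : Decaying G) : Decaying (F * G) :=
  ((hF.family (0 : ℂ)).mul (hG.family 0)).decaying

theorem Decaying.add (hF : Decaying F) (hG : Decaying G) : Decaying (F + G) where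
  differentiableOn := hF.differentiableOn.add hG.differentiableOn
  isBigO η hη := (hF.isBigO η hη).add (hG.isBigO η hη)

theorem Decaying.const_mul (hF : Decaying F) (c : ℂ) : Decaying (fun z => c * F z) where
  differentiableOn := hF.differentiableOn.const_mul c
  isBigO η hη := (hF.isBigO η hη).const_mul_left c

theorem decaying_zero : Decaying 0 where
  differentiableOn := differentiableOn_const 0
  isBigO _ _ := Asymptotics.isBigO_zero _ _

theorem Decaying.neg (hF : Decaying F) : Decaying (-F) where
  differentiableOn := hF.differentiableOn.neg
  isBigO η hη := (hF.isBigO η hη).neg_left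

/-- The operator `-d/dz`, which is `D = t d/dt` in the variable `t = e^{-z}`. -/
def negDeriv (F : ℂ → ℂ) : ℂ → ℂ := fun z => -deriv F z

theorem negDeriv_congr (h : Set.EqOn F G (strip 1)) :
    Set.EqOn (negDeriv F) (negDeriv G) (strip 1) := fun z hz => by
  rw [negDeriv, negDeriv, (h.eventuallyEq_of_mem ((isOpen_strip 1).mem_nhds hz)).deriv_eq]

theorem negDeriv_add (hF : Decaying F) (hG : Decaying G) :
    Set.EqOn (negDeriv (F + G)) (negDeriv F + negDeriv G) (strip 1) := fun z hz => by
  simp only [Pi.add_apply, negDeriv, deriv_add (hF.differentiableAt hz) (hG.differentiableAt hz),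
    neg_add]

theorem negDeriv_mul (hF : Decaying F) (hG : Decaying G) :
    Set.EqOn (negDeriv (F * G)) (negDeriv F * G + F * negDeriv G) (strip 1) := fun z hz => by
  simp only [Pi.add_apply, Pi.mul_apply, negDeriv,
    deriv_mul (hF.differentiableAt hz) (hG.differentiableAt hz)]
  ring

theorem negDeriv_const_mul (c : ℂ) (F : ℂ → ℂ) :
    negDeriv (fun z => c * F z) = fun z => c * negDeriv F z := by
  funext z
  simp only [negDeriv, deriv_const_mul_field, mul_neg]

theorem negDeriv_zero : negDeriv 0 = 0 := by
  funext z
  simp [negDeriv]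

theorem negDeriv_iterate_congr (h : Set.EqOn F G (strip 1)) (n : ℕ) :
    Set.EqOn (negDeriv^[n] F) (negDeriv^[n] G) (strip 1) := by
  induction n with
  | zero => exact h
  | succ n ih => simpa only [Function.iterate_succ_apply'] using negDeriv_congr ih

theorem norm_negDeriv_le_of_strip {η R C : ℝ} (hR : 0 < R) (hη : η + R < 1)
    (hd : DifferentiableOn ℂ F (strip 1))
    (hC : ∀ z ∈ strip (η + R), ‖F z‖ ≤ C * Real.exp (-z.re / 2)) {z : ℂ} (hz : z ∈ strip η) :
    ‖negDeriv F z‖ ≤ C * Real.exp (R / 2) / R * Real.exp (-z.re / 2) := by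
  have ball_subset := closedBall_subset_strip (R := R) hz
  have C_nonneg : 0 ≤ C := nonneg_of_mul_nonneg_left
    ((norm_nonneg _).trans (hC z (strip_mono (by linarith) hz))) (Real.exp_pos _)
  have on_sphere (w : ℂ) (hw : w ∈ Metric.sphere z R) :
      ‖F w‖ ≤ C * (Real.exp (R / 2) * Real.exp (-z.re / 2)) := by
    have re_le : |w.re - z.re| ≤ R := by
      simpa using (Complex.abs_re_le_norm (w - z)).trans_eq (mem_sphere_iff_norm.1 hw)
    rw [← Real.exp_add]
    refine (hC w (ball_subset (Metric.sphere_subset_closedBall hw))).trans ?_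
    gcongr
    linarith [neg_abs_le (w.re - z.re)]
  calc ‖negDeriv F z‖ = ‖deriv F z‖ := norm_neg _
    _ ≤ C * (Real.exp (R / 2) * Real.exp (-z.re / 2)) / R :=
      Complex.norm_deriv_le_of_forall_mem_sphere_norm_le hR
        ((hd.mono (ball_subset.trans (strip_mono hη.le))).diffContOnCl_ball subset_rfl) on_sphere
    _ = _ := by ring

theorem DecayingFamilyAt.negDeriv [FiniteDimensional ℂ P] (h𝓕 : DecayingFamilyAt 𝓕 p₀) :
    DecayingFamilyAt (fun p => negDeriv (𝓕 p)) p₀ := by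
  refine .of_eventually ?_ (h𝓕.eventually.mono fun p hp η hη => ?_)
  · filter_upwards [h𝓕.differentiableAt.eventually_nhds] with p hp z hz
    have mem : ∀ᶠ w in 𝓝 z, w ∈ strip 1 := (isOpen_strip 1).mem_nhds hz
    exact (differentiableAt_deriv_of_eventually
      ((hp.prod_nhds mem).mono fun q hq => hq.1 q.2 hq.2)).neg
  · obtain ⟨R, hR, hR'⟩ := exists_between (sub_pos.2 hη)
    obtain ⟨C, hC⟩ := hp.exists_norm_le (lt_sub_iff_add_lt'.1 hR')
    refine ⟨C * Real.exp (R / 2) / R, ?_⟩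
    filter_upwards [hC, hp.eventually] with q hq hdec z hz
      using norm_negDeriv_le_of_strip hR (lt_sub_iff_add_lt'.1 hR')
        hdec.decaying.differentiableOn hq hz

theorem Decaying.negDeriv (hF : Decaying F) : Decaying (negDeriv F) :=
  (hF.family (0 : ℂ)).negDeriv.decaying

theorem DecayingFamilyAt.negDeriv_iterate [FiniteDimensional ℂ P] (h𝓕 : DecayingFamilyAt 𝓕 p₀)
    (n : ℕ) : DecayingFamilyAt (fun p => DesMZV.negDeriv^[n] (𝓕 p)) p₀ := by
  induction n with
  | zero => exact h𝓕
  | succ n ih => simpa only [Function.iterate_succ_apply'] using ih.negDeriv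

theorem Decaying.negDeriv_iterate (hF : Decaying F) (n : ℕ) :
    Decaying (DesMZV.negDeriv^[n] F) :=
  ((hF.family (0 : ℂ)).negDeriv_iterate n).decaying

end Family

/-! ### Complex powers of the integration operator -/

/-- The integral `1/Γ(s) ∫₀^∞ F(z + t) t^{s-1} dt`, which is the power `J^s` of the operator
`J F(z) = ∫_z^∞ F` if `Re s > 0`. -/
def weylBase (s : ℂ) (F : ℂ → ℂ) (z : ℂ) : ℂ :=
  (Complex.Gamma s)⁻¹ * ∫ t in Set.Ioi (0 : ℝ), F (z + t) * (t : ℂ) ^ (s - 1)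

/-- The Weyl fractional integral: the power `J^s` of the operator `J F(z) = ∫_z^∞ F` for an
arbitrary complex exponent, defined as `J^{s+n} D^n` with `D = J⁻¹ = -d/dz` and the least
`n ≥ 1` such that `Re s + n > 0`. -/
def weyl (s : ℂ) (F : ℂ → ℂ) : ℂ → ℂ :=
  weylBase (s + (⌊-s.re⌋₊ + 1 : ℕ)) (negDeriv^[⌊-s.re⌋₊ + 1] F)

theorem integrableOn_rpow_mul_exp {a : ℝ} (ha : 0 < a) :
    IntegrableOn (fun t : ℝ => t ^ (a - 1) * Real.exp (-(1 / 2 * t))) (Set.Ioi 0) := by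
  simpa using integrableOn_rpow_mul_exp_neg_mul_rpow (p := 1) (s := a - 1) (b := 1 / 2)
    (by linarith) one_pos (by norm_num)

theorem rpow_le_rpow_add_rpow {t a b x : ℝ} (ht : 0 < t) (ha : a ≤ x) (hb : x ≤ b) :
    t ^ x ≤ t ^ a + t ^ b := by
  rcases le_total 1 t with h | h
  · exact (Real.rpow_le_rpow_of_exponent_le h hb).trans (le_add_of_nonneg_left (by positivity))
  · exact (Real.rpow_le_rpow_of_exponent_ge ht h ha).trans (le_add_of_nonneg_right (by positivity))

theorem continuousOn_cpow_Ioi (s : ℂ) :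
    ContinuousOn (fun t : ℝ => (t : ℂ) ^ s) (Set.Ioi 0) := fun t ht =>
  (Complex.continuousAt_ofReal_cpow_const t s (.inr ht.ne')).continuousWithinAt

section Family

variable {F G : ℂ → ℂ} {s z : ℂ} {C η : ℝ}

theorem norm_weyl_integrand_le (hC : ∀ z ∈ strip η, ‖F z‖ ≤ C * Real.exp (-z.re / 2))
    (hz : z ∈ strip η) {t : ℝ} (ht : 0 < t) :
    ‖F (z + t) * (t : ℂ) ^ (s - 1)‖ ≤
      C * Real.exp (-z.re / 2) * (t ^ (s.re - 1) * Real.exp (-(1 / 2 * t))) := by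
  have exp_add : Real.exp (-(z + t).re / 2) = Real.exp (-z.re / 2) * Real.exp (-(1 / 2 * t)) := by
    rw [← Real.exp_add, Complex.add_re, Complex.ofReal_re]; ring_nf
  rw [norm_mul, Complex.norm_cpow_eq_rpow_re_of_pos ht]
  calc _ ≤ C * Real.exp (-(z + t).re / 2) * t ^ (s - 1).re := by
        gcongr; exact hC _ (add_ofReal_mem_strip hz ht.le)
    _ = _ := by rw [exp_add, Complex.sub_re, Complex.one_re]; ring

theorem Decaying.continuousOn_shift (hF : Decaying F) (hz : z ∈ strip 1) :
    ContinuousOn (fun t : ℝ => F (z + t)) (Set.Ici 0) :=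
  hF.differentiableOn.continuousOn.comp (by fun_prop) fun _ ht => add_ofReal_mem_strip hz ht

theorem Decaying.aestronglyMeasurable (hF : Decaying F) (hz : z ∈ strip 1) (s : ℂ) :
    AEStronglyMeasurable (fun t : ℝ => F (z + t) * (t : ℂ) ^ s) (volume.restrict (Set.Ioi 0)) :=
  (((hF.continuousOn_shift hz).mono Set.Ioi_subset_Ici_self).mul
    (continuousOn_cpow_Ioi s)).aestronglyMeasurable measurableSet_Ioi

theorem Decaying.integrableOn (hF : Decaying F) (hz : z ∈ strip 1) (hs : 0 < s.re) :
    IntegrableOn (fun t : ℝ => F (z + t) * (t : ℂ) ^ (s - 1)) (Set.Ioi 0) := by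
  obtain ⟨η, hη, hzη⟩ := exists_mem_strip hz
  obtain ⟨C, hC⟩ := hF.exists_norm_le hη
  exact ((integrableOn_rpow_mul_exp hs).const_mul _).mono' (hF.aestronglyMeasurable hz _)
    (ae_restrict_of_forall_mem measurableSet_Ioi fun t ht => norm_weyl_integrand_le hC hzη ht)

theorem Decaying.integrableOn_shift (hF : Decaying F) (hz : z ∈ strip 1) :
    IntegrableOn (fun t : ℝ => F (z + t)) (Set.Ioi 0) := by
  simpa using hF.integrableOn (s := 1) hz one_pos

theorem Decaying.tendsto_zero (hF : Decaying F) (hz : z ∈ strip 1) (s : ℂ) :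
    Tendsto (fun t : ℝ => F (z + t) * (t : ℂ) ^ s) atTop (𝓝 0) := by
  obtain ⟨η, hη, hzη⟩ := exists_mem_strip hz
  obtain ⟨C, hC⟩ := hF.exists_norm_le hη
  have lim := (tendsto_rpow_mul_exp_neg_mul_atTop_nhds_zero s.re (1 / 2) (by norm_num)).const_mul
    (C * Real.exp (-z.re / 2))
  rw [mul_zero] at lim
  refine squeeze_zero_norm' ?_ lim
  filter_upwards [eventually_gt_atTop 0] with t ht
  simpa using norm_weyl_integrand_le (s := s + 1) hC hzη ht

theorem Decaying.hasDerivAt_shift (hF : Decaying F) (hz : z ∈ strip 1) {t : ℝ} (ht : 0 ≤ t) :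
    HasDerivAt (fun t : ℝ => F (z + t)) (-DesMZV.negDeriv F (z + t)) t := by
  rw [DesMZV.negDeriv, neg_neg]
  exact ((hF.differentiableAt (add_ofReal_mem_strip hz ht)).hasDerivAt.comp_const_add
    z (t : ℂ)).comp_ofReal

theorem norm_weylBase_le (hC : ∀ z ∈ strip η, ‖F z‖ ≤ C * Real.exp (-z.re / 2))
    (hz : z ∈ strip η) (hs : 0 < s.re) :
    ‖weylBase s F z‖ ≤ ‖(Complex.Gamma s)⁻¹‖ * (C * ((1 / (1 / 2)) ^ s.re * Real.Gamma s.re)) *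
      Real.exp (-z.re / 2) := by
  have le_integral := norm_integral_le_of_norm_le
    ((integrableOn_rpow_mul_exp hs).const_mul (C * Real.exp (-z.re / 2)))
    (ae_restrict_of_forall_mem measurableSet_Ioi fun t ht => norm_weyl_integrand_le hC hz ht)
  rw [integral_const_mul, Real.integral_rpow_mul_exp_neg_mul_Ioi hs one_half_pos] at le_integral
  calc ‖weylBase s F z‖ ≤ ‖(Complex.Gamma s)⁻¹‖ * _ :=
        (norm_mul _ _).trans_le (mul_le_mul_of_nonneg_left le_integral (norm_nonneg _))
    _ = _ := by ring

theorem weylBase_congr (s : ℂ) (h : Set.EqOn F G (strip 1)) :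
    Set.EqOn (weylBase s F) (weylBase s G) (strip 1) := fun z hz => by
  rw [weylBase, weylBase, setIntegral_congr_fun measurableSet_Ioi fun t (ht : 0 < t) => ?_]
  simp only [h (add_ofReal_mem_strip hz ht.le)]

theorem weyl_congr (s : ℂ) (h : Set.EqOn F G (strip 1)) :
    Set.EqOn (weyl s F) (weyl s G) (strip 1) :=
  weylBase_congr _ (negDeriv_iterate_congr h _)

variable {P : Type*} [NormedAddCommGroup P] [NormedSpace ℂ P] [FiniteDimensional ℂ P]
  {𝓕 : P → ℂ → ℂ} {p₀ : P} {σ : P → ℂ}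

theorem DecayingFamilyAt.differentiableAt_weylBase (h𝓕 : DecayingFamilyAt 𝓕 p₀)
    (hσ : Differentiable ℂ σ) (hσ₀ : 0 < (σ p₀).re) (hz : z ∈ strip 1) :
    DifferentiableAt ℂ (Function.uncurry fun p => weylBase (σ p) (𝓕 p)) (p₀, z) := by
  obtain ⟨η, hη, hzη⟩ := exists_mem_strip hz
  obtain ⟨C, hC⟩ := h𝓕.exists_norm_le hη
  obtain ⟨m, m_pos, hm⟩ := exists_between hσ₀
  obtain ⟨M, hM⟩ := exists_gt (σ p₀).re
  have re_cont : Continuous fun p => (σ p).re := Complex.continuous_re.comp hσ.continuous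
  have near : ∀ᶠ q : P × ℂ in 𝓝 (p₀, z), ((∀ w ∈ strip 1,
      DifferentiableAt ℂ (Function.uncurry 𝓕) (q.1, w)) ∧ Decaying (𝓕 q.1) ∧
      (∀ w ∈ strip η, ‖𝓕 q.1 w‖ ≤ C * Real.exp (-w.re / 2)) ∧
      m < (σ q.1).re ∧ (σ q.1).re < M) ∧ q.2 ∈ strip η :=
    Eventually.prod_nhds (h𝓕.differentiableAt.and <|
      (h𝓕.eventually.mono fun _ h => h.decaying).and <| hC.and <|
      (re_cont.continuousAt.eventually_const_lt hm).and
      (re_cont.continuousAt.eventually_lt_const hM)) ((isOpen_strip η).mem_nhds hzη)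
  refine DifferentiableAt.mul ((Complex.differentiable_one_div_Gamma.comp hσ _).comp
    (f := Prod.fst) (p₀, z) differentiableAt_fst) (differentiableAt_integral_of_dominated near
    (b := fun t => |C| * Real.exp (η / 2) *
      (t ^ (m - 1) * Real.exp (-(1 / 2 * t)) + t ^ (M - 1) * Real.exp (-(1 / 2 * t))))
    ?_ ?_ ?_ ?_)
  · rintro q ⟨⟨-, hF, -⟩, hq⟩
    exact hF.aestronglyMeasurable (strip_mono hη.le hq) _
  · refine ae_restrict_of_forall_mem measurableSet_Ioi fun t (ht : 0 < t) => ?_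
    rintro q ⟨⟨hd, -⟩, hq⟩
    have dF : DifferentiableAt ℂ (fun q : P × ℂ => 𝓕 q.1 (q.2 + t)) q :=
      (hd _ (add_ofReal_mem_strip (strip_mono hη.le hq) ht.le)).comp
        (f := fun q : P × ℂ => (q.1, q.2 + (t : ℂ))) q (by fun_prop)
    have dpow : DifferentiableAt ℂ (fun q : P × ℂ => (t : ℂ) ^ (σ q.1 - 1)) q :=
      (((hσ q.1).comp q differentiableAt_fst).sub_const 1).const_cpow
        (.inl (Complex.ofReal_ne_zero.2 ht.ne'))
    exact (dF.mul dpow).differentiableWithinAt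
  · exact ((integrableOn_rpow_mul_exp m_pos).add
      (integrableOn_rpow_mul_exp (hσ₀.trans hM))).const_mul _
  · refine ae_restrict_of_forall_mem measurableSet_Ioi fun t (ht : 0 < t) => ?_
    rintro q ⟨⟨-, -, hC, hm, hM⟩, hq⟩
    refine (norm_weyl_integrand_le hC hq ht).trans ?_
    rw [← add_mul]
    gcongr
    · exact le_abs_self C
    · linarith [hq.1]
    · exact rpow_le_rpow_add_rpow ht (by linarith) (by linarith)

theorem DecayingFamilyAt.weylBase (h𝓕 : DecayingFamilyAt 𝓕 p₀) (hσ : Differentiable ℂ σ)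
    (hσ₀ : 0 < (σ p₀).re) : DecayingFamilyAt (fun p => weylBase (σ p) (𝓕 p)) p₀ := by
  have re_cont : Continuous fun p => (σ p).re := Complex.continuous_re.comp hσ.continuous
  have re_pos : ∀ᶠ p in 𝓝 p₀, 0 < (σ p).re := re_cont.continuousAt.eventually_const_lt hσ₀
  refine .of_eventually ?_ ?_ <;> filter_upwards [h𝓕.eventually, re_pos] with p hp hσp
  · exact fun z hz => hp.differentiableAt_weylBase hσ hσp hz
  intro η hη
  obtain ⟨C, hC⟩ := hp.exists_norm_le hη
  let const (q : P) : ℝ := ‖(Complex.Gamma (σ q))⁻¹‖ *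
    (C * ((1 / (1 / 2)) ^ (σ q).re * Real.Gamma (σ q).re))
  have const_cont : ContinuousAt const p := by
    have cΓ := (Complex.differentiable_one_div_Gamma.comp hσ).continuous.continuousAt (x := p)
    have cΓre : ContinuousAt (fun q => Real.Gamma (σ q).re) p :=
      ContinuousAt.comp (f := fun q => (σ q).re) (g := Real.Gamma)
        (Real.differentiableOn_Gamma_Ioi.continuousOn.continuousAt (Ioi_mem_nhds hσp))
        re_cont.continuousAt
    have cpow : ContinuousAt (fun q => (1 / (1 / 2) : ℝ) ^ (σ q).re) p :=
      ((Real.continuous_const_rpow (by norm_num)).comp re_cont).continuousAt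
    exact cΓ.norm.mul <| continuousAt_const.mul <| cpow.mul cΓre
  refine ⟨const p + 1, ?_⟩
  filter_upwards [hC, const_cont.eventually_lt_const (lt_add_one _),
    re_cont.continuousAt.eventually_const_lt hσp] with q hq hlt hσq z hz
  exact (norm_weylBase_le hq hz hσq).trans (by gcongr)

theorem weylBase_eq_weylBase_add_one (hF : Decaying F) (hs : 0 < s.re) :
    Set.EqOn (weylBase s F) (weylBase (s + 1) (negDeriv F)) (strip 1) := fun z hz => by
  have s_ne : s ≠ 0 := fun e => by simp [e] at hs
  have deriv_mul_cpow : ∀ t ∈ Set.Ioi (0 : ℝ), HasDerivAt (fun t : ℝ => F (z + t) * (t : ℂ) ^ s)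
      (-(negDeriv F (z + t) * (t : ℂ) ^ (s + 1 - 1)) + s * (F (z + t) * (t : ℂ) ^ (s - 1))) t := by
    intro t (ht : 0 < t)
    refine ((hF.hasDerivAt_shift hz ht.le).mul
      (hasDerivAt_ofReal_cpow_const ht.ne' s_ne)).congr_deriv ?_
    rw [add_sub_cancel_right]; ring
  have int_deriv : IntegrableOn (fun t : ℝ => -(negDeriv F (z + t) * (t : ℂ) ^ (s + 1 - 1)))
      (Set.Ioi 0) :=
    (hF.negDeriv.integrableOn hz (by rw [Complex.add_re, Complex.one_re]; positivity)).neg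
  have int_cpow := (hF.integrableOn hz hs).const_mul s
  have cont_zero : ContinuousWithinAt (fun t : ℝ => F (z + t) * (t : ℂ) ^ s) (Set.Ici 0) 0 :=
    (hF.continuousOn_shift hz 0 Set.self_mem_Ici).mul
      (Complex.continuousAt_ofReal_cpow_const 0 s (.inl hs)).continuousWithinAt
  have by_parts := integral_Ioi_of_hasDerivAt_of_tendsto cont_zero deriv_mul_cpow
    (int_deriv.add int_cpow) (hF.tendsto_zero hz s)
  rw [integral_add int_deriv int_cpow, integral_neg, integral_const_mul, Complex.ofReal_zero,
    Complex.zero_cpow s_ne, mul_zero, sub_zero, neg_add_eq_zero] at by_parts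
  have := Complex.Gamma_ne_zero_of_re_pos hs
  rw [weylBase, weylBase, Complex.Gamma_add_one s s_ne, by_parts]
  field_simp

theorem negDeriv_weylBase (hF : Decaying F) (hs : 0 < s.re) :
    Set.EqOn (negDeriv (weylBase s F)) (weylBase s (negDeriv F)) (strip 1) := fun z hz => by
  obtain ⟨η, hη, hzη⟩ := exists_mem_strip hz
  obtain ⟨C, hC⟩ := hF.negDeriv.exists_norm_le hη
  have strip_nhds : strip η ∈ 𝓝 z := (isOpen_strip η).mem_nhds hzη
  have deriv_integral := (hasDerivAt_integral_of_dominated_loc_of_deriv_le (𝕜 := ℂ)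
    (μ := volume.restrict (Set.Ioi (0 : ℝ))) (x₀ := z) (s := strip η)
    (F := fun w (t : ℝ) => F (w + t) * (t : ℂ) ^ (s - 1))
    (F' := fun w (t : ℝ) => -(negDeriv F (w + t) * (t : ℂ) ^ (s - 1)))
    (bound := fun t => |C| * Real.exp (η / 2) * (t ^ (s.re - 1) * Real.exp (-(1 / 2 * t))))
    strip_nhds ?_ (hF.integrableOn hz hs) (hF.negDeriv.integrableOn hz hs).neg.1 ?_ ?_ ?_).2
  · have := (deriv_integral.const_mul (Complex.Gamma s)⁻¹).deriv
    change -deriv (fun w => (Complex.Gamma s)⁻¹ * ∫ t in Set.Ioi (0 : ℝ),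
      F (w + t) * (t : ℂ) ^ (s - 1)) z = _
    rw [this, integral_neg, mul_neg, neg_neg, weylBase]
  · filter_upwards [strip_nhds] with w hw using hF.aestronglyMeasurable (strip_mono hη.le hw) _
  · refine ae_restrict_of_forall_mem measurableSet_Ioi fun t (ht : 0 < t) w hw => ?_
    rw [norm_neg]
    refine (norm_weyl_integrand_le hC hw ht).trans ?_
    gcongr
    · exact le_abs_self C
    · linarith [hw.1]
  · exact (integrableOn_rpow_mul_exp hs).const_mul _
  · refine ae_restrict_of_forall_mem measurableSet_Ioi fun t (ht : 0 < t) w hw => ?_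
    have shift := (hF.differentiableAt
      (add_ofReal_mem_strip (strip_mono hη.le hw) ht.le)).hasDerivAt.comp_add_const w (t : ℂ)
    refine (shift.mul_const ((t : ℂ) ^ (s - 1))).congr_deriv ?_
    rw [negDeriv, neg_mul, neg_neg]

theorem weylBase_one_negDeriv (hF : Decaying F) :
    Set.EqOn (weylBase 1 (negDeriv F)) F (strip 1) := fun z hz => by
  have ftc := integral_Ioi_of_hasDerivAt_of_tendsto (f := fun t : ℝ => F (z + t))
    (f' := fun t : ℝ => -negDeriv F (z + t)) (hF.continuousOn_shift hz 0 Set.self_mem_Ici)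
    (fun t ht => hF.hasDerivAt_shift hz (le_of_lt ht)) (hF.negDeriv.integrableOn_shift hz).neg
    (by simpa using hF.tendsto_zero hz 0)
  rw [integral_neg] at ftc
  simpa [weylBase] using ftc

theorem weylBase_eq_weylBase_add_nat (hF : Decaying F) (hs : 0 < s.re) (n : ℕ) :
    Set.EqOn (weylBase s F) (weylBase (s + n) (negDeriv^[n] F)) (strip 1) := by
  induction n with
  | zero => simp [Set.eqOn_refl]
  | succ n ih =>
    have re_pos : 0 < (s + n).re := by rw [Complex.add_re, Complex.natCast_re]; positivity
    rw [Function.iterate_succ_apply', Nat.cast_succ, ← add_assoc]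
    exact ih.trans (weylBase_eq_weylBase_add_one (hF.negDeriv_iterate n) re_pos)

theorem weyl_eq_weylBase (hF : Decaying F) {n : ℕ} (hn : 0 < s.re + n) :
    Set.EqOn (weyl s F) (weylBase (s + n) (negDeriv^[n] F)) (strip 1) := by
  have of_le {a b : ℕ} (ha : 0 < s.re + a) (hab : a ≤ b) :
      Set.EqOn (weylBase (s + a) (negDeriv^[a] F)) (weylBase (s + b) (negDeriv^[b] F))
        (strip 1) := by
    obtain ⟨c, rfl⟩ := Nat.exists_eq_add_of_le' hab
    rw [Function.iterate_add_apply, Nat.cast_add, add_comm (c : ℂ), ← add_assoc]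
    exact weylBase_eq_weylBase_add_nat (hF.negDeriv_iterate a) (by simpa using ha) c
  have floor_pos : 0 < s.re + (⌊-s.re⌋₊ + 1 : ℕ) := by
    push_cast; linarith [Nat.lt_floor_add_one (-s.re)]
  rcases le_total n (⌊-s.re⌋₊ + 1) with h | h
  · exact (of_le hn h).symm
  · exact of_le floor_pos h

theorem DecayingFamilyAt.weyl (h𝓕 : DecayingFamilyAt 𝓕 p₀) (hσ : Differentiable ℂ σ) :
    DecayingFamilyAt (fun p => weyl (σ p) (𝓕 p)) p₀ := by
  obtain ⟨n, hn⟩ := exists_nat_gt (-(σ p₀).re)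
  have re_cont : Continuous fun p => (σ p).re := Complex.continuous_re.comp hσ.continuous
  refine ((h𝓕.negDeriv_iterate n).weylBase (hσ.add_const (n : ℂ))
    (by simpa using neg_lt_iff_pos_add'.1 hn)).congr ?_
  filter_upwards [h𝓕.eventually, re_cont.continuousAt.eventually_const_lt (neg_lt.1 hn)]
    with p hp hlt
  exact (weyl_eq_weylBase hp.decaying (neg_lt_iff_pos_add.1 hlt)).symm

theorem Decaying.weyl (hF : Decaying F) (s : ℂ) : Decaying (weyl s F) :=
  ((hF.family (0 : ℂ)).weyl (differentiable_const s)).decaying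

theorem weyl_zero (hF : Decaying F) : Set.EqOn (weyl 0 F) F (strip 1) := by
  have := weyl_eq_weylBase hF (s := 0) (n := 1) (by simp)
  rw [Nat.cast_one, zero_add] at this
  exact this.trans (weylBase_one_negDeriv hF)

theorem negDeriv_weyl (hF : Decaying F) (s : ℂ) :
    Set.EqOn (negDeriv (weyl s F)) (weyl s (negDeriv F)) (strip 1) := by
  obtain ⟨n, hn⟩ := exists_nat_gt (-s.re)
  have re_pos : 0 < s.re + n := neg_lt_iff_pos_add'.1 hn
  refine (negDeriv_congr (weyl_eq_weylBase hF re_pos)).trans <|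
    (negDeriv_weylBase (hF.negDeriv_iterate n) (by simpa using re_pos)).trans ?_
  rw [← Function.iterate_succ_apply' negDeriv, Function.iterate_succ_apply]
  exact (weyl_eq_weylBase hF.negDeriv re_pos).symm

theorem weyl_negDeriv (hF : Decaying F) (s : ℂ) :
    Set.EqOn (weyl s (negDeriv F)) (weyl (s - 1) F) (strip 1) := by
  obtain ⟨n, hn⟩ := exists_nat_gt (-s.re)
  have := weyl_eq_weylBase hF (s := s - 1) (n := n + 1) (by simp; linarith)
  rw [Function.iterate_succ_apply, Nat.cast_succ, sub_add_add_cancel] at this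
  exact (weyl_eq_weylBase hF.negDeriv (neg_lt_iff_pos_add'.1 hn)).trans this.symm

theorem negDeriv_weyl_eq (hF : Decaying F) (s : ℂ) :
    Set.EqOn (negDeriv (weyl s F)) (weyl (s - 1) F) (strip 1) :=
  (negDeriv_weyl hF s).trans (weyl_negDeriv hF s)

theorem weyl_one_negDeriv (hF : Decaying F) :
    Set.EqOn (weyl 1 (negDeriv F)) F (strip 1) := by
  simpa using (weyl_negDeriv hF 1).trans ((sub_self (1 : ℂ)).symm ▸ weyl_zero hF)

theorem negDeriv_weyl_one (hF : Decaying F) :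
    Set.EqOn (negDeriv (weyl 1 F)) F (strip 1) :=
  (negDeriv_weyl hF 1).trans (weyl_one_negDeriv hF)

theorem weyl_one_weyl (hF : Decaying F) (s : ℂ) :
    Set.EqOn (weyl 1 (weyl s F)) (weyl (s + 1) F) (strip 1) := by
  have := negDeriv_weyl_eq hF (s + 1)
  rw [add_sub_cancel_right] at this
  exact (weyl_congr 1 this).symm.trans (weyl_one_negDeriv (hF.weyl _))

end Family

/-! ### The Hankel contour -/

section Contour

variable {s : ℂ} {ε u : ℝ}

theorem measurable_hankelLog (ε : ℝ) : Measurable (hankelLog ε) := by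
  unfold hankelLog
  refine Measurable.ite measurableSet_Iic ?_ (Measurable.ite measurableSet_Iic ?_ ?_)
  · exact Complex.measurable_ofReal.comp (Real.measurable_log.comp (by fun_prop))
  · fun_prop
  · exact (Complex.measurable_ofReal.comp (Real.measurable_log.comp (by fun_prop))).add_const _

theorem measurable_hankelPath (ε : ℝ) : Measurable (hankelPath ε) :=
  Complex.measurable_exp.comp (measurable_hankelLog ε)

/-- The density of `t^{s-1} dt` along the parametrized Hankel contour `t = hankelPath ε u`. -/
def hankelWeight (s : ℂ) (ε u : ℝ) : ℂ :=
  Complex.exp ((s - 1) * hankelLog ε u) * deriv (hankelPath ε) u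

theorem measurable_hankelWeight (s : ℂ) (ε : ℝ) : Measurable (hankelWeight s ε) :=
  (Complex.measurable_exp.comp ((measurable_hankelLog ε).const_mul _)).mul (measurable_deriv _)

/-- The logarithm `log ε + iθ` of the point with argument `θ` on the circular part of the Hankel
contour. -/
def circleLog (ε θ : ℝ) : ℂ := Real.log ε + θ * Complex.I

theorem hasDerivAt_circleLog (ε θ : ℝ) : HasDerivAt (circleLog ε) Complex.I θ := by
  unfold circleLog
  simpa using ((hasDerivAt_id θ).ofReal_comp.mul_const Complex.I).const_add (Real.log ε : ℂ)

@[fun_prop]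
theorem continuous_circleLog (ε : ℝ) : Continuous (circleLog ε) :=
  continuous_iff_continuousAt.2 fun θ => (hasDerivAt_circleLog ε θ).continuousAt

theorem norm_exp_circleLog (hε : 0 < ε) (θ : ℝ) : ‖Complex.exp (circleLog ε θ)‖ = ε := by
  simp [Complex.norm_exp, circleLog, Real.exp_log hε]

theorem exp_mul_ofReal_log {t : ℝ} (ht : 0 < t) (s : ℂ) :
    Complex.exp (s * (Real.log t : ℝ)) = (t : ℂ) ^ s := by
  rw [Complex.cpow_def_of_ne_zero (Complex.ofReal_ne_zero.2 ht.ne'), Complex.ofReal_log ht.le,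
    mul_comm]

theorem exp_mul_circleLog_zero (hε : 0 < ε) (s : ℂ) :
    Complex.exp (s * circleLog ε 0) = (ε : ℂ) ^ s := by
  rw [circleLog, Complex.ofReal_zero, zero_mul, add_zero, exp_mul_ofReal_log hε]

theorem exp_mul_circleLog_two_pi (hε : 0 < ε) (s : ℂ) :
    Complex.exp (s * circleLog ε (2 * Real.pi)) =
      Complex.exp (2 * Real.pi * Complex.I * s) * (ε : ℂ) ^ s := by
  rw [circleLog, mul_add, Complex.exp_add, exp_mul_ofReal_log hε, mul_comm]
  push_cast; ring_nf

theorem exp_circleLog_zero (hε : 0 < ε) : Complex.exp (circleLog ε 0) = ε := by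
  simpa using exp_mul_circleLog_zero hε 1

theorem exp_circleLog_two_pi (hε : 0 < ε) : Complex.exp (circleLog ε (2 * Real.pi)) = ε := by
  simpa [Complex.exp_two_pi_mul_I] using exp_mul_circleLog_two_pi hε 1

theorem hankelLog_of_neg (hu : u < 0) : hankelLog ε u = Real.log (ε - u) := by
  rw [hankelLog, if_pos hu.le]

theorem hankelLog_of_mem (hu : u ∈ Set.Ioo 0 (2 * Real.pi)) : hankelLog ε u = circleLog ε u := by
  rw [hankelLog, if_neg hu.1.not_ge, if_pos hu.2.le, circleLog]

theorem hankelLog_of_gt (hu : 2 * Real.pi < u) :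
    hankelLog ε u = Real.log (ε + (u - 2 * Real.pi)) + 2 * Real.pi * Complex.I := by
  rw [hankelLog, if_neg (Real.two_pi_pos.trans hu).not_ge, if_neg hu.not_ge]

theorem hankelPath_of_neg (hε : 0 < ε) (hu : u < 0) : hankelPath ε u = (ε - u : ℝ) := by
  rw [hankelPath, hankelLog_of_neg hu, ← Complex.ofReal_exp, Real.exp_log (by linarith)]

theorem hankelPath_of_mem (hu : u ∈ Set.Ioo 0 (2 * Real.pi)) :
    hankelPath ε u = Complex.exp (circleLog ε u) := by
  rw [hankelPath, hankelLog_of_mem hu]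

theorem hankelPath_of_gt (hε : 0 < ε) (hu : 2 * Real.pi < u) :
    hankelPath ε u = (ε + (u - 2 * Real.pi) : ℝ) := by
  rw [hankelPath, hankelLog_of_gt hu, Complex.exp_add, Complex.exp_two_pi_mul_I, mul_one,
    ← Complex.ofReal_exp, Real.exp_log (by linarith)]

theorem hankelPath_mem_Ici_or_norm_eq (hε : 0 < ε) (u : ℝ) :
    (∃ t : ℝ, 0 ≤ t ∧ hankelPath ε u = t) ∨ ‖hankelPath ε u‖ = ε := by
  rcases lt_trichotomy u 0 with h | rfl | h
  · exact .inl ⟨ε - u, by linarith, hankelPath_of_neg hε h⟩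
  · exact .inl ⟨ε, hε.le, by rw [hankelPath, hankelLog, if_pos le_rfl, sub_zero,
      ← Complex.ofReal_exp, Real.exp_log hε]⟩
  rcases lt_or_ge (2 * Real.pi) u with h' | h'
  · exact .inl ⟨ε + (u - 2 * Real.pi), by linarith, hankelPath_of_gt hε h'⟩
  · right
    rw [hankelPath, hankelLog, if_neg h.not_ge, if_pos h', ← circleLog, norm_exp_circleLog hε]

theorem neg_le_hankelPath_re (hε : 0 < ε) (u : ℝ) : -ε ≤ (hankelPath ε u).re := by
  rcases hankelPath_mem_Ici_or_norm_eq hε u with ⟨t, ht, e⟩ | h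
  · rw [e, Complex.ofReal_re]; linarith
  · exact (abs_le.1 ((Complex.abs_re_le_norm _).trans_eq h)).1

theorem abs_hankelPath_im_le (hε : 0 < ε) (u : ℝ) : |(hankelPath ε u).im| ≤ ε := by
  rcases hankelPath_mem_Ici_or_norm_eq hε u with ⟨t, -, e⟩ | h
  · rw [e, Complex.ofReal_im, abs_zero]; exact hε.le
  · exact (Complex.abs_im_le_norm _).trans_eq h

theorem exp_two_pi_I_mul_add_one (s : ℂ) :
    Complex.exp (2 * Real.pi * Complex.I * (s + 1)) =
      Complex.exp (2 * Real.pi * Complex.I * s) := by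
  rw [mul_add, mul_one, Complex.exp_add, Complex.exp_two_pi_mul_I, mul_one]

theorem hankelWeight_of_neg (hε : 0 < ε) (hu : u < 0) :
    hankelWeight s ε u = -((ε - u : ℝ) : ℂ) ^ (s - 1) := by
  have path_eq : hankelPath ε =ᶠ[𝓝 u] fun u => ((ε - u : ℝ) : ℂ) := by
    filter_upwards [gt_mem_nhds hu] with v hv using hankelPath_of_neg hε hv
  have deriv_path : deriv (hankelPath ε) u = -1 := by
    simpa using path_eq.deriv_eq.trans ((hasDerivAt_id u).const_sub ε).ofReal_comp.deriv
  rw [hankelWeight, deriv_path, hankelLog_of_neg hu, exp_mul_ofReal_log (by linarith), mul_neg_one]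

theorem hankelWeight_of_mem (hu : u ∈ Set.Ioo 0 (2 * Real.pi)) :
    hankelWeight s ε u = Complex.I * Complex.exp (s * circleLog ε u) := by
  have path_eq : hankelPath ε =ᶠ[𝓝 u] fun u => Complex.exp (circleLog ε u) := by
    filter_upwards [Ioo_mem_nhds hu.1 hu.2] with v hv using hankelPath_of_mem hv
  rw [hankelWeight, path_eq.deriv_eq, (hasDerivAt_circleLog ε u).cexp.deriv, hankelLog_of_mem hu,
    ← mul_assoc, ← Complex.exp_add, mul_comm]
  ring_nf

theorem hankelWeight_of_gt (hε : 0 < ε) (hu : 2 * Real.pi < u) :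
    hankelWeight s ε u = Complex.exp (2 * Real.pi * Complex.I * s) *
      ((ε + (u - 2 * Real.pi) : ℝ) : ℂ) ^ (s - 1) := by
  have path_eq : hankelPath ε =ᶠ[𝓝 u] fun u => ((ε + (u - 2 * Real.pi) : ℝ) : ℂ) := by
    filter_upwards [lt_mem_nhds hu] with v hv using hankelPath_of_gt hε hv
  have deriv_path : deriv (hankelPath ε) u = 1 := by
    simpa using path_eq.deriv_eq.trans
      (((hasDerivAt_id u).sub_const (2 * Real.pi)).const_add ε).ofReal_comp.deriv
  rw [hankelWeight, deriv_path, hankelLog_of_gt hu, mul_add, Complex.exp_add,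
    exp_mul_ofReal_log (by linarith), mul_one, mul_comm, mul_comm (s - 1),
    ← exp_two_pi_I_mul_add_one (s - 1), sub_add_cancel]

theorem measurePreserving_sub_left_Iio (ε : ℝ) : MeasurePreserving (fun u : ℝ => ε - u)
    (volume.restrict (Set.Iio 0)) (volume.restrict (Set.Ioi ε)) := by
  have := (Measure.measurePreserving_sub_left volume ε).restrict_preimage_emb
    (MeasurableEquiv.subLeft ε).measurableEmbedding (Set.Ioi ε)
  rwa [Set.preimage_const_sub_Ioi, sub_self] at this

theorem measurePreserving_add_right_Ioi (a b : ℝ) : MeasurePreserving (fun u : ℝ => u + (b - a))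
    (volume.restrict (Set.Ioi a)) (volume.restrict (Set.Ioi b)) := by
  have := (measurePreserving_add_right volume (b - a)).restrict_preimage_emb
    (MeasurableEquiv.addRight _).measurableEmbedding (Set.Ioi b)
  rwa [Set.preimage_add_const_Ioi, sub_sub_cancel] at this

section Pieces

variable {E : Type*} [NormedAddCommGroup E] {h g₁ g₂ g₃ : ℝ → E}

theorem integrable_of_hankel_pieces (h₁ : ∀ u < 0, h u = g₁ (ε - u))
    (h₂ : ∀ u ∈ Set.Ioo 0 (2 * Real.pi), h u = g₂ u)
    (h₃ : ∀ u, 2 * Real.pi < u → h u = g₃ (u + (ε - 2 * Real.pi)))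
    (i₁ : IntegrableOn g₁ (Set.Ioi ε)) (i₂ : IntegrableOn g₂ (Set.Ioc 0 (2 * Real.pi)))
    (i₃ : IntegrableOn g₃ (Set.Ioi ε)) : Integrable h := by
  have int₁ : IntegrableOn h (Set.Iic 0) := by
    rw [integrableOn_Iic_iff_integrableOn_Iio]
    exact IntegrableOn.congr_fun (((measurePreserving_sub_left_Iio ε).integrable_comp_emb
      (MeasurableEquiv.subLeft ε).measurableEmbedding).2 i₁) (fun u hu => (h₁ u hu).symm)
      measurableSet_Iio
  have int₂ : IntegrableOn h (Set.Ioc 0 (2 * Real.pi)) := by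
    rw [integrableOn_Ioc_iff_integrableOn_Ioo] at i₂ ⊢
    exact i₂.congr_fun (fun u hu => (h₂ u hu).symm) measurableSet_Ioo
  have int₃ : IntegrableOn h (Set.Ioi (2 * Real.pi)) :=
    IntegrableOn.congr_fun (((measurePreserving_add_right_Ioi _ ε).integrable_comp_emb
      (MeasurableEquiv.addRight _).measurableEmbedding).2 i₃) (fun u hu => (h₃ u hu).symm)
      measurableSet_Ioi
  simpa [Set.Iic_union_Ioc_eq_Iic Real.two_pi_pos.le] using (int₁.union int₂).union int₃

theorem integral_eq_of_hankel_pieces [NormedSpace ℝ E] (h₁ : ∀ u < 0, h u = g₁ (ε - u))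
    (h₂ : ∀ u ∈ Set.Ioo 0 (2 * Real.pi), h u = g₂ u)
    (h₃ : ∀ u, 2 * Real.pi < u → h u = g₃ (u + (ε - 2 * Real.pi)))
    (i₁ : IntegrableOn g₁ (Set.Ioi ε)) (i₂ : IntegrableOn g₂ (Set.Ioc 0 (2 * Real.pi)))
    (i₃ : IntegrableOn g₃ (Set.Ioi ε)) :
    ∫ u, h u = (∫ t in Set.Ioi ε, g₁ t) + (∫ θ in (0 : ℝ)..2 * Real.pi, g₂ θ) +
      ∫ t in Set.Ioi ε, g₃ t := by
  have int_h := integrable_of_hankel_pieces h₁ h₂ h₃ i₁ i₂ i₃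
  have eq₁ : ∫ u in Set.Iic 0, h u = ∫ t in Set.Ioi ε, g₁ t := by
    rw [integral_Iic_eq_integral_Iio, setIntegral_congr_fun measurableSet_Iio h₁]
    exact (measurePreserving_sub_left_Iio ε).integral_comp
      (MeasurableEquiv.subLeft ε).measurableEmbedding g₁
  have eq₂ : ∫ u in 0..2 * Real.pi, h u = ∫ θ in 0..2 * Real.pi, g₂ θ := by
    simp only [intervalIntegral.integral_of_le Real.two_pi_pos.le, integral_Ioc_eq_integral_Ioo,
      setIntegral_congr_fun measurableSet_Ioo h₂]
  have eq₃ : ∫ u in Set.Ioi (2 * Real.pi), h u = ∫ t in Set.Ioi ε, g₃ t := by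
    rw [setIntegral_congr_fun measurableSet_Ioi h₃]
    exact (measurePreserving_add_right_Ioi _ ε).integral_comp
      (MeasurableEquiv.addRight _).measurableEmbedding g₃
  rw [← intervalIntegral.integral_Iic_add_Ioi int_h.integrableOn int_h.integrableOn (b := 0), eq₁,
    ← intervalIntegral.integral_interval_add_Ioi int_h.integrableOn int_h.integrableOn
      (b := 2 * Real.pi), eq₂, eq₃, add_assoc]

end Pieces

theorem integrableOn_rpow_mul_exp_Ioi (hε : 0 < ε) {a : ℝ} (ha : 0 < a) (σ : ℝ) :
    IntegrableOn (fun t : ℝ => t ^ σ * Real.exp (-(a * t))) (Set.Ioi ε) := by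
  refine integrable_of_isBigO_exp_neg (half_pos ha) ?_ ?_
  · exact (continuousOn_id.rpow_const fun t ht => .inl (hε.trans_le ht).ne').mul (by fun_prop)
  · refine ((isLittleO_rpow_exp_pos_mul_atTop σ (half_pos ha)).isBigO.mul
      (Asymptotics.isBigO_refl (fun t => Real.exp (-(a * t))) atTop)).congr_right fun t => ?_
    rw [← Real.exp_add]; ring_nf

theorem integrable_exp_mul_norm_hankelWeight (hε : 0 < ε) {a : ℝ} (ha : 0 < a) (s : ℂ) :
    Integrable fun u => Real.exp (-(a * (hankelPath ε u).re)) * ‖hankelWeight s ε u‖ := by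
  have int_ray := integrableOn_rpow_mul_exp_Ioi hε ha (s - 1).re
  refine integrable_of_hankel_pieces (ε := ε)
    (g₂ := fun θ => Real.exp (-(a * (Complex.exp (circleLog ε θ)).re)) *
      ‖Complex.I * Complex.exp (s * circleLog ε θ)‖)
    (fun u hu => ?_) (fun u hu => ?_) (fun u hu => ?_) int_ray
    (Continuous.integrableOn_Ioc (by fun_prop))
    (int_ray.const_mul ‖Complex.exp (2 * Real.pi * Complex.I * s)‖)
  · rw [hankelPath_of_neg hε hu, hankelWeight_of_neg hε hu, norm_neg,
      Complex.norm_cpow_eq_rpow_re_of_pos (by linarith), Complex.ofReal_re, mul_comm]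
  · rw [hankelPath_of_mem hu, hankelWeight_of_mem hu]
  · rw [hankelPath_of_gt hε hu, hankelWeight_of_gt hε hu, norm_mul,
      Complex.norm_cpow_eq_rpow_re_of_pos (by linarith), Complex.ofReal_re, add_sub_left_comm]
    ring

end Contour

/-! ### Hankel integrals as complex powers of the integration operator -/

/-- The integral of `F(x + t) t^{s-1} dt` over the ray `t > ε`. -/
def hankelRay (ε : ℝ) (s : ℂ) (F : ℂ → ℂ) (x : ℂ) : ℂ :=
  ∫ t in Set.Ioi ε, F (x + t) * (t : ℂ) ^ (s - 1)

/-- The integral of `F(x + t) t^{s-1} dt` over the circle `|t| = ε`, with `0 ≤ arg t ≤ 2π`. -/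
def hankelCircle (ε : ℝ) (s : ℂ) (F : ℂ → ℂ) (x : ℂ) : ℂ :=
  Complex.I * ∫ θ in (0 : ℝ)..2 * Real.pi,
    F (x + Complex.exp (circleLog ε θ)) * Complex.exp (s * circleLog ε θ)

section

variable {F : ℂ → ℂ} {ε δ : ℝ} {x s : ℂ}

theorem add_exp_circleLog_mem_closedBall (hε : 0 < ε) (x : ℂ) (θ : ℝ) :
    x + Complex.exp (circleLog ε θ) ∈ Metric.closedBall x ε := by
  rw [mem_closedBall_iff_norm, add_sub_cancel_left, norm_exp_circleLog hε]

theorem Decaying.continuous_circle (hF : Decaying F) (hε : 0 < ε)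
    (hx : Metric.closedBall x ε ⊆ strip 1) (s : ℂ) :
    Continuous fun θ => F (x + Complex.exp (circleLog ε θ)) * Complex.exp (s * circleLog ε θ) :=
  (hF.differentiableOn.continuousOn.comp_continuous (by fun_prop)
    fun θ => hx (add_exp_circleLog_mem_closedBall hε x θ)).mul (by fun_prop)

theorem Decaying.integrableOn_Ioi (hF : Decaying F) (hε : 0 < ε) (hx : x ∈ strip 1) (s : ℂ) :
    IntegrableOn (fun t : ℝ => F (x + t) * (t : ℂ) ^ (s - 1)) (Set.Ioi ε) := by
  obtain ⟨η, hη, hxη⟩ := exists_mem_strip hx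
  obtain ⟨C, hC⟩ := hF.exists_norm_le hη
  have Ioi_subset : Set.Ioi ε ⊆ Set.Ioi 0 := Set.Ioi_subset_Ioi hε.le
  exact ((integrableOn_rpow_mul_exp_Ioi hε one_half_pos (s.re - 1)).const_mul _).mono'
    ((hF.aestronglyMeasurable hx _).mono_set Ioi_subset)
    (ae_restrict_of_forall_mem measurableSet_Ioi fun t ht =>
      norm_weyl_integrand_le hC hxη (Ioi_subset ht))

theorem integral_hankel_eq_ray_add_circle (hF : Decaying F) (hε : 0 < ε)
    (hx : Metric.closedBall x ε ⊆ strip 1) (s : ℂ) :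
    ∫ u, F (x + hankelPath ε u) * hankelWeight s ε u =
      (Complex.exp (2 * Real.pi * Complex.I * s) - 1) * hankelRay ε s F x +
        hankelCircle ε s F x := by
  have int_ray := hF.integrableOn_Ioi hε (hx (Metric.mem_closedBall_self hε.le)) s
  have cont_circle := (hF.continuous_circle hε hx s).const_mul Complex.I
  rw [integral_eq_of_hankel_pieces (ε := ε)
    (fun u hu => ?_) (fun u hu => ?_) (fun u hu => ?_) int_ray.neg cont_circle.integrableOn_Ioc
    (int_ray.const_mul (Complex.exp (2 * Real.pi * Complex.I * s))), hankelRay, hankelCircle,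
    integral_neg', intervalIntegral.integral_const_mul, integral_const_mul]
  · ring
  · rw [hankelPath_of_neg hε hu, hankelWeight_of_neg hε hu, mul_neg, Pi.neg_apply]
  · rw [hankelPath_of_mem hu, hankelWeight_of_mem hu, mul_left_comm]
  · rw [hankelPath_of_gt hε hu, hankelWeight_of_gt hε hu, add_sub_left_comm, mul_left_comm]

theorem hankelRay_add_one_negDeriv (hF : Decaying F) (hε : 0 < ε) (hx : x ∈ strip 1) (s : ℂ) :
    hankelRay ε (s + 1) (negDeriv F) x = s * hankelRay ε s F x + F (x + ε) * (ε : ℂ) ^ s := by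
  have int_ray := (hF.integrableOn_Ioi hε hx s).const_mul s
  have int_ray' := hF.negDeriv.integrableOn_Ioi hε hx (s + 1)
  have deriv_mul_cpow : ∀ t ∈ Set.Ici ε, HasDerivAt (fun t : ℝ => F (x + t) * (t : ℂ) ^ s)
      (s * (F (x + t) * (t : ℂ) ^ (s - 1)) - negDeriv F (x + t) * (t : ℂ) ^ (s + 1 - 1)) t := by
    intro t ht
    have t_pos : 0 < t := hε.trans_le ht
    have deriv_cpow : HasDerivAt (fun t : ℝ => (t : ℂ) ^ s) (s * (t : ℂ) ^ (s - 1)) t := by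
      simpa using ((hasDerivAt_id (t : ℂ)).cpow_const (c := s) (.inl (by simpa))).comp_ofReal
    refine ((hF.hasDerivAt_shift hx t_pos.le).mul deriv_cpow).congr_deriv ?_
    rw [add_sub_cancel_right]; ring
  have by_parts := integral_Ioi_of_hasDerivAt_of_tendsto' deriv_mul_cpow (int_ray.sub int_ray')
    (hF.tendsto_zero hx s)
  rw [integral_sub int_ray int_ray', integral_const_mul] at by_parts
  rw [hankelRay, hankelRay]
  linear_combination -by_parts

theorem hankelCircle_add_one_negDeriv (hF : Decaying F) (hε : 0 < ε)
    (hx : Metric.closedBall x ε ⊆ strip 1) (s : ℂ) :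
    hankelCircle ε (s + 1) (negDeriv F) x = s * hankelCircle ε s F x -
      (Complex.exp (2 * Real.pi * Complex.I * s) - 1) * (F (x + ε) * (ε : ℂ) ^ s) := by
  have cont := (hF.continuous_circle hε hx s).const_mul (s * Complex.I)
  have cont' := (hF.negDeriv.continuous_circle hε hx (s + 1)).const_mul Complex.I
  have deriv_mul_exp : ∀ θ ∈ Set.uIcc 0 (2 * Real.pi), HasDerivAt
      (fun θ : ℝ => F (x + Complex.exp (circleLog ε θ)) * Complex.exp (s * circleLog ε θ))
      (s * Complex.I * (F (x + Complex.exp (circleLog ε θ)) * Complex.exp (s * circleLog ε θ)) -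
        Complex.I * (negDeriv F (x + Complex.exp (circleLog ε θ)) *
          Complex.exp ((s + 1) * circleLog ε θ))) θ := by
    intro θ _
    have deriv_F := (hF.differentiableAt
      (hx (add_exp_circleLog_mem_closedBall hε x θ))).hasDerivAt.comp θ
      ((hasDerivAt_circleLog ε θ).cexp.const_add x)
    refine (deriv_F.mul ((hasDerivAt_circleLog ε θ).const_mul s).cexp).congr_deriv ?_
    rw [add_mul, one_mul, Complex.exp_add, negDeriv, Function.comp_apply]
    ring
  have by_parts := intervalIntegral.integral_eq_sub_of_hasDerivAt deriv_mul_exp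
    ((cont.sub cont').intervalIntegrable _ _)
  rw [intervalIntegral.integral_sub (cont.intervalIntegrable _ _) (cont'.intervalIntegrable _ _),
    intervalIntegral.integral_const_mul, intervalIntegral.integral_const_mul,
    exp_mul_circleLog_zero hε, exp_mul_circleLog_two_pi hε, exp_circleLog_zero hε,
    exp_circleLog_two_pi hε] at by_parts
  rw [hankelCircle, hankelCircle]
  linear_combination -by_parts

/- In the variable `w = log t`, both pieces of the Hankel integral are integrals of
`F(x + exp w) exp(s w)`, and Cauchy's theorem on the rectangle `[log δ, log ε] × [0, 2π]` shows that
the radius of the circle does not matter. -/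

theorem hankelRay_sub_hankelRay (hF : Decaying F) (hδ : 0 < δ) (hδε : δ ≤ ε) (hx : x ∈ strip 1)
    (s : ℂ) : hankelRay δ s F x - hankelRay ε s F x =
      ∫ v in Real.log δ..Real.log ε, F (x + Complex.exp v) * Complex.exp (s * v) := by
  have hε := hδ.trans_le hδε
  have int_ray := hF.integrableOn_Ioi hδ hx s
  have change_var := intervalIntegral.integral_deriv_smul_comp''
    (g := fun t : ℝ => F (x + t) * (t : ℂ) ^ (s - 1))
    (Real.continuous_exp.continuousOn (s := Set.uIcc (Real.log δ) (Real.log ε)))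
    (fun v _ => (Real.hasDerivAt_exp v).hasDerivWithinAt) Real.continuous_exp.continuousOn ?_
  · rw [hankelRay, hankelRay, ← intervalIntegral.integral_interval_add_Ioi' (b := ε)
      (intervalIntegrable_iff_integrableOn_Ioc_of_le hδε |>.2 <|
        int_ray.mono_set Set.Ioc_subset_Ioi_self) (hF.integrableOn_Ioi hε hx s),
      add_sub_cancel_right]
    rw [Real.exp_log hε, Real.exp_log hδ] at change_var
    rw [← change_var]
    refine intervalIntegral.integral_congr fun v _ => ?_
    have cpow_exp : ((Real.exp v : ℝ) : ℂ) ^ (s - 1) = Complex.exp ((s - 1) * v) := by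
      rw [← exp_mul_ofReal_log (Real.exp_pos v), Real.log_exp]
    simp only [Function.comp_apply, Complex.real_smul, cpow_exp]
    rw [Complex.ofReal_exp, mul_left_comm, ← Complex.exp_add]
    ring_nf
  · have image_subset : Real.exp '' Set.uIcc (Real.log δ) (Real.log ε) ⊆ Set.Ioi 0 := by
      rintro _ ⟨v, _, rfl⟩; exact Real.exp_pos v
    exact ((hF.continuousOn_shift hx).mono (image_subset.trans Set.Ioi_subset_Ici_self)).mul
      ((continuousOn_cpow_Ioi _).mono image_subset)

theorem hankelCircle_sub_hankelCircle (hF : Decaying F) (hδ : 0 < δ) (hδε : δ ≤ ε)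
    (hx : Metric.closedBall x ε ⊆ strip 1) (s : ℂ) :
    hankelCircle ε s F x - hankelCircle δ s F x =
      (Complex.exp (2 * Real.pi * Complex.I * s) - 1) *
        ∫ v in Real.log δ..Real.log ε, F (x + Complex.exp v) * Complex.exp (s * v) := by
  let f (w : ℂ) : ℂ := F (x + Complex.exp w) * Complex.exp (s * w)
  have circleLog_re (ε θ : ℝ) : (circleLog ε θ).re = Real.log ε := by simp [circleLog]
  have circleLog_im (ε θ : ℝ) : (circleLog ε θ).im = θ := by simp [circleLog]
  have diff_f : DifferentiableOn ℂ f
      (Set.uIcc (circleLog δ 0).re (circleLog ε (2 * Real.pi)).re ×ℂ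
        Set.uIcc (circleLog δ 0).im (circleLog ε (2 * Real.pi)).im) := by
    rintro w ⟨hw, -⟩
    rw [circleLog_re, circleLog_re, Set.uIcc_of_le (Real.log_le_log hδ hδε)] at hw
    have mem_strip : x + Complex.exp w ∈ strip 1 := hx <| by
      rw [mem_closedBall_iff_norm, add_sub_cancel_left, Complex.norm_exp]
      exact (Real.le_log_iff_exp_le (hδ.trans_le hδε)).1 hw.2
    exact (((hF.differentiableAt mem_strip).comp w (by fun_prop)).mul
      (by fun_prop)).differentiableWithinAt
  have cauchy := Complex.integral_boundary_rect_eq_zero_of_differentiableOn f _ _ diff_f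
  have top (v : ℝ) : f (v + (2 * Real.pi : ℝ) * Complex.I) =
      Complex.exp (2 * Real.pi * Complex.I * s) * f v := by
    simp only [f, mul_add s, Complex.exp_add, Complex.ofReal_mul, Complex.ofReal_ofNat,
      Complex.exp_two_pi_mul_I, mul_one, mul_comm s (2 * _ * _)]
    ring
  simp only [circleLog_re, circleLog_im, top, intervalIntegral.integral_const_mul,
    Complex.ofReal_zero, zero_mul, add_zero, smul_eq_mul] at cauchy
  simp only [hankelCircle, circleLog]
  linear_combination cauchy

theorem tendsto_hankelRay (hF : Decaying F) (hx : x ∈ strip 1) (hs : 0 < s.re) :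
    Tendsto (fun δ => hankelRay δ s F x) (𝓝[>] 0)
      (𝓝 (∫ t in Set.Ioi (0 : ℝ), F (x + t) * (t : ℂ) ^ (s - 1))) := by
  refine ((aecover_Ioi_of_Ioi (μ := volume) (tendsto_id.mono_left
    nhdsWithin_le_nhds)).integral_tendsto_of_countably_generated
    (hF.integrableOn hx hs)).congr' ?_
  filter_upwards [self_mem_nhdsWithin] with δ (hδ : 0 < δ)
  rw [Measure.restrict_restrict measurableSet_Ioi, Set.Ioi_inter_Ioi, id, sup_of_le_left hδ.le,
    hankelRay]

theorem norm_exp_mul_circleLog_le (hδ : 0 < δ) {θ : ℝ} (hθ : θ ∈ Set.Icc 0 (2 * Real.pi)) :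
    ‖Complex.exp (s * circleLog δ θ)‖ ≤ δ ^ s.re * Real.exp (|s.im| * (2 * Real.pi)) := by
  have im_mul_le : -s.im * θ ≤ |s.im| * (2 * Real.pi) :=
    mul_le_mul (neg_le_abs _) hθ.2 hθ.1 (abs_nonneg _)
  rw [Complex.norm_exp, Real.rpow_def_of_pos hδ, ← Real.exp_add, Real.exp_le_exp]
  simp [circleLog]
  linarith

theorem tendsto_hankelCircle (hF : Decaying F) (hx : x ∈ strip 1) (hs : 0 < s.re) :
    Tendsto (fun δ => hankelCircle δ s F x) (𝓝[>] 0) (𝓝 0) := by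
  obtain ⟨r, r_pos, hr⟩ := Metric.eventually_nhds_iff_ball.1 <|
    (hF.differentiableAt hx).continuousAt.norm.eventually_lt_const (lt_add_one ‖F x‖)
  have bound_tendsto : Tendsto (fun δ : ℝ => (‖F x‖ + 1) *
      (δ ^ s.re * Real.exp (|s.im| * (2 * Real.pi))) * |2 * Real.pi - 0|) (𝓝[>] 0) (𝓝 0) := by
    have rpow_tendsto : Tendsto (fun δ : ℝ => δ ^ s.re) (𝓝[>] 0) (𝓝 0) := by
      simpa [Real.zero_rpow hs.ne'] using
        (tendsto_id.rpow_const (p := s.re) (.inr hs.le)).mono_left (nhdsWithin_le_nhds (a := 0))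
    simpa using ((rpow_tendsto.mul_const _).const_mul (‖F x‖ + 1)).mul_const |2 * Real.pi - 0|
  refine squeeze_zero_norm' ?_ bound_tendsto
  filter_upwards [Ioo_mem_nhdsGT r_pos] with δ ⟨hδ, hδr⟩
  rw [hankelCircle, norm_mul, Complex.norm_I, one_mul]
  refine intervalIntegral.norm_integral_le_of_norm_le_const fun θ hθ => ?_
  rw [Set.uIoc_of_le Real.two_pi_pos.le] at hθ
  rw [norm_mul]
  gcongr
  · exact (hr _ (Metric.closedBall_subset_ball hδr
      (add_exp_circleLog_mem_closedBall hδ x θ))).le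
  · exact norm_exp_mul_circleLog_le hδ (Set.Ioc_subset_Icc_self hθ)

theorem hankelRay_add_hankelCircle_of_re_pos (hF : Decaying F) (hε : 0 < ε)
    (hx : Metric.closedBall x ε ⊆ strip 1) (hs : 0 < s.re) :
    (Complex.exp (2 * Real.pi * Complex.I * s) - 1) * hankelRay ε s F x + hankelCircle ε s F x =
      (Complex.exp (2 * Real.pi * Complex.I * s) - 1) * Complex.Gamma s * weyl s F x := by
  have hx₁ := hx (Metric.mem_closedBall_self hε.le)
  have radius_indep : ∀ᶠ δ in 𝓝[>] 0, (Complex.exp (2 * Real.pi * Complex.I * s) - 1) *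
      hankelRay ε s F x + hankelCircle ε s F x =
        (Complex.exp (2 * Real.pi * Complex.I * s) - 1) * hankelRay δ s F x +
          hankelCircle δ s F x := by
    filter_upwards [Ioo_mem_nhdsGT hε] with δ ⟨hδ, hδε⟩
    have ray := hankelRay_sub_hankelRay hF hδ hδε.le hx₁ s
    have circle := hankelCircle_sub_hankelCircle hF hδ hδε.le hx s
    linear_combination circle -
      (Complex.exp (2 * Real.pi * Complex.I * s) - 1) * ray
  have limits_eq := tendsto_nhds_unique (tendsto_const_nhds.congr' radius_indep)
    (((tendsto_hankelRay hF hx₁ hs).const_mul _).add (tendsto_hankelCircle hF hx₁ hs))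
  have weyl_eq := weyl_eq_weylBase hF (s := s) (n := 0) (by simpa) hx₁
  have := Complex.Gamma_ne_zero_of_re_pos hs
  rw [limits_eq, add_zero, weyl_eq, Nat.cast_zero, add_zero, Function.iterate_zero_apply, weylBase]
  field_simp

theorem hankelRay_add_hankelCircle (hF : Decaying F) (hε : 0 < ε)
    (hx : Metric.closedBall x ε ⊆ strip 1) (hs : ∀ m : ℤ, s ≠ m) :
    (Complex.exp (2 * Real.pi * Complex.I * s) - 1) * hankelRay ε s F x + hankelCircle ε s F x =
      (Complex.exp (2 * Real.pi * Complex.I * s) - 1) * Complex.Gamma s * weyl s F x := by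
  obtain ⟨n, hn⟩ := exists_nat_gt (-s.re)
  have hx₁ := hx (Metric.mem_closedBall_self hε.le)
  induction n generalizing s F with
  | zero => exact hankelRay_add_hankelCircle_of_re_pos hF hε hx (by simpa using hn)
  | succ n ih =>
    have s_ne : s ≠ 0 := by simpa using hs 0
    have := ih hF.negDeriv (s := s + 1)
      (fun m e => hs (m - 1) (by push_cast; rw [← e, add_sub_cancel_right]))
      (by push_cast at hn; rw [Complex.add_re, Complex.one_re]; linarith)
    rw [hankelRay_add_one_negDeriv hF hε hx₁, hankelCircle_add_one_negDeriv hF hε hx,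
      Complex.Gamma_add_one s s_ne, weyl_negDeriv hF (s + 1) hx₁, add_sub_cancel_right,
      exp_two_pi_I_mul_add_one] at this
    refine mul_left_cancel₀ s_ne ?_
    linear_combination this

theorem integral_hankel (hF : Decaying F) (hε : 0 < ε) (hx : Metric.closedBall x ε ⊆ strip 1)
    (hs : ∀ m : ℤ, s ≠ m) : ∫ u, F (x + hankelPath ε u) * hankelWeight s ε u =
      (Complex.exp (2 * Real.pi * Complex.I * s) - 1) * Complex.Gamma s * weyl s F x := by
  rw [integral_hankel_eq_ray_add_circle hF hε hx, hankelRay_add_hankelCircle hF hε hx hs]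

end

/-! ### The kernel of the iterated integrals -/

/-- The generating function `z / (exp z - 1)` of the Bernoulli numbers, with its removable
singularity at `0` filled in. -/
def bernoulliGF (z : ℂ) : ℂ := (dslope Complex.exp 0 z)⁻¹

/-- The derivative of `z / (exp z - 1)`: in the variable `t = exp (-z)` it is `L^des(0)(t)`. -/
def desKernel : ℂ → ℂ := deriv bernoulliGF

theorem bernoulliGF_of_ne_zero {z : ℂ} (hz : z ≠ 0) :
    bernoulliGF z = z / (Complex.exp z - 1) := by
  rw [bernoulliGF, dslope_of_ne _ hz, slope_def_field, inv_div, Complex.exp_zero, sub_zero]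

theorem exp_sub_one_ne_zero {z : ℂ} (hz : z ∈ strip 1) (h0 : z ≠ 0) : Complex.exp z - 1 ≠ 0 := by
  intro h
  have hz' := abs_lt.1 hz.2
  have hπ := Real.pi_gt_three
  exact h0 (Complex.exp_inj_of_neg_pi_lt_of_le_pi (by linarith) (by linarith)
    (by simpa using Real.pi_pos) (by simpa using Real.pi_pos.le)
    (by rw [sub_eq_zero.1 h, Complex.exp_zero]))

theorem differentiableAt_bernoulliGF {z : ℂ} (hz : z ∈ strip 1) :
    DifferentiableAt ℂ bernoulliGF z := by
  have h : DifferentiableOn ℂ (dslope Complex.exp 0) Set.univ :=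
    (Complex.differentiableOn_dslope univ_mem).2 Complex.differentiable_exp.differentiableOn
  refine (h.differentiableAt univ_mem).inv ?_
  rcases eq_or_ne z 0 with rfl | h0
  · simp [dslope_same]
  · rw [dslope_of_ne _ h0, slope_def_field, Complex.exp_zero, sub_zero]
    exact div_ne_zero (exp_sub_one_ne_zero hz h0) h0

theorem hasDerivAt_bernoulliGF {z : ℂ} (hz : z ∈ strip 1) :
    HasDerivAt bernoulliGF (desKernel z) z :=
  (differentiableAt_bernoulliGF hz).hasDerivAt

theorem norm_bernoulliGF_le {z : ℂ} (hz : z ∈ strip 1) (h1 : 1 ≤ z.re) :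
    ‖bernoulliGF z‖ ≤ 4 * Real.exp (-z.re / 2) := by
  have h0 : z ≠ 0 := by rintro rfl; norm_num at h1
  have hnum : ‖z‖ ≤ 2 * Real.exp (z.re / 2) := by
    have := Complex.norm_le_abs_re_add_abs_im z
    rw [abs_of_pos (by linarith)] at this
    linarith [hz.2, Real.add_one_le_exp (z.re / 2)]
  have hden : Real.exp z.re / 2 ≤ ‖Complex.exp z - 1‖ := by
    have := norm_sub_norm_le (Complex.exp z) 1
    rw [Complex.norm_exp, norm_one] at this
    linarith [Real.add_one_le_exp z.re]
  have hexp : Real.exp (-z.re / 2) * Real.exp z.re = Real.exp (z.re / 2) := by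
    rw [← Real.exp_add]; ring_nf
  rw [bernoulliGF_of_ne_zero h0, norm_div, div_le_iff₀ (lt_of_lt_of_le (by positivity) hden)]
  calc ‖z‖ ≤ 2 * Real.exp (z.re / 2) := hnum
    _ = 4 * Real.exp (-z.re / 2) * (Real.exp z.re / 2) := by rw [← hexp]; ring
    _ ≤ _ := by gcongr

theorem decaying_bernoulliGF : Decaying bernoulliGF := by
  refine ⟨fun z hz => (differentiableAt_bernoulliGF hz).differentiableWithinAt, fun η hη => ?_⟩
  have hK : IsCompact (Set.Icc (-η) 1 ×ℂ Set.Icc (-η) η) := isCompact_Icc.reProdIm isCompact_Icc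
  have hsub : Set.Icc (-η) 1 ×ℂ Set.Icc (-η) η ⊆ strip 1 := fun z hz =>
    ⟨by linarith [hz.1.1], (abs_le.2 hz.2).trans_lt hη⟩
  obtain ⟨C, hC⟩ := hK.exists_bound_of_continuousOn (f := bernoulliGF) fun z hz =>
    (differentiableAt_bernoulliGF (hsub hz)).continuousAt.continuousWithinAt
  suffices h : ∀ z ∈ strip η,
      ‖bernoulliGF z‖ ≤ max 4 (|C| * Real.exp (1 / 2)) * Real.exp (-z.re / 2) from
    .of_bound _ (by simpa using h)
  intro z hz
  rcases le_total 1 z.re with h | h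
  · exact (norm_bernoulliGF_le (strip_mono hη.le hz) h).trans
      (mul_le_mul_of_nonneg_right (le_max_left _ _) (Real.exp_nonneg _))
  · calc ‖bernoulliGF z‖ ≤ |C| * 1 :=
          (hC z ⟨⟨hz.1.le, h⟩, abs_le.1 hz.2.le⟩).trans (by simpa using le_abs_self C)
      _ ≤ |C| * Real.exp (1 / 2 + -z.re / 2) := by
          gcongr
          exact Real.one_le_exp (by linarith)
      _ = |C| * Real.exp (1 / 2) * Real.exp (-z.re / 2) := by rw [Real.exp_add]; ring
      _ ≤ _ := mul_le_mul_of_nonneg_right (le_max_right _ _) (Real.exp_nonneg _)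

theorem decaying_desKernel : Decaying desKernel := by
  convert decaying_bernoulliGF.negDeriv.neg using 1
  funext z
  simp [negDeriv, desKernel]

theorem desKernel_of_ne_zero {z : ℂ} (hz : z ∈ strip 1) (h0 : z ≠ 0) :
    desKernel z = 1 / (Complex.exp z - 1) - z * Complex.exp z / (Complex.exp z - 1) ^ 2 := by
  have hexp := exp_sub_one_ne_zero hz h0
  have hbern : bernoulliGF =ᶠ[𝓝 z] fun w => w / (Complex.exp w - 1) := by
    filter_upwards [isOpen_ne.mem_nhds h0] with w hw using bernoulliGF_of_ne_zero hw
  have hderiv : HasDerivAt (fun w => w / (Complex.exp w - 1))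
      ((1 * (Complex.exp z - 1) - z * Complex.exp z) / (Complex.exp z - 1) ^ 2) z :=
    (hasDerivAt_id' z).fun_div ((Complex.hasDerivAt_exp z).sub_const 1) hexp
  rw [desKernel, hbern.deriv_eq, hderiv.deriv]
  field_simp

theorem measurable_desKernel : Measurable desKernel := measurable_deriv _

/-- One factor of the generating function `genH`. -/
def genFactor (c : ℝ) (z : ℂ) : ℂ :=
  1 / (Complex.exp z - 1) - c / (Complex.exp (c * z) - 1)

theorem ofReal_mul_mem_strip {z : ℂ} {η c : ℝ} (hz : z ∈ strip η) (hc : 0 < c) :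
    (c : ℂ) * z ∈ strip (c * η) := by
  constructor
  · rw [Complex.re_ofReal_mul]; nlinarith [hz.1]
  · rw [Complex.im_ofReal_mul, abs_mul, abs_of_pos hc]; exact mul_lt_mul_of_pos_left hz.2 hc

theorem hasDerivAt_bernoulliGF_ofReal_mul {z : ℂ} {c : ℝ} (hz : c * z ∈ strip 1) :
    HasDerivAt (fun c : ℝ => bernoulliGF (c * z)) (desKernel (c * z) * z) c := by
  have h : HasDerivAt (fun c : ℝ => (c : ℂ) * z) z c := by
    simpa using (hasDerivAt_id c).ofReal_comp.mul_const z
  exact HasDerivAt.comp (h₂ := bernoulliGF) c (hasDerivAt_bernoulliGF hz) h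

theorem genFactor_eq {z : ℂ} {c : ℝ} (hc : 0 < c) (hz : z ≠ 0) :
    genFactor c z = (bernoulliGF z - bernoulliGF (c * z)) / z := by
  have hc' : (c : ℂ) ≠ 0 := by exact_mod_cast hc.ne'
  rw [genFactor, bernoulliGF_of_ne_zero hz, bernoulliGF_of_ne_zero (mul_ne_zero hc' hz)]
  field_simp

theorem exists_norm_desKernel_ofReal_mul_le : ∃ C : ℝ, 0 ≤ C ∧ ∀ c ∈ Set.Icc (1 / 2 : ℝ) 2,
    ∀ z ∈ strip (1 / 4), ‖desKernel (c * z)‖ ≤ C * Real.exp (-z.re / 4) := by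
  obtain ⟨C, hC⟩ := decaying_desKernel.exists_norm_le (η := 1 / 2) (by norm_num)
  refine ⟨|C| * Real.exp (1 / 2), by positivity, fun c ⟨hc1, hc2⟩ z hz => ?_⟩
  have hcz : (c : ℂ) * z ∈ strip (1 / 2) :=
    strip_mono (by linarith) (ofReal_mul_mem_strip hz (by linarith))
  have hexp : -(c * z).re / 2 ≤ 1 / 2 + -z.re / 4 := by
    rw [Complex.re_ofReal_mul]
    nlinarith [hz.1]
  calc ‖desKernel (c * z)‖ ≤ C * Real.exp (-(c * z).re / 2) := hC _ hcz
    _ ≤ |C| * Real.exp (1 / 2 + -z.re / 4) := by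
        gcongr
        exact le_abs_self C
    _ = |C| * Real.exp (1 / 2) * Real.exp (-z.re / 4) := by rw [Real.exp_add, mul_assoc]

theorem exists_norm_genFactor_le : ∃ C : ℝ, 0 ≤ C ∧ ∀ c ∈ Set.Ioo (1 / 2 : ℝ) 2,
    ∀ z ∈ strip (1 / 4), ‖genFactor c z‖ ≤ C * Real.exp (-z.re / 4) * |1 - c| := by
  obtain ⟨C, hC0, hC⟩ := exists_norm_desKernel_ofReal_mul_le
  refine ⟨C, hC0, fun c hc z hz => ?_⟩
  rcases eq_or_ne z 0 with rfl | h0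
  · simp only [genFactor, Complex.exp_zero, sub_self, div_zero, mul_zero, norm_zero]
    positivity
  rw [genFactor_eq (by linarith [hc.1]) h0, norm_div, div_le_iff₀ (norm_pos_iff.2 h0)]
  have hmean := (convex_Icc (1 / 2 : ℝ) 2).norm_image_sub_le_of_norm_hasDerivWithin_le
    (f := fun θ : ℝ => bernoulliGF (θ * z)) (C := C * Real.exp (-z.re / 4) * ‖z‖)
    (fun θ hθ => (hasDerivAt_bernoulliGF_ofReal_mul (strip_mono (by linarith [hθ.2])
      (ofReal_mul_mem_strip hz (by linarith [hθ.1])))).hasDerivWithinAt)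
    (fun θ hθ => by
      rw [norm_mul]
      exact mul_le_mul_of_nonneg_right (hC θ hθ z hz) (norm_nonneg z))
    (Set.Ioo_subset_Icc_self hc) (show (1 : ℝ) ∈ Set.Icc (1 / 2 : ℝ) 2 by norm_num)
  rw [Complex.ofReal_one, one_mul, Real.norm_eq_abs] at hmean
  linarith

theorem tendsto_genFactor {z : ℂ} (hz : z ∈ strip 1) (h0 : z ≠ 0) :
    Tendsto (fun c : ℝ => 1 / (1 - (c : ℂ)) * genFactor c z) (𝓝[≠] 1) (𝓝 (desKernel z)) := by
  have hderiv : HasDerivAt (fun c : ℝ => bernoulliGF (c * z)) (desKernel z * z) 1 := by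
    simpa using hasDerivAt_bernoulliGF_ofReal_mul (c := 1) (z := z) (by simpa using hz)
  have hslope := (hasDerivAt_iff_tendsto_slope.1 hderiv).div_const z
  rw [mul_div_cancel_right₀ _ h0] at hslope
  refine hslope.congr' ?_
  filter_upwards [self_mem_nhdsWithin, nhdsWithin_le_nhds (lt_mem_nhds one_pos)] with c hc hc0
  have hc1 : (c : ℂ) - 1 ≠ 0 := sub_ne_zero.2 (by exact_mod_cast hc)
  have hc2 : 1 - (c : ℂ) ≠ 0 := by rwa [← neg_sub, neg_ne_zero]
  rw [genFactor_eq hc0 h0, slope_def_module, Complex.real_smul]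
  push_cast
  rw [one_mul]
  field_simp
  ring

/-! ### Iterated Weyl integrals and iterated Hankel integrals -/

/-- `J^{sᵣ}[G J^{sᵣ₋₁}[G ⋯ J^{s₁}[G] ⋯ ]]` for complex exponents, where `G` is `desKernel` and
`J^s` is the Weyl integral. -/
def iterWeyl : (r : ℕ) → (Fin r → ℂ) → ℂ → ℂ
  | 0, _ => 1
  | r + 1, s => weyl (s (Fin.last r)) (desKernel * iterWeyl r fun i => s i.castSucc)

theorem decayingFamilyAt_desKernel_mul_iterWeyl {P : Type*} [NormedAddCommGroup P]
    [NormedSpace ℂ P] [FiniteDimensional ℂ P] (r : ℕ) {σ : P → Fin r → ℂ}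
    (hσ : Differentiable ℂ σ) (p₀ : P) :
    DecayingFamilyAt (fun p => desKernel * iterWeyl r (σ p)) p₀ := by
  induction r with
  | zero => simpa only [iterWeyl, mul_one] using decaying_desKernel.family p₀
  | succ r ih =>
    have h := ih (σ := fun p i => σ p i.castSucc)
      (differentiable_pi.2 fun i => differentiable_pi.1 hσ i.castSucc)
    exact (decaying_desKernel.family p₀).mul (h.weyl (differentiable_pi.1 hσ (Fin.last r)))

theorem decaying_desKernel_mul_iterWeyl (r : ℕ) (s : Fin r → ℂ) :
    Decaying (desKernel * iterWeyl r s) :=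
  (decayingFamilyAt_desKernel_mul_iterWeyl (P := ℂ) r (differentiable_const s) 0).decaying

theorem differentiable_iterWeyl_apply_zero (r : ℕ) :
    Differentiable ℂ fun s : Fin r → ℂ => iterWeyl r s 0 := by
  cases r with
  | zero => exact differentiable_const _
  | succ r =>
    intro s
    have h := (decayingFamilyAt_desKernel_mul_iterWeyl r
      (σ := fun (p : Fin (r + 1) → ℂ) i => p i.castSucc) (by fun_prop) s).weyl
      (σ := fun p => p (Fin.last r)) (by fun_prop)
    exact DifferentiableAt.comp (f := fun p : Fin (r + 1) → ℂ => (p, (0 : ℂ))) s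
      (h.differentiableAt.self_of_nhds 0 (zero_mem_strip one_pos)) (by fun_prop)

section TailSum

variable {r : ℕ} {ε : ℝ}

/-- The sum `tⱼ + ⋯ + tᵣ` of the points `tₖ` of the Hankel contour with parameters `uₖ`. -/
def tailSum (ε : ℝ) (u : Fin r → ℝ) (j : Fin r) : ℂ :=
  ∑ k ∈ Finset.Ici j, hankelPath ε (u k)

theorem measurable_tailSum (ε : ℝ) (j : Fin r) : Measurable fun u => tailSum ε u j :=
  Finset.measurable_sum _ fun k _ => (measurable_hankelPath ε).comp (measurable_pi_apply k)

theorem tailSum_eq_add (ε : ℝ) (u : Fin r → ℝ) (j : Fin r) :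
    tailSum ε u j = hankelPath ε (u j) + ∑ k ∈ Finset.Ioi j, hankelPath ε (u k) := by
  rw [tailSum, ← Finset.Ioi_insert, Finset.sum_insert Finset.notMem_Ioi_self]

theorem tailSum_snoc_castSucc (ε : ℝ) (u : Fin r → ℝ) (v : ℝ) (j : Fin r) :
    tailSum ε (Fin.snoc u v : Fin (r + 1) → ℝ) j.castSucc = tailSum ε u j + hankelPath ε v := by
  have tailSum_eq_sum_ite {m : ℕ} (w : Fin m → ℝ) (i : Fin m) :
      tailSum ε w i = ∑ k, if i ≤ k then hankelPath ε (w k) else 0 := by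
    rw [tailSum, ← Finset.sum_filter]
    congr 1
    ext k; simp
  rw [tailSum_eq_sum_ite, tailSum_eq_sum_ite, Fin.sum_univ_castSucc]
  simp [Fin.snoc_castSucc, Fin.snoc_last, Fin.le_last]

theorem tailSum_snoc_last (ε : ℝ) (u : Fin r → ℝ) (v : ℝ) :
    tailSum ε (Fin.snoc u v : Fin (r + 1) → ℝ) (Fin.last r) = hankelPath ε v := by
  rw [tailSum, ← Fin.top_eq_last, Finset.Ici_top, Finset.sum_singleton, Fin.top_eq_last,
    Fin.snoc_last]

theorem neg_le_re_sum_hankelPath (hε : 0 < ε) (u : Fin r → ℝ) (S : Finset (Fin r)) :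
    -(r * ε) ≤ (∑ k ∈ S, hankelPath ε (u k)).re := by
  rw [Complex.re_sum]
  have hsum := S.card_nsmul_le_sum _ _ fun k _ => neg_le_hankelPath_re hε (u k)
  have hcard : (S.card : ℝ) ≤ r := by exact_mod_cast card_finset_fin_le S
  rw [nsmul_eq_mul] at hsum
  nlinarith

theorem abs_im_sum_hankelPath_le (hε : 0 < ε) (u : Fin r → ℝ) (S : Finset (Fin r)) :
    |(∑ k ∈ S, hankelPath ε (u k)).im| ≤ r * ε := by
  rw [Complex.im_sum]
  have hsum := (Finset.abs_sum_le_sum_abs _ _).trans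
    (S.sum_le_card_nsmul _ _ fun k _ => abs_hankelPath_im_le hε (u k))
  have hcard : (S.card : ℝ) ≤ r := by exact_mod_cast card_finset_fin_le S
  rw [nsmul_eq_mul] at hsum
  nlinarith

theorem add_tailSum_mem_strip (hε : 0 < ε) {x : ℂ} {η : ℝ} (hx : x ∈ strip η) (u : Fin r → ℝ)
    (j : Fin r) : x + tailSum ε u j ∈ strip (η + r * ε) :=
  add_mem_strip hx (neg_le_re_sum_hankelPath hε u _) (abs_im_sum_hankelPath_le hε u _)

theorem re_hankelPath_sub_le_re_tailSum (hε : 0 < ε) (u : Fin r → ℝ) (j : Fin r) :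
    (hankelPath ε (u j)).re - r * ε ≤ (tailSum ε u j).re := by
  rw [tailSum_eq_add, Complex.add_re]
  linarith [neg_le_re_sum_hankelPath hε u (Finset.Ioi j)]

theorem hankelLog_injective (hε : 0 < ε) : Function.Injective (hankelLog ε) := by
  have cases_hankelLog : ∀ u,
      (u ≤ 0 ∧ (hankelLog ε u).im = 0 ∧ Real.exp (hankelLog ε u).re = ε - u) ∨
      (0 < u ∧ u ≤ 2 * Real.pi ∧ (hankelLog ε u).im = u ∧ Real.exp (hankelLog ε u).re = ε) ∨
      (2 * Real.pi < u ∧ (hankelLog ε u).im = 2 * Real.pi ∧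
        Real.exp (hankelLog ε u).re = ε + (u - 2 * Real.pi)) := by
    intro u
    rw [hankelLog]
    split_ifs with h1 h2
    · left; simp [h1, Real.exp_log (by linarith : 0 < ε - u)]
    · right; left; simp [not_le.1 h1, h2, Real.exp_log hε]
    · right; right
      simp [not_le.1 h2, Real.exp_log (by linarith [not_le.1 h2] : 0 < ε + (u - 2 * Real.pi))]
  intro u v huv
  have hu := cases_hankelLog u
  rw [huv] at hu
  have := Real.two_pi_pos
  rcases hu with ⟨_, _, _⟩ | ⟨_, _, _, _⟩ | ⟨_, _, _⟩ <;>
  rcases cases_hankelLog v with ⟨_, _, _⟩ | ⟨_, _, _, _⟩ | ⟨_, _, _⟩ <;> linarith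

theorem countable_setOf_exp_eq (w : ℂ) : {z : ℂ | Complex.exp z = w}.Countable := by
  rcases Set.eq_empty_or_nonempty {z : ℂ | Complex.exp z = w} with h | ⟨z₀, hz₀⟩
  · exact h ▸ Set.countable_empty
  · refine (Set.countable_range fun n : ℤ => z₀ + n * (2 * Real.pi * Complex.I)).mono ?_
    intro z hz
    obtain ⟨n, hn⟩ := Complex.exp_eq_exp_iff_exists_int.1 (Eq.trans hz (Eq.symm hz₀))
    exact ⟨n, hn.symm⟩

theorem countable_setOf_hankelPath_eq (hε : 0 < ε) (w : ℂ) :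
    {u : ℝ | hankelPath ε u = w}.Countable :=
  (countable_setOf_exp_eq w).preimage_of_injOn (f := hankelLog ε) (hankelLog_injective hε).injOn

theorem ae_tailSum_ne_zero (hε : 0 < ε) (j : Fin r) : ∀ᵐ u : Fin r → ℝ, tailSum ε u j ≠ 0 := by
  cases r with
  | zero => exact j.elim0
  | succ r =>
    have mp := (volume_preserving_piFinSuccAbove (fun _ : Fin (r + 1) => ℝ) j).symm
    have meas : MeasurableSet {u : Fin (r + 1) → ℝ | tailSum ε u j = 0} :=
      measurableSet_eq_fun (measurable_tailSum ε j) measurable_const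
    rw [ae_iff]
    simp only [ne_eq, not_not]
    rw [← mp.measure_preimage meas.nullMeasurableSet, Measure.volume_eq_prod,
      Measure.prod_apply_symm (mp.measurable meas)]
    refine (lintegral_congr fun u => ?_).trans lintegral_zero
    -- Only the `j`-th summand depends on `v`, so `v` lies in a fibre of `hankelPath`.
    refine Set.Countable.measure_zero ((countable_setOf_hankelPath_eq hε
      (-∑ k ∈ Finset.Ioi j, hankelPath ε ((j.insertNth 0 u : Fin (r + 1) → ℝ) k))).mono ?_) _
    intro v hv
    have hv' : tailSum ε (j.insertNth v u : Fin (r + 1) → ℝ) j = 0 := hv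
    rw [tailSum_eq_add, Fin.insertNth_apply_same] at hv'
    rw [Set.mem_ofPred_eq, eq_neg_iff_add_eq_zero, ← hv']
    congr 1
    refine Finset.sum_congr rfl fun k hk => ?_
    obtain ⟨i, rfl⟩ := Fin.exists_succAbove_eq (Finset.mem_Ioi.1 hk).ne'
    rw [Fin.insertNth_apply_succAbove, Fin.insertNth_apply_succAbove]

/-- The integrand `∏ⱼ f(x + tⱼ + ⋯ + tᵣ) ∏ₖ tₖ^{sₖ-1} dtₖ` on the `r`-th power of the Hankel
contour. For `x = 0` and `f = genFactor c` it is `desIntegrand`. -/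
def tailIntegrand (f : ℂ → ℂ) (s : Fin r → ℂ) (ε : ℝ) (x : ℂ) (u : Fin r → ℝ) : ℂ :=
  (∏ j, f (x + tailSum ε u j)) * ∏ k, hankelWeight (s k) ε (u k)

/-- The product of the functions `C exp(-a Re tₖ) |tₖ^{sₖ-1} dtₖ|`, which dominates
`tailIntegrand`. -/
def hankelBound (s : Fin r → ℂ) (ε a C : ℝ) (u : Fin r → ℝ) : ℝ :=
  ∏ k, C * (Real.exp (-(a * (hankelPath ε (u k)).re)) * ‖hankelWeight (s k) ε (u k)‖)

variable {f : ℂ → ℂ} {s : Fin r → ℂ} {x : ℂ} {η a C : ℝ}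

theorem integrable_hankelBound (hε : 0 < ε) (ha : 0 < a) : Integrable (hankelBound s ε a C) :=
  Integrable.fintype_prod (f := fun k v =>
    C * (Real.exp (-(a * (hankelPath ε v).re)) * ‖hankelWeight (s k) ε v‖))
    fun k => (integrable_exp_mul_norm_hankelWeight hε ha (s k)).const_mul C

theorem measurable_tailIntegrand (hf : Measurable f) (s : Fin r → ℂ) (ε : ℝ) (x : ℂ) :
    Measurable (tailIntegrand f s ε x) :=
  (Finset.measurable_prod _ fun j _ => hf.comp ((measurable_tailSum ε j).const_add x)).mul
    (Finset.measurable_prod _ fun k _ =>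
      (measurable_hankelWeight (s k) ε).comp (measurable_pi_apply k))

theorem norm_tailIntegrand_le (hε : 0 < ε) (ha : 0 ≤ a) (hx : x ∈ strip η)
    (hf : ∀ z ∈ strip (η + r * ε), ‖f z‖ ≤ C * Real.exp (-(a * z.re))) (u : Fin r → ℝ) :
    ‖tailIntegrand f s ε x u‖ ≤ hankelBound s ε a (|C| * Real.exp (a * (η + r * ε))) u := by
  rw [tailIntegrand, ← Finset.prod_mul_distrib, norm_prod]
  refine Finset.prod_le_prod (fun k _ => norm_nonneg _) fun k _ => ?_
  rw [norm_mul, ← mul_assoc]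
  refine mul_le_mul_of_nonneg_right ?_ (norm_nonneg _)
  have hre : (hankelPath ε (u k)).re - (η + r * ε) ≤ (x + tailSum ε u k).re := by
    rw [Complex.add_re]
    linarith [re_hankelPath_sub_le_re_tailSum hε u k, hx.1]
  calc ‖f (x + tailSum ε u k)‖ ≤ C * Real.exp (-(a * (x + tailSum ε u k).re)) :=
        hf _ (add_tailSum_mem_strip hε hx u k)
    _ ≤ |C| * Real.exp (-(a * ((hankelPath ε (u k)).re - (η + r * ε)))) := by
        gcongr
        exact le_abs_self C
    _ = _ := by rw [mul_assoc, ← Real.exp_add]; ring_nf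

theorem integrable_tailIntegrand (hε : 0 < ε) (ha : 0 < a) (hx : x ∈ strip η)
    (hf : ∀ z ∈ strip (η + r * ε), ‖f z‖ ≤ C * Real.exp (-(a * z.re))) (hmeas : Measurable f) :
    Integrable (tailIntegrand f s ε x) :=
  (integrable_hankelBound hε ha).mono' (measurable_tailIntegrand hmeas s ε x).aestronglyMeasurable
    (.of_forall (norm_tailIntegrand_le hε ha.le hx hf))

theorem tendsto_integral_tailIntegrand {ι : Type*} {l : Filter ι} [l.IsCountablyGenerated]
    {𝓕 : ι → ℂ → ℂ} (hε : 0 < ε) (ha : 0 < a) (hη : r * ε < η)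
    (hmeas : ∀ i, Measurable (𝓕 i))
    (hbound : ∀ᶠ i in l, ∀ z ∈ strip η, ‖𝓕 i z‖ ≤ C * Real.exp (-(a * z.re)))
    (hlim : ∀ z ∈ strip η, z ≠ 0 → Tendsto (fun i => 𝓕 i z) l (𝓝 (f z))) :
    Tendsto (fun i => ∫ u, tailIntegrand (𝓕 i) s ε 0 u) l
      (𝓝 (∫ u, tailIntegrand f s ε 0 u)) := by
  have h0 : (0 : ℂ) ∈ strip (η - r * ε) := zero_mem_strip (sub_pos.2 hη)
  refine tendsto_integral_filter_of_dominated_convergence _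
    (.of_forall fun i => (measurable_tailIntegrand (hmeas i) s ε 0).aestronglyMeasurable)
    (hbound.mono fun i hi =>
      .of_forall (norm_tailIntegrand_le hε ha.le h0 (by rwa [sub_add_cancel])))
    (integrable_hankelBound hε ha) ?_
  filter_upwards [ae_all_iff.2 fun j : Fin r => ae_tailSum_ne_zero hε j] with u hu
  refine Tendsto.mul_const _ (tendsto_finsetProd _ fun j _ => hlim _ ?_ ?_)
  · simpa using add_tailSum_mem_strip hε h0 u j
  · rw [zero_add]
    exact hu j

theorem tailIntegrand_snoc (f : ℂ → ℂ) (s : Fin (r + 1) → ℂ) (ε : ℝ) (x : ℂ) (u : Fin r → ℝ)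
    (v : ℝ) : tailIntegrand f s ε x (Fin.snoc u v : Fin (r + 1) → ℝ) =
      f (x + hankelPath ε v) * hankelWeight (s (Fin.last r)) ε v *
        tailIntegrand f (fun i => s i.castSucc) ε (x + hankelPath ε v) u := by
  simp only [tailIntegrand, Fin.prod_univ_castSucc, tailSum_snoc_castSucc, tailSum_snoc_last,
    Fin.snoc_castSucc, Fin.snoc_last]
  simp only [add_comm (tailSum _ _ _), add_assoc]
  ring

theorem integral_tailIntegrand_succ {s : Fin (r + 1) → ℂ}
    (hint : Integrable (tailIntegrand f s ε x)) :
    ∫ u, tailIntegrand f s ε x u =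
      ∫ v, f (x + hankelPath ε v) * hankelWeight (s (Fin.last r)) ε v *
        ∫ u, tailIntegrand f (fun i => s i.castSucc) ε (x + hankelPath ε v) u := by
  let e := MeasurableEquiv.piFinSuccAbove (fun _ : Fin (r + 1) => ℝ) (Fin.last r)
  have mp : MeasurePreserving e.symm :=
    (volume_preserving_piFinSuccAbove (fun _ : Fin (r + 1) => ℝ) (Fin.last r)).symm
  have e_symm (v : ℝ) (u : Fin r → ℝ) : e.symm (v, u) = (Fin.snoc u v : Fin (r + 1) → ℝ) :=
    Fin.insertNth_last' v u
  have hint' : Integrable (fun q => tailIntegrand f s ε x (e.symm q)) (volume.prod volume) :=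
    (mp.integrable_comp_emb e.symm.measurableEmbedding).2 hint
  rw [← mp.integral_comp', Measure.volume_eq_prod, integral_prod _ hint']
  simp only [e_symm, tailIntegrand_snoc, integral_const_mul]

end TailSum

theorem integrable_tailIntegrand_desKernel {r : ℕ} {s : Fin r → ℂ} {ε η : ℝ} {x : ℂ} (hε : 0 < ε)
    (hη : η + r * ε < 1) (hx : x ∈ strip η) : Integrable (tailIntegrand desKernel s ε x) := by
  obtain ⟨C, hC⟩ := decaying_desKernel.exists_norm_le hη
  refine integrable_tailIntegrand hε one_half_pos hx (C := C) (fun z hz => ?_)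
    measurable_desKernel
  convert hC z hz using 3
  ring

theorem integral_tailIntegrand_desKernel {r : ℕ} {s : Fin r → ℂ} (hs : ∀ k, ∀ n : ℤ, s k ≠ n)
    {ε η : ℝ} {x : ℂ} (hε : 0 < ε) (hη : η + r * ε < 1) (hx : x ∈ strip η) :
    ∫ u, tailIntegrand desKernel s ε x u =
      (∏ k, (Complex.exp (2 * Real.pi * Complex.I * s k) - 1) * Complex.Gamma (s k)) *
        iterWeyl r s x := by
  induction r generalizing η x with
  | zero => simp [tailIntegrand, iterWeyl, volume_pi, Measure.real]
  | succ r ih =>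
    have hη' : η + ε + r * ε < 1 := by push_cast at hη; linarith
    have hball : Metric.closedBall x ε ⊆ strip 1 :=
      (closedBall_subset_strip hx).trans (strip_mono (by linarith [mul_nonneg r.cast_nonneg hε.le]))
    rw [integral_tailIntegrand_succ (integrable_tailIntegrand_desKernel hε hη hx),
      Fin.prod_univ_castSucc, iterWeyl, mul_assoc,
      ← integral_hankel (decaying_desKernel_mul_iterWeyl r _) hε hball (hs (Fin.last r)),
      ← integral_const_mul]
    refine integral_congr_ae (.of_forall fun v => ?_)
    have hv := add_mem_strip hx (neg_le_hankelPath_re hε v) (abs_hankelPath_im_le hε v)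
    simp only [ih (fun k => hs k.castSucc) hη' hv, Pi.mul_apply]
    ring

/-! ### The limit `c → 1` -/

theorem desIntegrand_eq_tailIntegrand (r : ℕ) (s : Fin r → ℂ) (c ε : ℝ) :
    desIntegrand r s c ε = tailIntegrand (genFactor c) s ε 0 := by
  funext u
  simp only [tailIntegrand, zero_add]
  rfl

theorem measurable_genFactor (c : ℝ) : Measurable (genFactor c) := by
  unfold genFactor
  fun_prop

theorem exists_norm_div_one_sub_mul_genFactor_le : ∃ C : ℝ, ∀ᶠ c : ℝ in 𝓝[≠] 1,
    ∀ z ∈ strip (1 / 4),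
      ‖1 / (1 - (c : ℂ)) * genFactor c z‖ ≤ C * Real.exp (-(1 / 4 * z.re)) := by
  obtain ⟨C, -, hC⟩ := exists_norm_genFactor_le
  refine ⟨C, ?_⟩
  filter_upwards [nhdsWithin_le_nhds (Ioo_mem_nhds one_half_lt_one one_lt_two),
    self_mem_nhdsWithin] with c hc hc1 z hz
  have hpos : 0 < |1 - c| := abs_pos.2 (sub_ne_zero.2 (Ne.symm hc1))
  have hnorm : ‖1 - (c : ℂ)‖ = |1 - c| := by
    rw [← Complex.ofReal_one, ← Complex.ofReal_sub, Complex.norm_real, Real.norm_eq_abs]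
  rw [norm_mul, norm_div, norm_one, hnorm, one_div, inv_mul_le_iff₀ hpos]
  exact (hC c hc z hz).trans_eq (by ring_nf)

theorem tailIntegrand_const_mul {r : ℕ} (a : ℂ) (f : ℂ → ℂ) (s : Fin r → ℂ) (ε : ℝ) (x : ℂ)
    (u : Fin r → ℝ) :
    tailIntegrand (fun z => a * f z) s ε x u = a ^ r * tailIntegrand f s ε x u := by
  simp only [tailIntegrand, Finset.prod_mul_distrib, Finset.prod_const, Finset.card_univ,
    Fintype.card_fin, mul_assoc]

theorem integrable_desIntegrand {r : ℕ} {ε : ℝ} (hε : 0 < ε) (hr : r * ε < 1 / 4)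
    (s : Fin r → ℂ) : ∀ᶠ c in 𝓝[≠] (1 : ℝ), Integrable (desIntegrand r s c ε) := by
  obtain ⟨C, -, hC⟩ := exists_norm_genFactor_le
  filter_upwards [nhdsWithin_le_nhds (Ioo_mem_nhds one_half_lt_one one_lt_two)] with c hc
  rw [desIntegrand_eq_tailIntegrand]
  refine integrable_tailIntegrand (η := 1 / 4 - r * ε) (a := 1 / 4) (C := C * |1 - c|) hε
    (by norm_num) (zero_mem_strip (sub_pos.2 hr)) (fun z hz => ?_) (measurable_genFactor c)
  rw [sub_add_cancel] at hz
  exact (hC c hc z hz).trans_eq (by ring_nf)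

theorem tendsto_integral_desIntegrand {r : ℕ} {ε : ℝ} (hε : 0 < ε) (hr : r * ε < 1 / 4)
    (s : Fin r → ℂ) :
    Tendsto (fun c : ℝ => (1 / (1 - (c : ℂ))) ^ r * ∫ u, desIntegrand r s c ε u) (𝓝[≠] 1)
      (𝓝 (∫ u, tailIntegrand desKernel s ε 0 u)) := by
  obtain ⟨C, hC⟩ := exists_norm_div_one_sub_mul_genFactor_le
  have hlim := tendsto_integral_tailIntegrand (s := s) hε (by norm_num) hr
    (fun c => (measurable_genFactor c).const_mul _) hC
    fun z hz hz0 => tendsto_genFactor (strip_mono (by norm_num) hz) hz0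
  simpa only [tailIntegrand_const_mul, integral_const_mul, desIntegrand_eq_tailIntegrand]
    using hlim

theorem exp_two_pi_I_mul_sub_one_mul_Gamma_ne_zero {s : ℂ} (hs : ∀ n : ℤ, s ≠ n) :
    (Complex.exp (2 * Real.pi * Complex.I * s) - 1) * Complex.Gamma s ≠ 0 := by
  refine mul_ne_zero (fun h => ?_)
    (Complex.Gamma_ne_zero fun m e => hs (-m) (by rw [e]; push_cast; rfl))
  obtain ⟨n, hn⟩ := Complex.exp_eq_one_iff.1 (sub_eq_zero.1 h)
  refine hs n (mul_left_cancel₀ Complex.two_pi_I_ne_zero ?_)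
  rw [hn]; ring

theorem desCoeff_mul_integral_tailIntegrand {r : ℕ} {s : Fin r → ℂ} (hs : ∀ k, ∀ n : ℤ, s k ≠ n)
    {ε : ℝ} (hε : 0 < ε) (hr : r * ε < 1) :
    desCoeff r s * ∫ u, tailIntegrand desKernel s ε 0 u = iterWeyl r s 0 := by
  obtain ⟨η, hη0, hη⟩ := exists_between (sub_pos.2 hr)
  rw [integral_tailIntegrand_desKernel hs hε (lt_sub_iff_add_lt.1 hη) (zero_mem_strip hη0),
    desCoeff, ← mul_assoc, ← Finset.prod_mul_distrib, Finset.prod_eq_one, one_mul]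
  exact fun k _ => one_div_mul_cancel (exp_two_pi_I_mul_sub_one_mul_Gamma_ne_zero (hs k))

theorem isDesMZF_iterWeyl (r : ℕ) : IsDesMZF r fun s => iterWeyl r s 0 := by
  refine ⟨differentiable_iterWeyl_apply_zero r, ?_⟩
  have hsmall : Tendsto (fun ε : ℝ => (r : ℝ) * ε) (𝓝[>] 0) (𝓝 0) := by
    have : Tendsto (fun ε : ℝ => (r : ℝ) * ε) (𝓝 0) (𝓝 (r * 0)) := tendsto_id.const_mul _
    rw [mul_zero] at this
    exact this.mono_left nhdsWithin_le_nhds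
  filter_upwards [self_mem_nhdsWithin,
    hsmall.eventually_lt_const (by norm_num : (0 : ℝ) < 1 / 4)] with ε hε hr s hs
  refine ⟨integrable_desIntegrand hε hr s, ?_⟩
  rw [← desCoeff_mul_integral_tailIntegrand hs hε (hr.trans (by norm_num))]
  refine ((tendsto_integral_desIntegrand hε hr s).const_mul (desCoeff r s)).congr fun c => ?_
  rw [one_div_pow]
  ring

theorem isDesMZF_desMZF (r : ℕ) : IsDesMZF r (desMZF r) := by
  have h : ∃ Z, IsDesMZF r Z := ⟨_, isDesMZF_iterWeyl r⟩
  rw [desMZF, dif_pos h]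
  exact h.choose_spec

theorem desMZF_eq_iterWeyl (r : ℕ) (s : Fin r → ℂ) : desMZF r s = iterWeyl r s 0 :=
  congrFun ((isDesMZF_desMZF r).unique (isDesMZF_iterWeyl r)) s

/-! ### Integer points -/

/-- The function `f` on `(0, 1)` corresponds to `F` under the substitution `t = exp (-z)`. -/
def Represents (F : ℂ → ℂ) (f : ℝ → ℝ) : Prop :=
  ∀ t ∈ Set.Ioo (0 : ℝ) 1, (f t : ℂ) = F (-Real.log t : ℝ)

theorem neg_log_mem_strip {t η : ℝ} (ht : t ∈ Set.Ioo (0 : ℝ) 1) (hη : 0 < η) :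
    ((-Real.log t : ℝ) : ℂ) ∈ strip η :=
  ofReal_mem_strip hη (by linarith [Real.log_neg ht.1 ht.2])

section Represents

variable {F F' : ℂ → ℂ} {f f' : ℝ → ℝ} {t : ℝ}

theorem Represents.congr (h : Represents F f) (hF : Set.EqOn F F' (strip 1)) :
    Represents F' f := fun t ht => by
  rw [h t ht, hF (neg_log_mem_strip ht one_pos)]

theorem Represents.mul (h : Represents F f) (h' : Represents F' f') :
    Represents (F * F') (fun t => f t * f' t) := fun t ht => by
  rw [Complex.ofReal_mul, h t ht, h' t ht, Pi.mul_apply]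

theorem Represents.tendsto_ofReal (h : Represents F f) (hF : ContinuousAt F 0) :
    Tendsto (fun t => (f t : ℂ)) (𝓝[<] 1) (𝓝 (F 0)) := by
  have hlog : ContinuousAt (fun t : ℝ => ((-Real.log t : ℝ) : ℂ)) 1 :=
    Complex.continuous_ofReal.continuousAt.comp (Real.continuousAt_log one_ne_zero).neg
  have hlog0 : Tendsto (fun t : ℝ => ((-Real.log t : ℝ) : ℂ)) (𝓝[<] 1) (𝓝 0) := by
    simpa using hlog.tendsto.mono_left nhdsWithin_le_nhds
  refine (hF.tendsto.comp hlog0).congr' ?_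
  filter_upwards [Ioo_mem_nhdsLT one_pos] with t ht using (h t ht).symm

theorem Represents.im_apply_zero (h : Represents F f) (hF : ContinuousAt F 0) : (F 0).im = 0 := by
  have := (Complex.continuous_im.tendsto _).comp (h.tendsto_ofReal hF)
  simp only [Function.comp_def, Complex.ofReal_im] at this
  exact tendsto_nhds_unique this tendsto_const_nhds

theorem Represents.tendsto (h : Represents F f) (hF : ContinuousAt F 0) :
    Tendsto f (𝓝[<] 1) (𝓝 (F 0).re) := by
  simpa only [Function.comp_def, Complex.ofReal_re] using
    (Complex.continuous_re.tendsto _).comp (h.tendsto_ofReal hF)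

theorem represents_desLiZero : Represents desKernel desLiZero := fun t ht => by
  have hlog0 : ((-Real.log t : ℝ) : ℂ) ≠ 0 := by
    rw [Complex.ofReal_ne_zero]
    linarith [Real.log_neg ht.1 ht.2]
  have ht0 : (t : ℂ) ≠ 0 := by exact_mod_cast ht.1.ne'
  have ht1 : 1 - (t : ℂ) ≠ 0 := sub_ne_zero.2 (by exact_mod_cast ht.2.ne')
  have hexp : Complex.exp ((-Real.log t : ℝ) : ℂ) = (t : ℂ)⁻¹ := by
    rw [← Complex.ofReal_exp, Real.exp_neg, Real.exp_log ht.1, Complex.ofReal_inv]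
  have hinv : (t : ℂ)⁻¹ - 1 = (1 - t) / t := by field_simp
  rw [desKernel_of_ne_zero (neg_log_mem_strip ht one_pos) hlog0, hexp, hinv, desLiZero]
  push_cast
  field_simp
  ring

theorem hasDerivAt_comp_neg_log (hF : Decaying F) (ht : t ∈ Set.Ioo (0 : ℝ) 1) :
    HasDerivAt (fun t : ℝ => F (-Real.log t : ℝ)) (negDeriv F (-Real.log t : ℝ) / t) t := by
  have hF' := (hF.differentiableAt (neg_log_mem_strip ht one_pos)).hasDerivAt
  have hlog : HasDerivAt (fun t : ℝ => ((-Real.log t : ℝ) : ℂ)) ((-t⁻¹ : ℝ) : ℂ) t :=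
    (Real.hasDerivAt_log ht.1.ne').neg.ofReal_comp
  refine (HasDerivAt.comp (h₂ := F) (h := fun t : ℝ => ((-Real.log t : ℝ) : ℂ)) t hF'
    hlog).congr_deriv ?_
  rw [negDeriv]
  push_cast
  ring

theorem Represents.negDeriv_opD (h : Represents F f) (hF : Decaying F) :
    Represents (negDeriv F) (opD f) := fun t ht => by
  have hF' : HasDerivAt (fun t => (f t : ℂ)) (negDeriv F (-Real.log t : ℝ) / t) t := by
    refine (hasDerivAt_comp_neg_log hF ht).congr_of_eventuallyEq ?_
    filter_upwards [Ioo_mem_nhds ht.1 ht.2] with v hv using h v hv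
  have hf : HasDerivAt f (negDeriv F (-Real.log t : ℝ) / t).re t := by
    simpa [Function.comp_def] using Complex.reCLM.hasFDerivAt.comp_hasDerivAt t hF'
  have ht0 : (t : ℂ) ≠ 0 := by exact_mod_cast ht.1.ne'
  rw [opD, hf.deriv, Complex.ofReal_mul, hf.ofReal_comp.unique hF', mul_div_cancel₀ _ ht0]

theorem Represents.intervalIntegrable_div (h : Represents F f) (hF : Decaying F)
    (ht : t ∈ Set.Ioo (0 : ℝ) 1) : IntervalIntegrable (fun v => (f v : ℂ) / v) volume 0 t := by
  have mem_Ioo_one {v : ℝ} (hv : v ∈ Set.Ioo 0 t) : v ∈ Set.Ioo (0 : ℝ) 1 :=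
    ⟨hv.1, hv.2.trans ht.2⟩
  obtain ⟨C, hC⟩ := hF.exists_norm_le one_half_lt_one
  have int_rpow : IntegrableOn (fun v : ℝ => C * v ^ (-(1 / 2) : ℝ)) (Set.Ioo 0 t) := by
    rw [← intervalIntegrable_iff_integrableOn_Ioo_of_le ht.1.le]
    exact (intervalIntegral.intervalIntegrable_rpow' (by norm_num)).const_mul C
  rw [intervalIntegrable_iff_integrableOn_Ioo_of_le ht.1.le]
  refine Integrable.mono' int_rpow ?_ (ae_restrict_of_forall_mem measurableSet_Ioo fun v hv => ?_)
  · refine (ContinuousOn.congr (f := fun v : ℝ => F (-Real.log v : ℝ) / v) ?_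
      fun v hv => by simp only [h v (mem_Ioo_one hv)]).aestronglyMeasurable measurableSet_Ioo
    exact ContinuousOn.div
      (fun v hv =>
        (hasDerivAt_comp_neg_log hF (mem_Ioo_one hv)).continuousAt.continuousWithinAt)
      (by fun_prop) fun v hv => by exact_mod_cast hv.1.ne'
  · rw [h v (mem_Ioo_one hv), norm_div, Complex.norm_real, Real.norm_of_nonneg hv.1.le,
      div_le_iff₀ hv.1]
    refine (hC _ (neg_log_mem_strip (mem_Ioo_one hv) one_half_pos)).trans_eq ?_
    rw [mul_assoc, ← Real.rpow_add_one hv.1.ne', Complex.ofReal_re, Real.rpow_def_of_pos hv.1]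
    ring_nf

theorem Represents.weyl_one_opJ (h : Represents F f) (hF : Decaying F) :
    Represents (weyl 1 F) (opJ f) := fun t ht => by
  have antideriv : ∀ v ∈ Set.Ioo 0 t, HasDerivAt (fun v : ℝ => weyl 1 F (-Real.log v : ℝ))
      ((f v : ℂ) / v) v := fun v hv => by
    have hv1 : v ∈ Set.Ioo (0 : ℝ) 1 := ⟨hv.1, hv.2.trans ht.2⟩
    have := hasDerivAt_comp_neg_log (hF.weyl 1) hv1
    rwa [negDeriv_weyl_one hF (neg_log_mem_strip hv1 one_pos), ← h v hv1] at this
  have lim_zero : Tendsto (fun v : ℝ => weyl 1 F (-Real.log v : ℝ)) (𝓝[>] 0) (𝓝 0) := by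
    have hlog : Tendsto (fun v : ℝ => -Real.log v) (𝓝[>] 0) atTop :=
      tendsto_neg_atBot_atTop.comp Real.tendsto_log_nhdsGT_zero
    have := ((hF.weyl 1).tendsto_zero (zero_mem_strip one_pos) 0).comp hlog
    simpa [Function.comp_def] using this
  have lim_t : Tendsto (fun v : ℝ => weyl 1 F (-Real.log v : ℝ)) (𝓝[<] t)
      (𝓝 (weyl 1 F (-Real.log t : ℝ))) :=
    (hasDerivAt_comp_neg_log (hF.weyl 1) ht).continuousAt.tendsto.mono_left nhdsWithin_le_nhds
  have ftc := intervalIntegral.integral_eq_sub_of_hasDerivAt_of_tendsto ht.1 antideriv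
    (h.intervalIntegrable_div hF ht) lim_zero lim_t
  rw [← sub_zero (weyl 1 F _), ← ftc, opJ, ← intervalIntegral.integral_ofReal]
  simp only [Complex.ofReal_div]

theorem Represents.weyl_natCast (h : Represents F f) (hF : Decaying F) (n : ℕ) :
    Represents (weyl n F) (opJ^[n] f) := by
  induction n with
  | zero => exact h.congr (by rw [Nat.cast_zero]; exact (weyl_zero hF).symm)
  | succ n ih =>
    rw [Function.iterate_succ_apply', Nat.cast_succ]
    exact (ih.weyl_one_opJ (hF.weyl n)).congr (weyl_one_weyl hF n)

theorem Represents.weyl_neg_natCast (h : Represents F f) (hF : Decaying F) (n : ℕ) :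
    Represents (weyl (-n : ℂ) F) (opD^[n] f) := by
  induction n with
  | zero => exact h.congr (by rw [Nat.cast_zero, neg_zero]; exact (weyl_zero hF).symm)
  | succ n ih =>
    rw [Function.iterate_succ_apply', Nat.cast_succ, neg_add, ← sub_eq_add_neg]
    exact (ih.negDeriv_opD (hF.weyl _)).congr (negDeriv_weyl_eq hF _)

theorem Represents.weyl_intCast (h : Represents F f) (hF : Decaying F) :
    ∀ k : ℤ, Represents (weyl k F) (opJPow k f)
  | .ofNat n => by simpa [opJPow] using h.weyl_natCast hF n
  | .negSucc n => by
    rw [Int.cast_negSucc]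
    exact h.weyl_neg_natCast hF (n + 1)

end Represents

/-- The function of `z = -log t` that corresponds to `desLiAux`. -/
def desLiStrip : List ℤ → ℂ → ℂ
  | [] => 1
  | m :: l => weyl m (desKernel * desLiStrip l)

theorem decaying_desKernel_mul_desLiStrip (l : List ℤ) : Decaying (desKernel * desLiStrip l) := by
  induction l with
  | nil => simpa only [desLiStrip, mul_one] using decaying_desKernel
  | cons m l ih => exact decaying_desKernel.mul (ih.weyl m)

theorem represents_desLiAux (l : List ℤ) : Represents (desLiStrip l) (desLiAux l) := by
  induction l with
  | nil => intro t _; simp [desLiStrip, desLiAux]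
  | cons m l ih =>
    exact (represents_desLiZero.mul ih).weyl_intCast (decaying_desKernel_mul_desLiStrip l) m

theorem continuousAt_desLiStrip (l : List ℤ) : ContinuousAt (desLiStrip l) 0 := by
  cases l with
  | nil => exact continuousAt_const
  | cons m l =>
    exact (((decaying_desKernel_mul_desLiStrip l).weyl m).differentiableAt
      (zero_mem_strip one_pos)).continuousAt

theorem im_desLiStrip_apply_zero (l : List ℤ) : (desLiStrip l 0).im = 0 :=
  (represents_desLiAux l).im_apply_zero (continuousAt_desLiStrip l)

theorem iterWeyl_intCast (r : ℕ) (k : Fin r → ℤ) :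
    iterWeyl r (fun i => (k i : ℂ)) = desLiStrip (List.ofFn k).reverse := by
  induction r with
  | zero => simp [iterWeyl, desLiStrip]
  | succ r ih =>
    rw [List.ofFn_succ', List.concat_eq_append, List.reverse_append]
    change weyl (k (Fin.last r)) (desKernel * iterWeyl r fun i => (k i.castSucc : ℂ)) = _
    rw [ih fun i => k i.castSucc]
    rfl

theorem desZeta_eq_desLiStrip (k : List ℤ) : desZeta k = desLiStrip k.reverse 0 := by
  rw [desZeta, desMZF_eq_iterWeyl, iterWeyl_intCast, List.ofFn_get]

theorem im_desZeta (k : List ℤ) : (desZeta k).im = 0 := by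
  rw [desZeta_eq_desLiStrip, im_desLiStrip_apply_zero]

theorem tendsto_desLi (k : List ℤ) : Tendsto (desLi k) (𝓝[<] 1) (𝓝 (desZeta k).re) := by
  rw [desZeta_eq_desLiStrip]
  exact (represents_desLiAux k.reverse).tendsto (continuousAt_desLiStrip _)

/-! ### The homomorphism on `𝓗` -/

namespace Word

theorem exponents_ofList (l : List ℤ) : (ofList l).exponents = l := by
  induction l with
  | nil => rfl
  | cons k l ih => exact congrArg (k :: ·) ih

theorem ofList_exponents {w : Word} (hw : w.last = 0) : ofList w.exponents = w := by
  induction w with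
  | pow k => exact congrArg pow hw.symm
  | powY k w ih => exact congrArg (powY k) (ih hw)

theorem endsInY_of_lead_ne_zero {w : Word} (h : w.last = 0) (h' : w.lead ≠ 0) : w.EndsInY :=
  ⟨depth_ne_zero h h', h⟩

theorem EndsInY.pow_mul {w : Word} (hw : w.EndsInY) (a : ℤ) : (pow a * w).EndsInY := by
  rw [Word.pow_mul]
  exact ⟨by rw [depth_shift]; exact hw.1, (last_shift a hw.1).trans hw.2⟩

theorem d_mul_j_mul (w : Word) : d * (j * w) = w := by
  rw [← mul_assoc, d_mul_j, one_mul]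

end Word

theorem shWord_mem_endsInYSpan_left {u v : Word} (hu : u.EndsInY) (hv : v.last = 0) :
    shWord u v ∈ endsInYSpan :=
  (shWord_mem u v hu.2 hv).2 (Or.inl hu.1)

theorem shWord_mem_endsInYSpan_right {u v : Word} (hu : u.last = 0) (hv : v.EndsInY) :
    shWord u v ∈ endsInYSpan :=
  (shWord_mem u v hu hv.2).2 (Or.inr hv.1)

/-- The function on the half strip obtained from a word by reading `j` as integration, `d` as
differentiation and `y` as multiplication by `desKernel`, applied to the constant `1`. The last
power of `j` is ignored, so this is meaningful only for words `w` with `w.last = 0`. -/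
def wordEval (w : Word) : ℂ → ℂ := desLiStrip w.exponents

theorem wordEval_pow (k : ℤ) : wordEval (.pow k) = 1 := rfl

theorem wordEval_powY (k : ℤ) (w : Word) :
    wordEval (.powY k w) = weyl k (desKernel * wordEval w) := rfl

theorem wordEval_powY_zero (w : Word) :
    Set.EqOn (wordEval (.powY 0 w)) (desKernel * wordEval w) (strip 1) := by
  rw [wordEval_powY, Int.cast_zero]
  exact weyl_zero (decaying_desKernel_mul_desLiStrip _)

theorem decaying_wordEval {w : Word} (hw : w.EndsInY) : Decaying (wordEval w) := by
  cases w with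
  | pow k => exact absurd rfl hw.1
  | powY k w => exact (decaying_desKernel_mul_desLiStrip _).weyl k

theorem wordEval_d_mul {w : Word} (hw : w.EndsInY) :
    Set.EqOn (wordEval (.d * w)) (negDeriv (wordEval w)) (strip 1) := by
  cases w with
  | pow k => exact absurd rfl hw.1
  | powY k w =>
    have hk : ((-1 + k : ℤ) : ℂ) = k - 1 := by push_cast; ring
    change Set.EqOn (weyl ((-1 + k : ℤ) : ℂ) _) (negDeriv (weyl k _)) _
    rw [hk]
    exact (negDeriv_weyl_eq (decaying_desKernel_mul_desLiStrip _) k).symm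

theorem negDeriv_wordEval_mul {u v : Word} (hu : u.EndsInY) (hv : v.EndsInY) :
    Set.EqOn (negDeriv (wordEval u * wordEval v))
      (wordEval (.d * u) * wordEval v + wordEval u * wordEval (.d * v)) (strip 1) := fun z hz => by
  rw [negDeriv_mul (decaying_wordEval hu) (decaying_wordEval hv) hz]
  simp only [Pi.add_apply, Pi.mul_apply, wordEval_d_mul hu hz, wordEval_d_mul hv hz]

/-- The `ℚ`-linear extension of `wordEval`. -/
def evalStrip : QDJY →ₗ[ℚ] (ℂ → ℂ) :=
  (Finsupp.linearCombination ℚ wordEval).comp coeffs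

theorem evalStrip_wd (w : Word) : evalStrip (wd w) = wordEval w := by
  have hw : coeffs (wd w) = Finsupp.single w 1 := rfl
  rw [evalStrip, LinearMap.comp_apply, hw, Finsupp.linearCombination_single, one_smul]

theorem evalStrip_apply (x : QDJY) (z : ℂ) :
    evalStrip x z = (coeffs x).sum fun w c => (c : ℂ) * wordEval w z := by
  simp only [evalStrip, LinearMap.comp_apply, Finsupp.linearCombination_apply, Finsupp.sum,
    Finset.sum_apply, Pi.smul_apply, Rat.smul_def]

theorem evalStrip_smul (c : ℚ) (x : QDJY) :
    evalStrip (c • x) = fun z => (c : ℂ) * evalStrip x z := by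
  rw [map_smul]
  funext z
  exact Rat.smul_def _ _

theorem decaying_evalStrip {x : QDJY} (hx : x ∈ endsInYSpan) : Decaying (evalStrip x) := by
  induction hx using Submodule.span_induction with
  | mem x hx =>
    obtain ⟨w, hw, rfl⟩ := hx
    rw [evalStrip_wd]
    exact decaying_wordEval hw
  | zero => rw [map_zero]; exact decaying_zero
  | add x x' _ _ hx hx' => rw [map_add]; exact hx.add hx'
  | smul c x _ hx => rw [evalStrip_smul]; exact hx.const_mul _

theorem evalStrip_y_mul (x : QDJY) :
    Set.EqOn (evalStrip (wd .y * x)) (desKernel * evalStrip x) (strip 1) := fun z hz => by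
  induction x using MonoidAlgebra.induction_linear with
  | zero => simp
  | add x x' hx hx' => rw [mul_add, map_add, map_add, mul_add, Pi.add_apply, Pi.add_apply, hx, hx']
  | single w c =>
    have hw : MonoidAlgebra.single w c = c • wd w := by simp [wd]
    rw [hw, mul_smul_comm, map_smul, map_smul, wd_mul, evalStrip_wd, evalStrip_wd, mul_smul_comm,
      Pi.smul_apply, Pi.smul_apply, Word.y, Word.powY_mul, one_mul, wordEval_powY_zero w hz]

theorem evalStrip_d_mul {x : QDJY} (hx : x ∈ endsInYSpan) :
    Set.EqOn (evalStrip (wd .d * x)) (negDeriv (evalStrip x)) (strip 1) := fun z hz => by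
  induction hx using Submodule.span_induction with
  | mem x hx =>
    obtain ⟨w, hw, rfl⟩ := hx
    rw [wd_mul, evalStrip_wd, evalStrip_wd, wordEval_d_mul hw hz]
  | zero => rw [mul_zero, map_zero, negDeriv_zero]
  | add x x' hx hx' ih ih' =>
    rw [mul_add, map_add, map_add, Pi.add_apply, ih, ih',
      negDeriv_add (decaying_evalStrip hx) (decaying_evalStrip hx') hz, Pi.add_apply]
  | smul c x _ ih =>
    simp only [mul_smul_comm, evalStrip_smul, negDeriv_const_mul, ih]

theorem evalStrip_j_mul {x : QDJY} (hx : x ∈ endsInYSpan) :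
    Set.EqOn (evalStrip (wd .j * x)) (weyl 1 (evalStrip x)) (strip 1) := by
  have hj : wd .j * x ∈ endsInYSpan := pow_mul_mem 1 hx
  have hd : wd .d * (wd .j * x) = x := by
    rw [← mul_assoc, wd_mul, Word.d_mul_j]
    exact one_mul x
  have hderiv := evalStrip_d_mul hj
  rw [hd] at hderiv
  exact ((weyl_congr 1 hderiv).trans (weyl_one_negDeriv (decaying_evalStrip hj))).symm

section Shuffle

variable {x x' : QDJY} {u v : Word}

theorem evalStrip_j_mul_add_j_mul (hu : u.EndsInY) (hv : v.EndsInY)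
    (hx : x ∈ endsInYSpan) (hx' : x' ∈ endsInYSpan)
    (h : Set.EqOn (evalStrip x) (wordEval (.d * u) * wordEval v) (strip 1))
    (h' : Set.EqOn (evalStrip x') (wordEval u * wordEval (.d * v)) (strip 1)) :
    Set.EqOn (evalStrip (wd .j * x + wd .j * x')) (wordEval u * wordEval v) (strip 1) := by
  have hderiv : Set.EqOn (evalStrip (x + x')) (negDeriv (wordEval u * wordEval v)) (strip 1) :=
    fun z hz => by
      rw [map_add, Pi.add_apply, h hz, h' hz, negDeriv_wordEval_mul hu hv hz, Pi.add_apply]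
  rw [← mul_add]
  exact (evalStrip_j_mul (add_mem hx hx')).trans ((weyl_congr 1 hderiv).trans
    (weyl_one_negDeriv ((decaying_wordEval hu).mul (decaying_wordEval hv))))

theorem evalStrip_d_mul_sub (hu : u.EndsInY) (hv : v.EndsInY) (hx : x ∈ endsInYSpan)
    (h : Set.EqOn (evalStrip x) (wordEval u * wordEval v) (strip 1))
    (h' : Set.EqOn (evalStrip x') (wordEval (.d * u) * wordEval v) (strip 1)) :
    Set.EqOn (evalStrip (wd .d * x - x')) (wordEval u * wordEval (.d * v)) (strip 1) :=
  fun z hz => by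
    rw [map_sub, Pi.sub_apply, evalStrip_d_mul hx hz, negDeriv_congr h hz,
      negDeriv_wordEval_mul hu hv hz, h' hz, Pi.add_apply, add_sub_cancel_left]

theorem evalStrip_shWord (U V : Word) : U.last = 0 → V.last = 0 →
    Set.EqOn (evalStrip (shWord U V)) (wordEval U * wordEval V) (strip 1) := by
  induction U, V using shWord.induct with
  | case1 V k hk =>
    intro _ _
    rw [shWord, dif_pos hk, evalStrip_wd, wordEval_pow, one_mul]
    exact Set.eqOn_refl _ _
  | case2 V k u hk ih =>
    intro hU hV z hz
    have hk0 : k = 0 := hk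
    subst hk0
    rw [shWord, dif_pos hk, evalStrip_y_mul _ hz, Pi.mul_apply, ih hU hV hz, Pi.mul_apply,
      Pi.mul_apply, wordEval_powY_zero u hz, Pi.mul_apply, mul_assoc]
  | case3 U hU0 k hk =>
    intro _ _
    rw [shWord, dif_neg hU0, dif_pos hk, evalStrip_wd, wordEval_pow, mul_one]
    exact Set.eqOn_refl _ _
  | case4 U hU0 k v hk ih =>
    intro hU hV z hz
    have hk0 : k = 0 := hk
    subst hk0
    rw [shWord, dif_neg hU0, dif_pos hk, evalStrip_y_mul _ hz, Pi.mul_apply, ih hU hV hz,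
      Pi.mul_apply, Pi.mul_apply, wordEval_powY_zero v hz, Pi.mul_apply, mul_left_comm]
  | case5 U V hU0 hV0 hU1 hV1 ih₁ ih₂ =>
    intro hU hV
    have hU' := Word.endsInY_of_lead_ne_zero hU hU0
    have hV' := Word.endsInY_of_lead_ne_zero hV hV0
    have hdU := hU'.pow_mul (-1)
    have hdV := hV'.pow_mul (-1)
    rw [shWord, dif_neg hU0, dif_neg hV0, dif_pos hU1, dif_pos hV1]
    exact evalStrip_j_mul_add_j_mul hU' hV' (shWord_mem_endsInYSpan_left hdU hV)
      (shWord_mem_endsInYSpan_left hU' hdV.2) (ih₁ hdU.2 hV) (ih₂ hU hdV.2)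
  | case6 U V hU0 hV0 hU1 hV1 ih₁ ih₂ =>
    intro hU hV
    have hU' := Word.endsInY_of_lead_ne_zero hU hU0
    have hjV : (Word.j * V).EndsInY := (Word.endsInY_of_lead_ne_zero hV hV0).pow_mul 1
    rw [shWord, dif_neg hU0, dif_neg hV0, dif_pos hU1, dif_neg hV1]
    simpa only [Word.d_mul_j_mul] using evalStrip_d_mul_sub hU' hjV
      (shWord_mem_endsInYSpan_left hU' hjV.2) (ih₁ hU hjV.2) (ih₂ (hU'.pow_mul (-1)).2 hjV.2)
  | case7 U V hU0 hV0 hU1 ih₁ ih₂ =>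
    intro hU hV
    have hV' := Word.endsInY_of_lead_ne_zero hV hV0
    have hjU : (Word.j * U).EndsInY := (Word.endsInY_of_lead_ne_zero hU hU0).pow_mul 1
    rw [shWord, dif_neg hU0, dif_neg hV0, dif_neg hU1, mul_comm]
    simpa only [Word.d_mul_j_mul] using evalStrip_d_mul_sub hV' hjU
      (shWord_mem_endsInYSpan_left hjU hV) (mul_comm (wordEval V) _ ▸ ih₁ hjU.2 hV)
      (mul_comm (wordEval (Word.d * V)) _ ▸ ih₂ hjU.2 (hV'.pow_mul (-1)).2)

theorem evalStrip_sh (hx : x ∈ admissible) (hx' : x' ∈ admissible) :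
    Set.EqOn (evalStrip (sh x x')) (evalStrip x * evalStrip x') (strip 1) := fun z hz => by
  induction hx, hx' using Submodule.span_induction₂ with
  | mem_mem x x' hx hx' =>
    obtain ⟨u, hu, rfl⟩ := hx
    obtain ⟨v, hv, rfl⟩ := hx'
    rw [sh_wd, evalStrip_wd, evalStrip_wd]
    exact evalStrip_shWord u v ((Word.eq_one_or_endsInY_iff u).1 hu)
      ((Word.eq_one_or_endsInY_iff v).1 hv) hz
  | zero_left => simp
  | zero_right => simp
  | add_left a b c _ _ _ ha hb => simp [add_mul, ha, hb]
  | add_right a b c _ _ _ hb hc => simp [mul_add, hb, hc]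
  | smul_left c a b _ _ h => simp [h]
  | smul_right c a b _ _ h => simp [h]

theorem evalStrip_pow_mul_eq_zero (hx : x ∈ endsInYSpan)
    (h : Set.EqOn (evalStrip x) 0 (strip 1)) (k : ℤ) :
    Set.EqOn (evalStrip (wd (.pow k) * x)) 0 (strip 1) := by
  induction k using Int.induction_on with
  | zero =>
    change Set.EqOn (evalStrip (1 * x)) 0 (strip 1)
    rwa [one_mul]
  | succ k ih =>
    have hk : wd (.pow (k + 1)) * x = wd .j * (wd (.pow k) * x) := by
      rw [← mul_assoc, wd_mul, Word.j, Word.pow_mul, Word.shift, add_comm]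
    rw [hk]
    refine (evalStrip_j_mul (pow_mul_mem _ hx)).trans ((weyl_congr 1 ih).trans ?_)
    simpa only [negDeriv_zero] using weyl_one_negDeriv decaying_zero
  | pred k ih =>
    have hk : wd (.pow (-k - 1)) * x = wd .d * (wd (.pow (-k)) * x) := by
      rw [← mul_assoc, wd_mul, Word.d, Word.pow_mul, Word.shift, sub_eq_add_neg, add_comm]
    rw [hk]
    simpa only [negDeriv_zero] using
      (evalStrip_d_mul (pow_mul_mem _ hx)).trans (negDeriv_congr ih)

theorem leibniz_mem_endsInYSpan (hu : u.EndsInY) (hv : v.EndsInY) :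
    wd .d * sh (wd u) (wd v) - sh (wd .d * wd u) (wd v) - sh (wd u) (wd .d * wd v)
      ∈ endsInYSpan := by
  rw [wd_mul, wd_mul, sh_wd, sh_wd, sh_wd]
  exact sub_mem (sub_mem (pow_mul_mem (-1) (shWord_mem_endsInYSpan_left hu hv.2))
    (shWord_mem_endsInYSpan_right (hu.pow_mul (-1)).2 hv))
    (shWord_mem_endsInYSpan_left hu (hv.pow_mul (-1)).2)

theorem evalStrip_leibniz (hu : u.EndsInY) (hv : v.EndsInY) :
    Set.EqOn (evalStrip (wd .d * sh (wd u) (wd v) - sh (wd .d * wd u) (wd v) -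
      sh (wd u) (wd .d * wd v))) 0 (strip 1) := fun z hz => by
  have hdu := (hu.pow_mul (-1)).2
  have hdv := (hv.pow_mul (-1)).2
  rw [wd_mul, wd_mul, sh_wd, sh_wd, sh_wd, map_sub, map_sub, Pi.sub_apply, Pi.sub_apply,
    evalStrip_d_mul (shWord_mem_endsInYSpan_left hu hv.2) hz,
    negDeriv_congr (evalStrip_shWord u v hu.2 hv.2) hz, negDeriv_wordEval_mul hu hv hz,
    evalStrip_shWord (.d * u) v hdu hv.2 hz, evalStrip_shWord u (.d * v) hu.2 hdv hz,
    Pi.add_apply, add_sub_cancel_left, sub_self, Pi.zero_apply]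

end Shuffle

/-- The algebra homomorphism from `(admissible, ⧢₀)` to the functions on the half strip. -/
def Adm.evalHom : Adm →+* (strip 1 → ℂ) where
  toFun x z := evalStrip x.val z
  map_zero' := by
    funext z
    exact congrFun (map_zero evalStrip) z
  map_one' := by
    funext z
    exact congrFun (evalStrip_wd 1) z
  map_add' x x' := by
    funext z
    exact congrFun (map_add evalStrip x.val x'.val) z
  map_mul' x x' := by
    funext z
    exact evalStrip_sh x.2 x'.2 z.2

theorem ringCon_L_le_ker_evalHom : L.ringCon ≤ RingCon.ker Adm.evalHom := by
  suffices L ≤ TwoSidedIdeal.ker Adm.evalHom from TwoSidedIdeal.ringCon_le_iff.1 this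
  refine TwoSidedIdeal.span_le.2 ?_
  rintro x ⟨k, u, v, hu, hv, hx⟩
  refine (TwoSidedIdeal.mem_ker _).2 (funext fun z => ?_)
  change evalStrip x.val z = 0
  rw [hx]
  exact evalStrip_pow_mul_eq_zero (leibniz_mem_endsInYSpan hu hv) (evalStrip_leibniz hu hv) k z.2

namespace H

/-- The homomorphism induced on `𝓗` by evaluation at `z = 0`, that is, at `t = 1`. -/
def evalHom : H →+* ℂ :=
  (Pi.evalRingHom (fun _ : strip 1 => ℂ) ⟨0, zero_mem_strip one_pos⟩).comp
    (L.ringCon.lift Adm.evalHom ringCon_L_le_ker_evalHom)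

theorem evalHom_word (k : List ℤ) : evalHom (word k) = desZeta k := by
  change evalStrip (wd (Word.ofList k.reverse)) 0 = _
  rw [evalStrip_wd, wordEval, Word.exponents_ofList, desZeta_eq_desLiStrip]

theorem linearMap_ext {M : Type*} [AddCommGroup M] [Module ℚ M] {f g : H →ₗ[ℚ] M}
    (h : ∀ k, f (word k) = g (word k)) : f = g := by
  have eq_on_admissible : ∀ (x : QDJY) (hx : x ∈ admissible),
      f (L.ringCon.mk' ⟨x, hx⟩) = g (L.ringCon.mk' ⟨x, hx⟩) := by
    intro x hx
    induction hx using Submodule.span_induction with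
    | mem x hx =>
      obtain ⟨w, hw, rfl⟩ := hx
      have hw' := Word.ofList_exponents ((Word.eq_one_or_endsInY_iff w).1 hw)
      have hword := h w.exponents.reverse
      simp only [word, Adm.word, List.reverse_reverse, hw'] at hword
      exact hword
    | zero => exact (map_zero f).trans (map_zero g).symm
    | add a b ha hb iha ihb =>
      exact (map_add f _ _).trans ((congrArg₂ (· + ·) iha ihb).trans (map_add g _ _).symm)
    | smul c a ha iha =>
      exact (map_smul f c _).trans ((congrArg (c • ·) iha).trans (map_smul g c _).symm)
  ext x
  induction x using Quotient.inductionOn' with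
  | h x => exact eq_on_admissible x.1 x.2

/-- The map `ζ^des` on `𝓗`. -/
def zeta : H →ₗ[ℚ] ℝ :=
  (Complex.reAddGroupHom.comp (evalHom : H →+ ℂ)).toRatLinearMap

theorem zeta_word (k : List ℤ) : zeta (word k) = (desZeta k).re :=
  congrArg Complex.re (evalHom_word k)

theorem ofReal_zeta (x : H) : (zeta x : ℂ) = evalHom x := by
  have im_eq_zero : (Complex.imAddGroupHom.comp (evalHom : H →+ ℂ)).toRatLinearMap = 0 :=
    linearMap_ext fun k => (congrArg Complex.im (evalHom_word k)).trans (im_desZeta k)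
  exact Complex.ext rfl (DFunLike.congr_fun im_eq_zero x).symm

theorem zeta_one : zeta 1 = 1 :=
  congrArg Complex.re (map_one evalHom)

theorem zeta_mul (x x' : H) : zeta (x * x') = zeta x * zeta x' := by
  rw [← Complex.ofReal_inj, Complex.ofReal_mul, ofReal_zeta, ofReal_zeta, ofReal_zeta, map_mul]

end H

theorem desZeta_mul_desZeta (k l : List ℤ) : desZeta k * desZeta l =
    (coeffs (shWord (Word.ofList k.reverse) (Word.ofList l.reverse))).sum
      fun w c => (c : ℂ) * desZeta w.exponents.reverse := by
  have h := evalStrip_shWord (Word.ofList k.reverse) (Word.ofList l.reverse) (Word.last_ofList _)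
    (Word.last_ofList _) (zero_mem_strip one_pos)
  simpa only [evalStrip_apply, Pi.mul_apply, wordEval, Word.exponents_ofList,
    desZeta_eq_desLiStrip, List.reverse_reverse] using h.symm

end DesMZV

end

open DesMZV in
/-- The linear map `𝓗 → ℝ` with `1 ↦ 1` and
`j^{kᵣ} y ⋯ j^{k₁} y ↦ lim_{t → 1-0} L^des(k₁, …, kᵣ)(t) = ζ^des_r(k₁, …, kᵣ)` exists, is unique and
is a homomorphism of `ℚ`-algebras; hence the shuffle type formula for the values `ζ^des_r`. -/
theorem mainTheorem1 :
    (∀ r : ℕ, IsDesMZF r (desMZF r)) ∧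
    (∃ f : H →ₗ[ℚ] ℝ,
      (f 1 = 1 ∧ ∀ k : List ℤ, Tendsto (desLi k) (𝓝[<] 1) (𝓝 (f (H.word k)))) ∧
      (∀ g : H →ₗ[ℚ] ℝ,
        (g 1 = 1 ∧ ∀ k : List ℤ, Tendsto (desLi k) (𝓝[<] 1) (𝓝 (g (H.word k)))) → g = f) ∧
      (∀ k : List ℤ, (f (H.word k) : ℂ) = desZeta k) ∧
      (∀ x z : H, f (x * z) = f x * f z)) ∧
    (∀ k l : List ℤ,
      desZeta k * desZeta l =
        (coeffs (shWord (Word.ofList k.reverse) (Word.ofList l.reverse))).sum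
          fun w c => (c : ℂ) * desZeta w.exponents.reverse) := by
  have hlim : ∀ k : List ℤ, Tendsto (desLi k) (𝓝[<] 1) (𝓝 (H.zeta (H.word k))) := fun k => by
    rw [H.zeta_word]
    exact tendsto_desLi k
  refine ⟨isDesMZF_desMZF, ⟨H.zeta, ⟨H.zeta_one, hlim⟩, fun g hg => ?_, fun k => ?_, H.zeta_mul⟩,
    desZeta_mul_desZeta⟩
  · exact H.linearMap_ext fun k => tendsto_nhds_unique (hg.2 k) (hlim k)
  · rw [H.ofReal_zeta, H.evalHom_word]
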